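/- Let $\mathbb H=\{z=x+iy: y>0\}$ and, for $k\in\mathbb Z$, let $$\Delta_k = y^2\Big(\frac{\partial^2}{\partial x^2}+\frac{\partial^2}{\partial y^2}\Big) - iky\Big(\frac{\partial}{\partial x}+i\frac{\partial}{\partial y}\Big).$$ For an integer $m\ge 0$ let $V_k^m(0)$ be the complex vector space of $C^\infty$ functions $f:\mathbb H\to\mathbb C$ such that 1. $f\big(\frac{az+b}{cz+d}\big)=(cz+d)^k f(z)$ for all $\begin{pmatrix}a&b\\c&d\end{pmatrix}\in SL_2(\mathbb Z)$ and $z\in\mathbb H$; 2. $\Delta_k^m f=0$; 3. there is $\alpha\in\mathbb R$ with $f(x+iy)=O(y^\alpha)$ as $y\to\infty$, uniformly in $x\in\mathbb R$. Let $V_k^{m+1/2}(0)$ be the space of $C^\infty$ functions $f:\mathbb H\to\mathbb C$ satisfying 1 and 3 for which $\Delta_k^m f$ is a (possibly zero) holomorphic modular form of weight $k$ for $SL_2(\mathbb Z)$, that is, a holomorphic function on $\mathbb H$ satisfying 1 and 3. For $z\in\mathbb H$ and $\mathrm{Re}(s)>1$ let $$\widehat{\widehat{E}}_2(z,s) = (s+1)\,s\,\pi^{-(s+1)}\,\Gamma(s+1)\,\zeta(2s+2)\cdot\frac12\sum_{\substack{(c,d)\in\mathbb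 Z^2\\ \gcd(c,d)=1}}\frac{y^s}{(cz+d)^2|cz+d|^{2s}}.$$ For each $z\in\mathbb H$ this function continues analytically to an entire function of $s$, again denoted $\widehat{\widehat{E}}_2(z,s)$. Define $G_n(z)$ by the Taylor expansion $\widehat{\widehat{E}}_2(z,s)=\sum_{n\ge 0}G_n(z)s^n$ at $s=0$. Theorem. $G_0(z)=0$ for all $z\in\mathbb H$. For every integer $m\ge 0$, $V_2^m(0)=V_2^{m+1/2}(0)$, this space has dimension $m$ over $\mathbb C$, and $G_1,\dots,G_m$ form a basis of it. -/

import Mathlib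

namespace PolyMaass

noncomputable section

open UpperHalfPlane
open scoped MatrixGroups ContDiff Manifold ModularForm

/-- `f : ℍ → ℂ` is a `C^∞` function of the two real variables `x, y`, `z = x + iy`. -/
def IsSmooth (f : ℍ → ℂ) : Prop :=
  ContDiffOn ℝ ∞ (f ∘ ofComplex) {w : ℂ | 0 < w.im}

/-- The directional derivative of `f : ℍ → ℂ` along the real direction `v`. -/
def pd (v : ℂ) (f : ℍ → ℂ) (z : ℍ) : ℂ :=
  fderiv ℝ (f ∘ ofComplex) (z : ℂ) v

/-- `∂f/∂x`. -/
def pdx (f : ℍ → ℂ) : ℍ → ℂ := pd 1 f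

/-- `∂f/∂y`. -/
def pdy (f : ℍ → ℂ) : ℍ → ℂ := pd Complex.I f

/-- The weight `k` hyperbolic Laplacian
`Δ_k = y² (∂²/∂x² + ∂²/∂y²) - i k y (∂/∂x + i ∂/∂y)`. -/
def lap (k : ℤ) (f : ℍ → ℂ) (z : ℍ) : ℂ :=
  (z.im : ℂ) ^ 2 * (pdx (pdx f) z + pdy (pdy f) z)
    - Complex.I * (k : ℂ) * (z.im : ℂ) * (pdx f z + Complex.I * pdy f z)

/-- Moderate growth at the cusp: `f(x + iy) = O(y^α)` for some real `α`, as `y → ∞`,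
uniformly in `x`. -/
def ModerateGrowth (f : ℍ → ℂ) : Prop :=
  ∃ α : ℝ, f =O[atImInfty] fun z : ℍ => z.im ^ α

/-- Weight `k` modular invariance under the full modular group. -/
def IsModular (k : ℤ) (f : ℍ → ℂ) : Prop :=
  ∀ γ : SL(2, ℤ), f ∣[k] γ = f

/-- Smooth functions on `ℍ`, modular of weight `k`, of moderate growth at the cusp. -/
structure IsModerateForm (k : ℤ) (f : ℍ → ℂ) : Prop where
  smooth : IsSmooth f
  modular : IsModular k f
  growth : ModerateGrowth f

/-- Holomorphic modular forms of weight `k` for the full modular group (zero included). -/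
structure IsHolModForm (k : ℤ) (f : ℍ → ℂ) : Prop where
  holo : MDifferentiable 𝓘(ℂ) 𝓘(ℂ) f
  modular : IsModular k f
  growth : ModerateGrowth f

/-! ### Closure properties, needed to form the vector spaces -/

theorem isOpen_im_pos : IsOpen {w : ℂ | 0 < w.im} :=
  isOpen_lt continuous_const Complex.continuous_im

theorem IsSmooth.differentiableAt {f : ℍ → ℂ} (hf : IsSmooth f) (z : ℍ) :
    DifferentiableAt ℝ (f ∘ ofComplex) (z : ℂ) :=
  (hf.differentiableOn (by simp)).differentiableAt (isOpen_im_pos.mem_nhds z.im_pos)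

theorem IsSmooth.zero : IsSmooth 0 :=
  contDiffOn_const (c := (0 : ℂ))

theorem IsSmooth.add {f g : ℍ → ℂ} (hf : IsSmooth f) (hg : IsSmooth g) : IsSmooth (f + g) :=
  ContDiffOn.add hf hg

theorem IsSmooth.smul (c : ℂ) {f : ℍ → ℂ} (hf : IsSmooth f) : IsSmooth (c • f) :=
  ContDiffOn.const_smul c hf

theorem IsSmooth.mul {f g : ℍ → ℂ} (hf : IsSmooth f) (hg : IsSmooth g) : IsSmooth (f * g) :=
  ContDiffOn.mul hf hg

theorem IsSmooth.const (c : ℂ) : IsSmooth fun _ => c :=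
  contDiffOn_const

theorem IsSmooth.im : IsSmooth fun z => (z.im : ℂ) := by
  have h : ContDiff ℝ ∞ fun w : ℂ => ((w.im : ℝ) : ℂ) :=
    Complex.ofRealCLM.contDiff.comp Complex.imCLM.contDiff
  refine h.contDiffOn.congr fun w hw => ?_
  simp only [Function.comp_apply]
  rw [ofComplex_apply_of_im_pos hw]
  rfl

theorem IsSmooth.pd (v : ℂ) {f : ℍ → ℂ} (hf : IsSmooth f) : IsSmooth (pd v f) := by
  have h : ContDiffOn ℝ ∞ (fun w => fderiv ℝ (f ∘ ofComplex) w v) {w : ℂ | 0 < w.im} :=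
    (ContDiffOn.fderiv_of_isOpen hf isOpen_im_pos (by simp)).clm_apply contDiffOn_const
  refine h.congr fun w hw => ?_
  simp only [Function.comp_apply, PolyMaass.pd]
  rw [ofComplex_apply_of_im_pos hw]

theorem pd_add (v : ℂ) {f g : ℍ → ℂ} (hf : IsSmooth f) (hg : IsSmooth g) :
    pd v (f + g) = pd v f + pd v g := by
  ext z
  have h : ((f + g) ∘ ofComplex : ℂ → ℂ) = (f ∘ ofComplex) + (g ∘ ofComplex) := rfl
  simp only [pd, Pi.add_apply]
  rw [h, fderiv_add (hf.differentiableAt z) (hg.differentiableAt z)]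
  rfl

theorem pd_smul (v c : ℂ) {f : ℍ → ℂ} (hf : IsSmooth f) :
    pd v (c • f) = c • pd v f := by
  ext z
  have h : ((c • f) ∘ ofComplex : ℂ → ℂ) = c • (f ∘ ofComplex) := rfl
  simp only [pd, Pi.smul_apply]
  rw [h, fderiv_const_smul (hf.differentiableAt z)]
  rfl

theorem IsSmooth.lap (k : ℤ) {f : ℍ → ℂ} (hf : IsSmooth f) : IsSmooth (lap k f) := by
  have h1 := ((IsSmooth.im.mul IsSmooth.im).mul
    (((hf.pd 1).pd 1).add ((hf.pd Complex.I).pd Complex.I))).add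
    (((IsSmooth.const (-(Complex.I * (k : ℂ)))).mul IsSmooth.im).mul
      ((hf.pd 1).add ((IsSmooth.const Complex.I).mul (hf.pd Complex.I))))
  convert! h1 using 1
  ext z
  simp only [PolyMaass.lap, pdx, pdy, Pi.add_apply, Pi.mul_apply]
  ring

theorem lap_add (k : ℤ) {f g : ℍ → ℂ} (hf : IsSmooth f) (hg : IsSmooth g) :
    lap k (f + g) = lap k f + lap k g := by
  ext z
  simp only [lap, pdx, pdy, pd_add _ hf hg, pd_add _ (hf.pd _) (hg.pd _), Pi.add_apply]
  ring

theorem lap_smul (k : ℤ) (c : ℂ) {f : ℍ → ℂ} (hf : IsSmooth f) :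
    lap k (c • f) = c • lap k f := by
  ext z
  simp only [lap, pdx, pdy, pd_smul _ _ hf, pd_smul _ _ (hf.pd _), Pi.smul_apply, smul_eq_mul]
  ring

theorem IsSmooth.lap_iterate (k : ℤ) {f : ℍ → ℂ} (hf : IsSmooth f) (m : ℕ) :
    IsSmooth ((PolyMaass.lap k)^[m] f) := by
  induction m with
  | zero => exact hf
  | succ m ih => rw [Function.iterate_succ_apply']; exact ih.lap k

theorem lap_iterate_add (k : ℤ) {f g : ℍ → ℂ} (hf : IsSmooth f) (hg : IsSmooth g) (m : ℕ) :
    (lap k)^[m] (f + g) = (lap k)^[m] f + (lap k)^[m] g := by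
  induction m with
  | zero => rfl
  | succ m ih =>
    simp only [Function.iterate_succ_apply', ih]
    exact lap_add k (hf.lap_iterate k m) (hg.lap_iterate k m)

theorem lap_iterate_smul (k : ℤ) (c : ℂ) {f : ℍ → ℂ} (hf : IsSmooth f) (m : ℕ) :
    (lap k)^[m] (c • f) = c • (lap k)^[m] f := by
  induction m with
  | zero => rfl
  | succ m ih =>
    simp only [Function.iterate_succ_apply', ih]
    exact lap_smul k c (hf.lap_iterate k m)

theorem lap_iterate_zero (k : ℤ) (m : ℕ) : (lap k)^[m] (0 : ℍ → ℂ) = 0 := by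
  simpa using lap_iterate_smul k 0 IsSmooth.zero m

theorem ModerateGrowth.zero : ModerateGrowth 0 :=
  ⟨0, Asymptotics.isBigO_zero _ _⟩

theorem ModerateGrowth.smul (c : ℂ) {f : ℍ → ℂ} (hf : ModerateGrowth f) :
    ModerateGrowth (c • f) := by
  obtain ⟨a, ha⟩ := hf
  exact ⟨a, ha.const_smul_left c⟩

theorem rpow_isBigO_of_le {a b : ℝ} (h : a ≤ b) :
    (fun z : ℍ => z.im ^ a) =O[atImInfty] fun z : ℍ => z.im ^ b := by
  refine Asymptotics.IsBigO.of_bound 1 ?_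
  have h1 : ∀ᶠ z : ℍ in atImInfty, 1 ≤ z.im :=
    (Filter.tendsto_comap (f := UpperHalfPlane.im)).eventually (Filter.eventually_ge_atTop 1)
  filter_upwards [h1] with z hz
  rw [one_mul, Real.norm_of_nonneg (Real.rpow_nonneg z.im_pos.le _),
    Real.norm_of_nonneg (Real.rpow_nonneg z.im_pos.le _)]
  exact Real.rpow_le_rpow_of_exponent_le hz h

theorem ModerateGrowth.add {f g : ℍ → ℂ} (hf : ModerateGrowth f) (hg : ModerateGrowth g) :
    ModerateGrowth (f + g) := by
  obtain ⟨a, ha⟩ := hf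
  obtain ⟨b, hb⟩ := hg
  exact ⟨max a b, (ha.trans (rpow_isBigO_of_le (le_max_left a b))).add
    (hb.trans (rpow_isBigO_of_le (le_max_right a b)))⟩

theorem IsModular.zero (k : ℤ) : IsModular k 0 := fun γ => SlashAction.zero_slash k γ

theorem IsModular.add {k : ℤ} {f g : ℍ → ℂ} (hf : IsModular k f) (hg : IsModular k g) :
    IsModular k (f + g) := fun γ => by
  rw [SlashAction.add_slash, hf γ, hg γ]

theorem IsModular.smul {k : ℤ} (c : ℂ) {f : ℍ → ℂ} (hf : IsModular k f) :
    IsModular k (c • f) := fun γ => by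
  rw [ModularForm.SL_smul_slash, hf γ]

theorem IsModerateForm.zero (k : ℤ) : IsModerateForm k 0 :=
  ⟨IsSmooth.zero, IsModular.zero k, ModerateGrowth.zero⟩

theorem IsModerateForm.add {k : ℤ} {f g : ℍ → ℂ} (hf : IsModerateForm k f)
    (hg : IsModerateForm k g) : IsModerateForm k (f + g) :=
  ⟨hf.smooth.add hg.smooth, hf.modular.add hg.modular, hf.growth.add hg.growth⟩

theorem IsModerateForm.smul {k : ℤ} (c : ℂ) {f : ℍ → ℂ} (hf : IsModerateForm k f) :
    IsModerateForm k (c • f) :=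
  ⟨hf.smooth.smul c, hf.modular.smul c, hf.growth.smul c⟩

theorem IsHolModForm.zero (k : ℤ) : IsHolModForm k 0 :=
  ⟨mdifferentiable_const (c := (0 : ℂ)), IsModular.zero k, ModerateGrowth.zero⟩

theorem IsHolModForm.add {k : ℤ} {f g : ℍ → ℂ} (hf : IsHolModForm k f)
    (hg : IsHolModForm k g) : IsHolModForm k (f + g) :=
  ⟨hf.holo.add hg.holo, hf.modular.add hg.modular, hf.growth.add hg.growth⟩

theorem IsHolModForm.smul {k : ℤ} (c : ℂ) {f : ℍ → ℂ} (hf : IsHolModForm k f) :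
    IsHolModForm k (c • f) :=
  ⟨hf.holo.const_smul c, hf.modular.smul c, hf.growth.smul c⟩

/-! ### The spaces of polyharmonic Maass forms -/

/-- `V_k^m(0)` for an integer depth `m`: the weight `k` forms of moderate growth
with `Δ_k^m f = 0`. -/
def V (k : ℤ) (m : ℕ) : Submodule ℂ (ℍ → ℂ) where
  carrier := {f | IsModerateForm k f ∧ (lap k)^[m] f = 0}
  zero_mem' := ⟨IsModerateForm.zero k, lap_iterate_zero k m⟩
  add_mem' := fun {f g} hf hg => ⟨hf.1.add hg.1, by
    rw [lap_iterate_add k hf.1.smooth hg.1.smooth, hf.2, hg.2, add_zero]⟩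
  smul_mem' := fun c f hf => ⟨hf.1.smul c, by
    rw [lap_iterate_smul k c hf.1.smooth, hf.2, smul_zero]⟩

/-- `V_k^{m+1/2}(0)`: the weight `k` forms of moderate growth for which `Δ_k^m f` is a
holomorphic modular form of weight `k`. -/
def VHalf (k : ℤ) (m : ℕ) : Submodule ℂ (ℍ → ℂ) where
  carrier := {f | IsModerateForm k f ∧ IsHolModForm k ((lap k)^[m] f)}
  zero_mem' := ⟨IsModerateForm.zero k, by
    rw [lap_iterate_zero]; exact IsHolModForm.zero k⟩
  add_mem' := fun {f g} hf hg => ⟨hf.1.add hg.1, by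
    rw [lap_iterate_add k hf.1.smooth hg.1.smooth]; exact hf.2.add hg.2⟩
  smul_mem' := fun c f hf => ⟨hf.1.smul c, by
    rw [lap_iterate_smul k c hf.1.smooth]; exact hf.2.smul c⟩

/-! ### The doubly-completed weight 2 Eisenstein series -/

/-- The defining expression of the doubly-completed weight 2 Eisenstein series
`(s+1) s π^{-(s+1)} Γ(s+1) ζ(2s+2) · ½ ∑_{(c,d)=1} y^s / ((cz+d)² |cz+d|^{2s})`,
where `(c,d)` runs over all coprime pairs of integers. The sum converges absolutely
for `Re s > 0`. -/
def eisSeries2 (z : ℍ) (s : ℂ) : ℂ :=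
  (s + 1) * s * (Real.pi : ℂ) ^ (-(s + 1)) * Complex.Gamma (s + 1) * riemannZeta (2 * s + 2) *
    ((1 / 2) * ∑' p : {p : ℤ × ℤ // IsCoprime p.1 p.2},
      (z.im : ℂ) ^ s /
        (((p.1.1 : ℂ) * (z : ℂ) + (p.1.2 : ℂ)) ^ 2 *
          ((‖(p.1.1 : ℂ) * (z : ℂ) + (p.1.2 : ℂ)‖ : ℝ) : ℂ) ^ (2 * s)))

/-- `g` is the analytic continuation to all `s ∈ ℂ` of the doubly-completed weight 2 Eisenstein
series at `z`. There is at most one such `g`, by the identity theorem. -/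
structure IsContinuation (z : ℍ) (g : ℂ → ℂ) : Prop where
  entire : Differentiable ℂ g
  eq_series : ∀ s : ℂ, 1 < s.re → g s = eisSeries2 z s

/-- The analytically continued doubly-completed weight 2 Eisenstein series. (The existence of the
continuation is not built into the definition; it is asserted by `IsContinuation z (E2 z)`.) -/
def E2 (z : ℍ) : ℂ → ℂ :=
  Classical.epsilon fun g : ℂ → ℂ => IsContinuation z g

/-- The Taylor coefficients `G_n(z)` in `s` at `s = 0`. -/
def G (n : ℕ) (z : ℍ) : ℂ :=
  iteratedDeriv n (E2 z) 0 / (n.factorial : ℂ)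

end

end PolyMaass

/-! The upper bound on the dimension rests on the factorisation Δ₂ = 4 ∂_z ∘ (y² ∂_z̄)
(`lap_two_eq`), whose inner operator maps weight 2 to weight 0. If Δ₂h = 0, then the conjugate of y²
∂h/∂z̄ is a holomorphic form of weight 0, hence constant. If that constant is 0, then h is a
holomorphic form of weight 2, hence 0. So the harmonic forms span at most a line
(`IsWeakForm.exists_eq_smul`). This has to be applied to h = Δ₂^m f, but moderate growth of f gives
no pointwise bound on its derivatives. Growth is therefore measured by pairing with rescaled test
functions (`WeakGrowth`): integration by parts makes this notion stable under differentiation, and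
for holomorphic functions the mean value property turns it back into pointwise growth.

The existence half realises the Eisenstein series as a Mellin transform. With R = (c z̄ + d)/y and Q
= |cz + d|²/y, put θ(t) = ∑ R² e^{-πtQ}. The term at (c,d) = 0 vanishes, and Poisson summation gives
θ(1/t) = t³ θ(t) with no correction terms (`theta_inv`). Folding the Mellin integral at t = 1 shows
that the completed series equals (π/2) s ∫₁^∞ (t^{s+1} + t^{-s}) θ(t) dt, which is entire in s.
Hence G₀ = 0, and G_{n+1} is π/(2 n!) times the integral of θ against w_n(t) = (t + (-1)ⁿ)(log t)ⁿ
(`G_succ`).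

On each theta term Δ₂ acts as F ↦ (t² F)'' in the variable t (`lap_eisKernel`). Two integrations by
parts move this to t² d²/dt² acting on the weight. That operator multiplies t^{s+1} + t^{-s} by
s(s+1), so it sends w_n to n w_{n-1} + n(n-1) w_{n-2}. The boundary terms at t = 1 vanish termwise
for n ≥ 1; for n = 0 they sum to zero because differentiating the functional equation at 1 gives
3θ(1) + 2θ'(1) = 0. Consequently Δ₂G₁ = 0 and Δ₂G_{n+2} = G_{n+1} + G_n.

Finally G₁ ≠ 0, by an estimate at z = 2i. Since Δ₂^m G_{m+1} = G₁ while Δ₂^m kills G₀, …, G_m, both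
spanning and independence follow by triangularity. The half-integral spaces add nothing, because
there are no nonzero holomorphic forms of weight 2. -/

namespace PolyMaass

noncomputable section

open UpperHalfPlane
open scoped MatrixGroups ContDiff Manifold ModularForm ComplexConjugate

/-! ### Wirtinger calculus on the upper half-plane -/

/-- The real-linear map `v ↦ a v + b v̄`. -/
def wirtingerCLM (a b : ℂ) : ℂ →L[ℝ] ℂ :=
  a • (1 : ℂ →L[ℝ] ℂ) + b • (Complex.conjCLE : ℂ →L[ℝ] ℂ)

theorem wirtingerCLM_apply (a b v : ℂ) : wirtingerCLM a b v = a * v + b * conj v := by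
  simp [wirtingerCLM]

/-- `f` is real differentiable at `z` with `∂f/∂z = a` and `∂f/∂z̄ = b`. -/
def HasWirtinger (f : ℍ → ℂ) (z : ℍ) (a b : ℂ) : Prop :=
  HasFDerivAt (f ∘ ofComplex) (wirtingerCLM a b) (z : ℂ)

/-- The Wirtinger derivative `∂f/∂z`. -/
def dz (f : ℍ → ℂ) (z : ℍ) : ℂ := (pdx f z - Complex.I * pdy f z) / 2

/-- The Wirtinger derivative `∂f/∂z̄`. -/
def dzb (f : ℍ → ℂ) (z : ℍ) : ℂ := (pdx f z + Complex.I * pdy f z) / 2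

theorem clm_eq_wirtinger (T : ℂ →L[ℝ] ℂ) :
    T = wirtingerCLM ((T 1 - Complex.I * T Complex.I) / 2)
      ((T 1 + Complex.I * T Complex.I) / 2) := by
  ext v
  have hv : T v = v.re * T 1 + v.im * T Complex.I := by
    conv_lhs => rw [show v = v.re • (1 : ℂ) + v.im • Complex.I by simp]
    rw [map_add, map_smul, map_smul]; simp
  rw [hv, wirtingerCLM_apply]
  have h1 : v = v.re + v.im * Complex.I := (Complex.re_add_im v).symm
  have h2 : conj v = v.re - v.im * Complex.I := by
    apply Complex.ext <;> simp
  rw [h2]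
  nth_rewrite 3 [h1]
  linear_combination ((T Complex.I) * v.im) * Complex.I_sq

theorem IsSmooth.hasWirtinger {f : ℍ → ℂ} (hf : IsSmooth f) (z : ℍ) :
    HasWirtinger f z (dz f z) (dzb f z) := by
  have := (hf.differentiableAt z).hasFDerivAt
  rw [clm_eq_wirtinger (fderiv ℝ (f ∘ ofComplex) z)] at this
  exact this

theorem HasWirtinger.pd {f : ℍ → ℂ} {z : ℍ} {a b : ℂ} (h : HasWirtinger f z a b) (v : ℂ) :
    pd v f z = a * v + b * conj v := by
  rw [PolyMaass.pd, HasFDerivAt.fderiv h, wirtingerCLM_apply]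

theorem HasWirtinger.dz {f : ℍ → ℂ} {z : ℍ} {a b : ℂ} (h : HasWirtinger f z a b) :
    dz f z = a := by
  simp only [PolyMaass.dz, pdx, pdy, h.pd, map_one, Complex.conj_I]
  linear_combination (-a / 2 + b / 2) * Complex.I_sq

theorem HasWirtinger.dzb {f : ℍ → ℂ} {z : ℍ} {a b : ℂ} (h : HasWirtinger f z a b) :
    dzb f z = b := by
  simp only [PolyMaass.dzb, pdx, pdy, h.pd, map_one, Complex.conj_I]
  linear_combination (a / 2 - b / 2) * Complex.I_sq

theorem HasWirtinger.mul {f g : ℍ → ℂ} {z : ℍ} {a b c d : ℂ} (hf : HasWirtinger f z a b)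
    (hg : HasWirtinger g z c d) :
    HasWirtinger (f * g) z (f z * c + g z * a) (f z * d + g z * b) := by
  have h := HasFDerivAt.mul hf hg
  have e : (f * g) ∘ ofComplex = (f ∘ ofComplex) * (g ∘ ofComplex) := rfl
  rw [HasWirtinger, e]
  convert! h using 1
  ext v
  simp [wirtingerCLM]
  ring

theorem HasWirtinger.add {f g : ℍ → ℂ} {z : ℍ} {a b c d : ℂ} (hf : HasWirtinger f z a b)
    (hg : HasWirtinger g z c d) : HasWirtinger (f + g) z (a + c) (b + d) := by
  have h := HasFDerivAt.add hf hg
  have e : (f + g) ∘ ofComplex = (f ∘ ofComplex) + (g ∘ ofComplex) := rfl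
  rw [HasWirtinger, e]
  convert! h using 1
  ext v
  simp [wirtingerCLM]
  ring

theorem HasWirtinger.comp {f : ℍ → ℂ} {z : ℍ} {a b : ℂ} (hf : HasWirtinger f z a b)
    {g : ℂ → ℂ} {g' : ℂ} (hg : HasDerivAt g g' (f z)) :
    HasWirtinger (g ∘ f) z (g' * a) (g' * b) := by
  have h0 : HasDerivAt g g' ((f ∘ ofComplex) (z : ℂ)) := by simpa using hg
  have h := (h0.hasFDerivAt.restrictScalars ℝ).comp (z : ℂ) hf
  rw [HasWirtinger, Function.comp_assoc]
  convert! h using 1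
  ext v
  simp [wirtingerCLM]
  ring

theorem HasWirtinger.const (c : ℂ) (z : ℍ) : HasWirtinger (fun _ => c) z 0 0 := by
  have h := hasFDerivAt_const (𝕜 := ℝ) c (z : ℂ)
  rw [HasWirtinger]
  convert! h using 1
  ext v
  simp [wirtingerCLM]

theorem HasWirtinger.of_clm (T : ℂ →L[ℝ] ℂ) {f : ℍ → ℂ} (hf : ∀ z : ℍ, f z = T z) (z : ℍ)
    {a b : ℂ} (hT : T = wirtingerCLM a b) : HasWirtinger f z a b := by
  rw [HasWirtinger, ← hT]
  refine T.hasFDerivAt.congr_of_eventuallyEq ?_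
  filter_upwards [isOpen_im_pos.mem_nhds z.im_pos] with w hw
  simp only [Function.comp_apply, hf]
  rw [ofComplex_apply_of_im_pos hw]

theorem IsSmooth.of_clm (T : ℂ →L[ℝ] ℂ) {f : ℍ → ℂ} (hf : ∀ z : ℍ, f z = T z) : IsSmooth f := by
  refine T.contDiff.contDiffOn.congr fun w hw => ?_
  simp only [Function.comp_apply, hf]
  rw [ofComplex_apply_of_im_pos hw]

theorem hasWirtinger_coe (z : ℍ) : HasWirtinger (fun z => (z : ℂ)) z 1 0 :=
  .of_clm (1 : ℂ →L[ℝ] ℂ) (fun _ => rfl) z (by ext v; simp [wirtingerCLM])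

theorem hasWirtinger_conj (z : ℍ) : HasWirtinger (fun z => conj (z : ℂ)) z 0 1 :=
  .of_clm (Complex.conjCLE : ℂ →L[ℝ] ℂ) (fun _ => rfl) z (by ext v; simp [wirtingerCLM])

theorem hasWirtinger_im (z : ℍ) :
    HasWirtinger (fun z => (z.im : ℂ)) z (-Complex.I / 2) (Complex.I / 2) := by
  refine .of_clm (Complex.ofRealCLM ∘L Complex.imCLM) (fun _ => rfl) z ?_
  ext v
  rw [wirtingerCLM_apply]
  apply Complex.ext <;> simp <;> ring

theorem IsSmooth.conj_coe : IsSmooth fun z => conj (z : ℂ) :=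
  .of_clm (Complex.conjCLE : ℂ →L[ℝ] ℂ) fun _ => rfl

theorem IsSmooth.inv {f : ℍ → ℂ} (hf : IsSmooth f) (h0 : ∀ z, f z ≠ 0) : IsSmooth f⁻¹ :=
  ContDiffOn.inv hf fun _ _ => h0 _

theorem IsSmooth.dzb {f : ℍ → ℂ} (hf : IsSmooth f) : IsSmooth (dzb f) := by
  have h := ((hf.pd 1).add ((hf.pd Complex.I).smul Complex.I)).smul (1 / 2)
  convert! h using 1
  ext z
  simp only [PolyMaass.dzb, pdx, pdy, Pi.smul_apply, Pi.add_apply, smul_eq_mul]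
  ring

theorem dzb_add {f g : ℍ → ℂ} (hf : IsSmooth f) (hg : IsSmooth g) :
    dzb (f + g) = dzb f + dzb g := by
  ext z
  exact ((hf.hasWirtinger z).add (hg.hasWirtinger z)).dzb

theorem dzb_smul (c : ℂ) {f : ℍ → ℂ} (hf : IsSmooth f) : dzb (c • f) = c • dzb f := by
  ext z
  have h := ((HasWirtinger.const c z).mul (hf.hasWirtinger z)).dzb
  simp only [mul_zero, add_zero] at h
  exact h

/-- Symmetry of the second derivative; needed because the factored Laplacian produces both mixed
partials, which must cancel. -/
theorem pd_comm (v w : ℂ) {f : ℍ → ℂ} (hf : IsSmooth f) : pd v (pd w f) = pd w (pd v f) := by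
  have key : ∀ (v w : ℂ) (z : ℍ), pd v (pd w f) z
      = fderiv ℝ (fderiv ℝ (f ∘ ofComplex)) (z : ℂ) v w := by
    intro v w z
    have hd : DifferentiableAt ℝ (fderiv ℝ (f ∘ ofComplex)) (z : ℂ) :=
      ((ContDiffOn.fderiv_of_isOpen (m := ∞) hf isOpen_im_pos (by simp)).differentiableOn
        (by simp)).differentiableAt (isOpen_im_pos.mem_nhds z.im_pos)
    have e : (pd w f ∘ ofComplex) =ᶠ[nhds (z : ℂ)] fun u => fderiv ℝ (f ∘ ofComplex) u w := by
      filter_upwards [isOpen_im_pos.mem_nhds z.im_pos] with u hu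
      simp only [Function.comp_apply, pd]
      rw [ofComplex_apply_of_im_pos hu]
    rw [pd, e.fderiv_eq, fderiv_clm_apply hd (by fun_prop)]
    simp
  ext z
  rw [key, key]
  exact (((hf.contDiffAt (isOpen_im_pos.mem_nhds z.im_pos)).isSymmSndFDerivAt
    (by simpa using (WithTop.coe_le_coe.mpr le_top : ((2 : ℕ∞) : ℕ∞ω) ≤ ∞))) v w)

/-- The weight lowering operator `y² ∂/∂z̄`. -/
def lower (f : ℍ → ℂ) (z : ℍ) : ℂ := (z.im : ℂ) ^ 2 * dzb f z

theorem lower_eq (f : ℍ → ℂ) :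
    lower f = ((fun z : ℍ => (z.im : ℂ)) * fun z => (z.im : ℂ)) * dzb f := by
  ext z; simp [lower, sq]

theorem IsSmooth.lower {f : ℍ → ℂ} (hf : IsSmooth f) : IsSmooth (lower f) := by
  rw [lower_eq]
  exact (IsSmooth.im.mul IsSmooth.im).mul hf.dzb

/-- Expanding the right side by Leibniz with ∂y/∂z = -i/2, the second-order part is y² times the
Euclidean Laplacian and the derivative of y² produces exactly the first-order term for k = 2. -/
theorem lap_two_eq {f : ℍ → ℂ} (hf : IsSmooth f) (z : ℍ) : lap 2 f z = 4 * dz (lower f) z := by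
  have hpd : ∀ v, pd v (dzb f) z = (pd v (pdx f) z + Complex.I * pd v (pdy f) z) / 2 := by
    intro v
    have e : dzb f = (1 / 2 : ℂ) • (pdx f + Complex.I • pdy f) := by
      ext z
      simp only [dzb, Pi.smul_apply, Pi.add_apply, smul_eq_mul]
      ring
    have hx : IsSmooth (pdx f) := hf.pd 1
    have hy : IsSmooth (pdy f) := hf.pd Complex.I
    rw [e, pd_smul _ _ (hx.add (hy.smul _)), pd_add _ hx (hy.smul _), pd_smul _ _ hy]
    simp only [Pi.smul_apply, Pi.add_apply, smul_eq_mul]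
    ring
  have h1 := (((hasWirtinger_im z).mul (hasWirtinger_im z)).mul (hf.dzb.hasWirtinger z)).dz
  rw [← lower_eq] at h1
  rw [h1, dz, pdx, pdy, hpd, hpd]
  have hc : pd Complex.I (pdx f) z = pd 1 (pdy f) z := by
    simp only [pdx, pdy]; rw [pd_comm _ _ hf]
  rw [hc]
  simp only [lap, dzb, pdx, pdy, Pi.mul_apply]
  push_cast
  linear_combination ((z.im : ℂ) ^ 2 * pd Complex.I (pd Complex.I f) z) * Complex.I_sq

theorem mdifferentiable_of_dzb_eq_zero {f : ℍ → ℂ} (hf : IsSmooth f) (h : ∀ z, dzb f z = 0) :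
    MDifferentiable 𝓘(ℂ) 𝓘(ℂ) f := by
  intro z
  rw [UpperHalfPlane.mdifferentiableAt_iff, differentiableAt_complex_iff_differentiableAt_real]
  refine ⟨hf.differentiableAt z, ?_⟩
  have h1 := h z
  simp only [dzb, pdx, pdy, pd] at h1
  rw [smul_eq_mul]
  linear_combination -2 * Complex.I * h1 + (fderiv ℝ (f ∘ ofComplex) z Complex.I) * Complex.I_sq

theorem HasWirtinger.conj {f : ℍ → ℂ} {z : ℍ} {a b : ℂ} (hf : HasWirtinger f z a b) :
    HasWirtinger (fun z => conj (f z)) z (conj b) (conj a) := by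
  have h := (Complex.conjCLE : ℂ →L[ℝ] ℂ).hasFDerivAt.comp (z : ℂ) hf
  rw [HasWirtinger]
  convert! h using 1
  ext v
  simp [wirtingerCLM]
  ring

theorem IsSmooth.conj {f : ℍ → ℂ} (hf : IsSmooth f) : IsSmooth fun z => conj (f z) :=
  (Complex.conjCLE : ℂ →L[ℝ] ℂ).contDiff.comp_contDiffOn hf

/-! ### The action of the modular group -/

/-- Chain rule: the Möbius map is holomorphic with derivative `denom⁻²`, so ∂_z picks up that factor
and ∂_z̄ its conjugate. -/
theorem hasWirtinger_comp_smul {f : ℍ → ℂ} (γ : SL(2, ℤ)) {z : ℍ} {a b : ℂ}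
    (hf : HasWirtinger f (γ • z) a b) :
    HasWirtinger (fun z => f (γ • z)) z (a * ((denom γ z) ^ 2)⁻¹)
      (b * conj ((denom γ z) ^ 2)⁻¹) := by
  have hdet : ((γ : GL (Fin 2) ℝ)).val.det = 1 := Matrix.SpecialLinearGroup.det_coe _
  have hg : (0 : ℝ) < ((γ : GL (Fin 2) ℝ)).val.det := hdet ▸ one_pos
  have h1 := (hasStrictDerivAt_smul hg z).hasDerivAt.hasFDerivAt.restrictScalars ℝ
  rw [hdet] at h1
  have h0 : HasFDerivAt (f ∘ ofComplex) (wirtingerCLM a b)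
      (((γ : GL (Fin 2) ℝ) • ofComplex (z : ℂ) : ℍ) : ℂ) := by
    rw [ofComplex_apply]; exact hf
  have h := h0.comp (z : ℂ) h1
  rw [HasWirtinger]
  convert! h using 1
  · ext w
    simp only [Function.comp_apply, ofComplex_apply]
    rfl
  · ext v
    simp [wirtingerCLM]
    ring

theorem IsModular.apply_smul {k : ℤ} {f : ℍ → ℂ} (hf : IsModular k f) (γ : SL(2, ℤ)) (z : ℍ) :
    f (γ • z) = denom γ z ^ k * f z := by
  have h := congrFun (hf γ) z
  rw [ModularForm.SL_slash_apply] at h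
  rw [← h, mul_comm, mul_assoc, ← zpow_add₀ (denom_ne_zero γ z)]
  simp

theorem isModular_of_apply_smul {k : ℤ} {f : ℍ → ℂ}
    (hf : ∀ (γ : SL(2, ℤ)) (z : ℍ), f (γ • z) = denom γ z ^ k * f z) : IsModular k f := by
  intro γ
  ext z
  rw [ModularForm.SL_slash_apply, hf, mul_comm, ← mul_assoc, ← zpow_add₀ (denom_ne_zero γ z)]
  simp

theorem hasWirtinger_denom_zpow (γ : SL(2, ℤ)) (k : ℤ) (z : ℍ) :
    ∃ a, HasWirtinger (fun z => denom γ z ^ k) z a 0 := by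
  have h := (hasDerivAt_denom_zpow (γ : GL (Fin 2) ℝ) k z).hasFDerivAt.restrictScalars ℝ
  refine ⟨k * (γ : GL (Fin 2) ℝ) 1 0 * denom γ z ^ (k - 1),
    (h.congr_of_eventuallyEq ?_).congr_fderiv ?_⟩
  · filter_upwards [isOpen_im_pos.mem_nhds z.im_pos] with w hw
    simp only [Function.comp_apply]
    rw [ofComplex_apply_of_im_pos hw]
  · ext v
    simp [wirtingerCLM]
    ring

/-- The automorphy factor is holomorphic, so ∂f/∂z̄ transforms by j² j̄² with j the denominator, and
y² transforms by the inverse (j j̄)⁻². -/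
theorem IsModular.lower {f : ℍ → ℂ} (hs : IsSmooth f) (hf : IsModular 2 f) :
    IsModular 0 (lower f) := by
  refine isModular_of_apply_smul fun γ z => ?_
  obtain ⟨a, ha⟩ := hasWirtinger_denom_zpow γ 2 z
  have h1 := (hasWirtinger_comp_smul γ (hs.hasWirtinger (γ • z))).dzb
  have h2 := (ha.mul (hs.hasWirtinger z)).dzb
  have e : (fun z => f (γ • z)) = (fun z : ℍ => denom γ z ^ (2 : ℤ)) * f := by
    ext z; exact hf.apply_smul γ z
  rw [e, h2] at h1
  have hd : denom γ z ≠ 0 := denom_ne_zero _ _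
  have hd' : conj (denom γ z) ≠ 0 := by simp [hd]
  have h3 : dzb f (γ • z) = denom γ z ^ 2 * conj (denom γ z) ^ 2 * dzb f z := by
    simp only [map_inv₀, map_pow, mul_zero, add_zero] at h1
    field_simp at h1
    rw [← h1]
    ring
  have h4 : ((γ • z).im : ℂ) = z.im / (denom γ z * conj (denom γ z)) := by
    rw [Complex.mul_conj, ModularGroup.im_smul_eq_div_normSq]
    push_cast
    rfl
  simp only [PolyMaass.lower]
  rw [h3, h4]
  field_simp

theorem IsModular.dz {f : ℍ → ℂ} (hs : IsSmooth f) (hf : IsModular 0 f) :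
    IsModular 2 (dz f) := by
  refine isModular_of_apply_smul fun γ z => ?_
  have h1 := (hasWirtinger_comp_smul γ (hs.hasWirtinger (γ • z))).dz
  have e : (fun z => f (γ • z)) = f := by
    ext z; simpa using hf.apply_smul γ z
  rw [e] at h1
  have hd : denom γ z ≠ 0 := denom_ne_zero _ _
  rw [h1, zpow_ofNat]
  field_simp

theorem IsModular.lap {f : ℍ → ℂ} (hs : IsSmooth f) (hf : IsModular 2 f) :
    IsModular 2 (lap 2 f) := by
  have e : PolyMaass.lap 2 f = (4 : ℂ) • PolyMaass.dz (PolyMaass.lower f) := by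
    ext z; exact lap_two_eq hs z
  rw [e]
  exact ((hf.lower hs).dz hs.lower).smul 4

end

end PolyMaass

/-! ### Uniqueness: weight two harmonic forms of moderate growth up to scalars -/

namespace PolyMaass

noncomputable section

open UpperHalfPlane Filter Topology
open scoped MatrixGroups ContDiff Manifold ModularForm ComplexConjugate

/-! ### Holomorphic modular forms of moderate growth -/

theorem IsModular.vadd_one {k : ℤ} {f : ℍ → ℂ} (hf : IsModular k f) (z : ℍ) :
    f ((1 : ℝ) +ᵥ z) = f z := by
  have h := hf.apply_smul ModularGroup.T z
  have h1 : denom ModularGroup.T z = 1 := by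
    rw [ModularGroup.denom_apply]
    simp [ModularGroup.T]
  rw [h1, modular_T_smul] at h
  simpa using h

theorem IsModular.periodic {k : ℤ} {f : ℍ → ℂ} (hf : IsModular k f) :
    Function.Periodic (f ∘ ofComplex) (1 : ℝ) := by
  intro w
  by_cases! hw : 0 < w.im
  · have h1 : 0 < (w + (1 : ℝ)).im := by simp [hw]
    simp only [Function.comp_apply, ofComplex_apply_of_im_pos h1, ofComplex_apply_of_im_pos hw]
    rw [← hf.vadd_one ⟨w, hw⟩]
    congr 1
    ext
    simp [add_comm]
  · have h1 : (w + (1 : ℝ)).im ≤ 0 := by simpa using hw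
    simp only [Function.comp_apply, ofComplex_apply_of_im_nonpos h1,
      ofComplex_apply_of_im_nonpos hw]

/-- In the variable q = e^{2πiz} polynomial growth in y is o(1/|q|), so the singularity of the cusp
function at q = 0 is removable. This upgrades moderate growth to the boundedness required of a
modular form. -/
theorem IsHolModForm.isBoundedAtImInfty {k : ℤ} {f : ℍ → ℂ} (hf : IsHolModForm k f) :
    IsBoundedAtImInfty f := by
  set F := f ∘ ofComplex with hF
  have hper : Function.Periodic F (1 : ℝ) := hf.modular.periodic
  have hhol : ∀ᶠ z in comap Complex.im atTop, DifferentiableAt ℂ F z := by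
    filter_upwards [preimage_mem_comap (Ioi_mem_atTop 0)] with z hz
    exact ((UpperHalfPlane.mdifferentiable_iff.mp hf.holo) z hz).differentiableAt
      (isOpen_im_pos.mem_nhds hz)
  have hC := Function.Periodic.eventually_differentiableAt_cuspFunction_nhds_ne_zero one_pos
    hper hhol
  obtain ⟨α, hα⟩ := hf.growth
  have h1 : F =o[comap Complex.im atTop]
      fun w => (Function.Periodic.qParam (1 : ℝ) w)⁻¹ := by
    have h2 : F =O[comap Complex.im atTop] fun w => w.im ^ α := by
      refine (hα.comp_tendsto tendsto_comap_im_ofComplex).congr' .rfl ?_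
      filter_upwards [preimage_mem_comap (Ioi_mem_atTop 0)] with z hz
      simp only [Function.comp_apply]
      rw [ofComplex_apply_of_im_pos hz]
      rfl
    have h3 := (isLittleO_rpow_exp_pos_mul_atTop α Real.two_pi_pos).comp_tendsto
      (tendsto_comap (f := Complex.im))
    refine (h2.trans_isLittleO h3).trans_isBigO (Asymptotics.isBigO_of_le _ fun w => ?_)
    rw [norm_inv, Function.Periodic.norm_qParam, ← Real.exp_neg]
    simp only [Function.comp_apply, Real.norm_eq_abs, Real.abs_exp]
    gcongr
    simp
  have h4 : Function.Periodic.cuspFunction 1 F =o[𝓝[≠] 0] fun q : ℂ => q⁻¹ := by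
    refine (h1.comp_tendsto (Function.Periodic.invQParam_tendsto one_pos)).congr' ?_ ?_
    · filter_upwards [self_mem_nhdsWithin] with q hq
      rw [Function.Periodic.cuspFunction_eq_of_nonzero _ _ hq]
      rfl
    · filter_upwards [self_mem_nhdsWithin] with q hq
      simp only [Function.comp_apply]
      rw [Function.Periodic.qParam_right_inv one_ne_zero hq]
  have h5 : (fun q => Function.Periodic.cuspFunction 1 F q -
      Function.Periodic.cuspFunction 1 F 0) =o[𝓝[≠] 0] fun q : ℂ => (q - 0)⁻¹ := by
    simp only [sub_zero]
    refine h4.sub ?_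
    rw [Asymptotics.isLittleO_const_left]
    right
    simpa [Function.comp_def] using tendsto_norm_inv_nhdsNE_zero_atTop (α := ℂ)
  have h6 := Complex.tendsto_limUnder_of_differentiable_on_punctured_nhds_of_isLittleO hC h5
  have h7 := (h6.comp (Function.Periodic.qParam_tendsto one_pos)).comp tendsto_coe_atImInfty
  refine (h7.isBigO_one ℝ).congr' (Eventually.of_forall fun z => ?_) .rfl |>.trans
    (Asymptotics.isBigO_of_le _ fun z => by simp)
  simp only [Function.comp_apply]
  rw [Function.Periodic.eq_cuspFunction one_ne_zero hper]
  simp [hF]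

/-- A holomorphic modular form of moderate growth, as an element of Mathlib's `ModularForm`. -/
def IsHolModForm.toModularForm {k : ℤ} {f : ℍ → ℂ} (hf : IsHolModForm k f) :
    ModularForm 𝒮ℒ k where
  toFun := f
  slash_action_eq' γ hγ := by
    obtain ⟨γ, rfl⟩ := hγ
    exact hf.modular γ
  holo' := hf.holo
  bdd_at_cusps' {c} hc := by
    rw [Subgroup.IsArithmetic.isCusp_iff_isCusp_SL2Z] at hc
    rw [OnePoint.isBoundedAt_iff_forall_SL2Z hc]
    intro γ _
    rw [hf.modular γ]
    exact hf.isBoundedAtImInfty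

theorem IsHolModForm.eq_zero_of_weight_two {f : ℍ → ℂ} (hf : IsHolModForm 2 f) : f = 0 := by
  have h := rank_zero_iff_forall_zero.mp ModularForm.levelOne_weight_two_rank_zero hf.toModularForm
  exact congrArg DFunLike.coe h

theorem IsHolModForm.eq_const_of_weight_zero {f : ℍ → ℂ} (hf : IsHolModForm 0 f) :
    ∃ c, ∀ z, f z = c := by
  obtain ⟨c, hc⟩ := ModularFormClass.levelOne_weight_zero_const hf.toModularForm
  exact ⟨c, fun z => congrFun hc z⟩

end

end PolyMaass

namespace PolyMaass

noncomputable section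

open UpperHalfPlane Filter Topology MeasureTheory
open scoped MatrixGroups ContDiff Manifold ModularForm ComplexConjugate

/-! ### The mean value property against radial weights -/

theorem integral_circle_eq {H : ℂ → ℂ} (hH : DifferentiableOn ℂ H (Metric.ball 0 1)) {r : ℝ}
    (hr0 : 0 ≤ r) (hr : r < 1) :
    ∫ θ in Set.Ioo (-Real.pi) Real.pi, H (r * (Real.cos θ + Real.sin θ * Complex.I))
      = 2 * Real.pi * H 0 := by
  have hd : DiffContOnCl ℂ H (Metric.ball 0 |r|) := by
    refine (hH.mono ?_).diffContOnCl
    rw [abs_of_nonneg hr0]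
    exact (Metric.closure_ball_subset_closedBall).trans (Metric.closedBall_subset_ball hr)
  have h := hd.circleAverage
  -- Circle averages are taken over (0, 2π), polar coordinates over (-π, π); periodicity identifies
  -- the two integrals.
  have hper : Function.Periodic (fun θ : ℝ => H (circleMap 0 r θ)) (2 * Real.pi) := by
    intro θ
    simp only
    rw [periodic_circleMap 0 r θ]
  have h2 := hper.intervalIntegral_add_eq (-Real.pi) 0
  rw [Real.circleAverage_def, zero_add] at *
  rw [← integral_Ioc_eq_integral_Ioo, ← intervalIntegral.integral_of_le (by linarith [Real.pi_pos])]
  rw [show -Real.pi + 2 * Real.pi = Real.pi by ring] at h2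
  have e : ∀ θ : ℝ, (r : ℂ) * (Real.cos θ + Real.sin θ * Complex.I) = circleMap 0 r θ := by
    intro θ
    simp [circleMap, Complex.exp_mul_I]
  simp_rw [e]
  rw [h2, ← h, Complex.real_smul]
  have : (Real.pi : ℂ) ≠ 0 := by exact_mod_cast Real.pi_ne_zero
  push_cast
  field_simp

/-- In polar coordinates each circle contributes its mean value H(0), and `ρ` vanishes before the
circles leave the unit disc. -/
theorem integral_mul_radial {H : ℂ → ℂ} (hH : DifferentiableOn ℂ H (Metric.ball 0 1))
    {ρ : ℝ → ℂ} (hρ : Continuous ρ) (hρ0 : ∀ r, 1 / 2 ≤ r → ρ r = 0) :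
    ∫ u, H u * ρ ‖u‖ = H 0 * ∫ u : ℂ, ρ ‖u‖ := by
  have key : ∀ {K : ℂ → ℂ}, DifferentiableOn ℂ K (Metric.ball 0 1) →
      ∫ u, K u * ρ ‖u‖ = ∫ r in Set.Ioi (0 : ℝ), 2 * Real.pi * K 0 * (r * ρ r) := by
    intro K hK
    set k : ℂ → ℂ := fun u => K u * ρ ‖u‖ with hk
    have hsupp : tsupport k ⊆ Metric.closedBall 0 (1 / 2) := by
      refine closure_minimal (fun u hu => ?_) Metric.isClosed_closedBall
      by_contra hu'
      simp only [Metric.mem_closedBall, dist_zero_right, not_le] at hu'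
      exact hu (by simp [hk, hρ0 _ hu'.le])
    have hcont : Continuous k := by
      refine continuous_of_tsupport fun u hu => ?_
      have hu1 : u ∈ Metric.ball (0 : ℂ) 1 :=
        Metric.closedBall_subset_ball (by norm_num) (hsupp hu)
      exact (hK.continuousOn.continuousAt (Metric.isOpen_ball.mem_nhds hu1)).mul
        (hρ.comp continuous_norm).continuousAt
    rw [← Complex.integral_comp_polarCoord_symm]
    rw [show polarCoord.target = Set.Ioi (0 : ℝ) ×ˢ Set.Ioo (-Real.pi) Real.pi from rfl]
    rw [Measure.volume_eq_prod, setIntegral_prod]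
    · refine setIntegral_congr_fun measurableSet_Ioi fun r hr => ?_
      simp only [Complex.polarCoord_symm_apply]
      have hr' : (0 : ℝ) < r := hr
      have e : ∀ θ : ℝ, ‖(r : ℂ) * (Real.cos θ + Real.sin θ * Complex.I)‖ = r := by
        intro θ
        rw [← Complex.polarCoord_symm_apply (r, θ), Complex.norm_polarCoord_symm, abs_of_pos hr']
      simp only [e]
      rcases lt_or_ge r 1 with h1 | h1
      · rw [integral_smul, integral_mul_const, integral_circle_eq hK hr'.le h1, Complex.real_smul]
        ring
      · simp [hρ0 r (by linarith)]
    · have hc : Continuous fun p : ℝ × ℝ => p.1 • k (Complex.polarCoord.symm p) := by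
        simp only [Complex.polarCoord_symm_apply]
        fun_prop
      have h1 : IntegrableOn (fun p : ℝ × ℝ => p.1 • k (Complex.polarCoord.symm p))
          (Set.Icc 0 1 ×ˢ Set.Icc (-Real.pi) Real.pi) (volume.prod volume) :=
        hc.continuousOn.integrableOn_compact (isCompact_Icc.prod isCompact_Icc)
      refine h1.of_forall_sdiff_eq_zero (measurableSet_Ioi.prod measurableSet_Ioo) fun p hp => ?_
      obtain ⟨⟨hp1, hp2⟩, hp3⟩ := hp
      have : 1 < p.1 := by
        by_contra! h
        exact hp3 ⟨⟨(Set.mem_Ioi.mp hp1).le, h⟩, Set.Ioo_subset_Icc_self hp2⟩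
      simp only [hk, Complex.norm_polarCoord_symm]
      rw [hρ0 _ (by rw [abs_of_pos hp1]; linarith)]
      simp
  -- The case K = 1 expresses the integral of `ρ` in the same radial form, so that form never has to
  -- be evaluated.
  have h1 := key (K := fun _ => 1) (differentiableOn_const _)
  rw [key hH]
  simp only [one_mul, mul_one] at h1
  rw [h1, integral_const_mul, integral_const_mul]
  ring

end

end PolyMaass

namespace PolyMaass

noncomputable section

open UpperHalfPlane Filter Topology MeasureTheory
open scoped MatrixGroups ContDiff Manifold ModularForm ComplexConjugate

/-! ### Moderate growth in the weak sense -/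

/-- Smooth functions with compact support inside the upper half-plane. -/
structure IsTestFun (φ : ℂ → ℂ) : Prop where
  smooth : ContDiff ℝ ∞ φ
  compact : HasCompactSupport φ
  subset : tsupport φ ⊆ {w : ℂ | 0 < w.im}

/-- The rescaled pairing `∫ f(x + Yw) φ(w) dw`. -/
def testPairing (f : ℍ → ℂ) (φ : ℂ → ℂ) (x Y : ℝ) : ℂ :=
  ∫ w : ℂ, (f ∘ ofComplex) (x + Y * w) * φ w

/-- Moderate growth at the cusp after pairing with arbitrary rescaled test functions. -/
def WeakGrowth (f : ℍ → ℂ) : Prop :=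
  ∃ α : ℝ, ∀ φ, IsTestFun φ → ∃ C : ℝ, ∀ᶠ Y : ℝ in atTop, ∀ x : ℝ,
    ‖testPairing f φ x Y‖ ≤ C * Y ^ α

theorem IsTestFun.fderiv_apply {φ : ℂ → ℂ} (h : IsTestFun φ) (v : ℂ) :
    IsTestFun fun w => fderiv ℝ φ w v := by
  have hs : tsupport (fun w => fderiv ℝ φ w v) ⊆ tsupport φ :=
    tsupport_fderiv_apply_subset ℝ v
  exact ⟨(h.smooth.fderiv_right (m := ∞) (by simp)).clm_apply contDiff_const,
    h.compact.fderiv_apply ℝ v, hs.trans h.subset⟩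

theorem IsTestFun.im_mul {φ : ℂ → ℂ} (h : IsTestFun φ) : IsTestFun fun w => (w.im : ℂ) * φ w := by
  have hi : ContDiff ℝ ∞ fun w : ℂ => ((w.im : ℝ) : ℂ) :=
    Complex.ofRealCLM.contDiff.comp Complex.imCLM.contDiff
  exact ⟨hi.mul h.smooth, h.compact.mul_left, (tsupport_mul_subset_right).trans h.subset⟩

theorem IsTestFun.conj {φ : ℂ → ℂ} (h : IsTestFun φ) : IsTestFun fun w => conj (φ w) := by
  have hs : tsupport (fun w => (starRingEnd ℂ) (φ w)) ⊆ tsupport φ :=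
    closure_mono fun w hw hw' => hw (by simp [hw'])
  exact ⟨(Complex.conjCLE : ℂ →L[ℝ] ℂ).contDiff.comp h.smooth,
    h.compact.comp_left (g := starRingEnd ℂ) (by simp), hs.trans h.subset⟩

theorem im_rescale (x Y : ℝ) (w : ℂ) : ((x : ℂ) + Y * w).im = Y * w.im := by simp

theorem IsTestFun.continuous_mul {φ g : ℂ → ℂ} (h : IsTestFun φ)
    (hg : ContinuousOn g {w : ℂ | 0 < w.im}) : Continuous fun w => g w * φ w := by
  refine continuous_of_tsupport fun w hw => ?_
  have hw' := h.subset (tsupport_mul_subset_right hw)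
  exact (hg.continuousAt (isOpen_im_pos.mem_nhds hw')).mul h.smooth.continuous.continuousAt

theorem IsTestFun.integrable_mul {φ g : ℂ → ℂ} (h : IsTestFun φ)
    (hg : ContinuousOn g {w : ℂ | 0 < w.im}) : Integrable fun w => g w * φ w :=
  (h.continuous_mul hg).integrable_of_hasCompactSupport h.compact.mul_left

theorem IsSmooth.continuousOn_rescale {f : ℍ → ℂ} (hf : IsSmooth f) (x : ℝ) {Y : ℝ}
    (hY : 0 < Y) :
    ContinuousOn (fun w : ℂ => (f ∘ ofComplex) (x + Y * w)) {w : ℂ | 0 < w.im} := by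
  refine hf.continuousOn.comp (by fun_prop) fun w hw => ?_
  simp only [Set.mem_ofPred_eq, im_rescale] at *
  positivity

theorem testPairing_add {f g : ℍ → ℂ} (hf : IsSmooth f) (hg : IsSmooth g) {φ : ℂ → ℂ}
    (h : IsTestFun φ) (x : ℝ) {Y : ℝ} (hY : 0 < Y) :
    testPairing (f + g) φ x Y = testPairing f φ x Y + testPairing g φ x Y := by
  rw [testPairing, testPairing, testPairing,
    ← integral_add (h.integrable_mul (hf.continuousOn_rescale x hY))
      (h.integrable_mul (hg.continuousOn_rescale x hY))]
  congr 1
  ext w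
  simp [add_mul]

theorem WeakGrowth.add {f g : ℍ → ℂ} (hf : IsSmooth f) (hg : IsSmooth g) (wf : WeakGrowth f)
    (wg : WeakGrowth g) : WeakGrowth (f + g) := by
  obtain ⟨a, ha⟩ := wf
  obtain ⟨b, hb⟩ := wg
  refine ⟨max a b, fun φ h => ?_⟩
  obtain ⟨C, hC⟩ := ha φ h
  obtain ⟨D, hD⟩ := hb φ h
  refine ⟨|C| + |D|, ?_⟩
  filter_upwards [hC, hD, eventually_ge_atTop 1] with Y h1 h2 hY x
  rw [testPairing_add hf hg h x (by linarith), add_mul]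
  refine (norm_add_le _ _).trans (add_le_add ((h1 x).trans ?_) ((h2 x).trans ?_))
  · exact mul_le_mul (le_abs_self _) (Real.rpow_le_rpow_of_exponent_le hY (le_max_left _ _))
      (by positivity) (abs_nonneg _)
  · exact mul_le_mul (le_abs_self _) (Real.rpow_le_rpow_of_exponent_le hY (le_max_right _ _))
      (by positivity) (abs_nonneg _)

theorem WeakGrowth.smul (c : ℂ) {f : ℍ → ℂ} (wf : WeakGrowth f) : WeakGrowth (c • f) := by
  obtain ⟨a, ha⟩ := wf
  refine ⟨a, fun φ h => ?_⟩
  obtain ⟨C, hC⟩ := ha φ h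
  refine ⟨‖c‖ * C, ?_⟩
  filter_upwards [hC] with Y h1 x
  have e : testPairing (c • f) φ x Y = c * testPairing f φ x Y := by
    rw [testPairing, testPairing, ← integral_const_mul]
    congr 1; ext w; simp [mul_assoc]
  rw [e, norm_mul, mul_assoc]
  exact mul_le_mul_of_nonneg_left (h1 x) (norm_nonneg _)

theorem WeakGrowth.conj {f : ℍ → ℂ} (wf : WeakGrowth f) :
    WeakGrowth fun z => conj (f z) := by
  obtain ⟨a, ha⟩ := wf
  refine ⟨a, fun φ h => ?_⟩
  obtain ⟨C, hC⟩ := ha _ h.conj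
  refine ⟨C, ?_⟩
  filter_upwards [hC] with Y h1 x
  have e : testPairing (fun z => (starRingEnd ℂ) (f z)) φ x Y
      = (starRingEnd ℂ) (testPairing f (fun w => (starRingEnd ℂ) (φ w)) x Y) := by
    rw [testPairing, testPairing, ← integral_conj]
    congr 1; ext w; simp
  rw [e, RCLike.norm_conj]
  exact h1 x

theorem WeakGrowth.im_mul {f : ℍ → ℂ} (wf : WeakGrowth f) :
    WeakGrowth ((fun z : ℍ => (z.im : ℂ)) * f) := by
  obtain ⟨a, ha⟩ := wf
  refine ⟨a + 1, fun φ h => ?_⟩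
  obtain ⟨C, hC⟩ := ha _ h.im_mul
  refine ⟨C, ?_⟩
  filter_upwards [hC, eventually_gt_atTop 0] with Y h1 hY x
  have e : testPairing ((fun z : ℍ => (z.im : ℂ)) * f) φ x Y
      = Y * testPairing f (fun w => (w.im : ℂ) * φ w) x Y := by
    rw [testPairing, testPairing, ← integral_const_mul]
    congr 1; ext w
    by_cases hw : w ∈ tsupport φ
    · have h2 : 0 < ((x : ℂ) + Y * w).im := by
        rw [im_rescale]; exact mul_pos hY (h.subset hw)
      have h3 : (ofComplex ((x : ℂ) + Y * w)).im = Y * w.im := by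
        rw [ofComplex_apply_of_im_pos h2, ← im_rescale x Y w]; rfl
      simp only [Function.comp_apply, Pi.mul_apply, h3]
      push_cast
      ring
    · rw [image_eq_zero_of_notMem_tsupport hw]; simp
  rw [e, norm_mul, Real.rpow_add hY, Real.rpow_one, Complex.norm_real, Real.norm_of_nonneg hY.le]
  calc Y * _ ≤ Y * (C * Y ^ a) := mul_le_mul_of_nonneg_left (h1 x) hY.le
    _ = _ := by ring

/-- The derivative is moved onto the test function. Rescaling by Y makes each derivative gain a
factor 1/Y, so the exponent drops by one and stays independent of φ. -/
theorem WeakGrowth.pd {f : ℍ → ℂ} (hf : IsSmooth f) (wf : WeakGrowth f) (v : ℂ) :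
    WeakGrowth (pd v f) := by
  obtain ⟨a, ha⟩ := wf
  refine ⟨a - 1, fun φ h => ?_⟩
  obtain ⟨C, hC⟩ := ha _ (h.fderiv_apply v)
  refine ⟨C, ?_⟩
  filter_upwards [hC, eventually_gt_atTop 0] with Y h1 hY x
  have hpos : ∀ w ∈ {w : ℂ | 0 < w.im}, 0 < ((x : ℂ) + Y * w).im := fun w hw => by
    rw [im_rescale]; exact mul_pos hY hw
  have hd : ∀ w ∈ {w : ℂ | 0 < w.im}, HasFDerivAt (fun w : ℂ => (f ∘ ofComplex) (x + Y * w))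
      ((fderiv ℝ (f ∘ ofComplex) (x + Y * w)) ∘L (Y • (1 : ℂ →L[ℝ] ℂ))) w := by
    intro w hw
    have h2 : HasFDerivAt (fun w : ℂ => (x : ℂ) + Y * w) (Y • (1 : ℂ →L[ℝ] ℂ)) w := by
      have := ((1 : ℂ →L[ℝ] ℂ).hasFDerivAt (x := w)).const_smul Y |>.const_add (x : ℂ)
      simpa [Complex.real_smul] using! this
    exact (((hf.differentiableOn (by simp)).differentiableAt
      (isOpen_im_pos.mem_nhds (hpos w hw))).hasFDerivAt).comp w h2
  have e0 : ∀ w ∈ {w : ℂ | 0 < w.im}, fderiv ℝ (fun w : ℂ => (f ∘ ofComplex) (x + Y * w)) w v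
      = Y * (PolyMaass.pd v f ∘ ofComplex) (x + Y * w) := by
    intro w hw
    rw [(hd w hw).fderiv]
    simp only [Function.comp_apply, PolyMaass.pd]
    rw [ofComplex_apply_of_im_pos (hpos w hw)]
    simp
  have e1 : ∀ w, fderiv ℝ (fun w : ℂ => (f ∘ ofComplex) (x + Y * w)) w v * φ w
      = Y * ((PolyMaass.pd v f ∘ ofComplex) (x + Y * w) * φ w) := by
    intro w
    by_cases hw : w ∈ tsupport φ
    · rw [e0 w (h.subset hw)]; ring
    · rw [image_eq_zero_of_notMem_tsupport hw]; simp
  have hip := integral_mul_fderiv_eq_neg_fderiv_mul_of_integrable (𝕜 := ℂ) (μ := volume)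
    (f := fun w : ℂ => (f ∘ ofComplex) (x + Y * w)) (g := φ) (v := v)
    (by
      simp_rw [e1]
      exact (h.integrable_mul ((hf.pd v).continuousOn_rescale x hY)).const_mul _)
    ((h.fderiv_apply v).integrable_mul (hf.continuousOn_rescale x hY))
    (h.integrable_mul (hf.continuousOn_rescale x hY))
    (fun w hw => (hd w (h.subset hw)).differentiableAt)
    (fun w _ => (h.smooth.differentiable (by simp)) w)
  simp_rw [e1] at hip
  rw [integral_const_mul] at hip
  have e : testPairing (PolyMaass.pd v f) φ x Y
      = -(Y : ℂ)⁻¹ * testPairing f (fun w => fderiv ℝ φ w v) x Y := by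
    rw [testPairing, testPairing, hip]
    have : (Y : ℂ) ≠ 0 := by exact_mod_cast hY.ne'
    field_simp
  rw [e, norm_mul, norm_neg, norm_inv, Complex.norm_real, Real.norm_of_nonneg hY.le,
    Real.rpow_sub_one hY.ne']
  calc Y⁻¹ * _ ≤ Y⁻¹ * (C * Y ^ a) := mul_le_mul_of_nonneg_left (h1 x) (by positivity)
    _ = _ := by ring

theorem WeakGrowth.dz {f : ℍ → ℂ} (hf : IsSmooth f) (wf : WeakGrowth f) : WeakGrowth (dz f) := by
  have h := ((wf.pd hf 1).add (hf.pd 1) ((hf.pd Complex.I).smul _)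
    ((wf.pd hf Complex.I).smul (-Complex.I))).smul (1 / 2)
  convert! h using 1
  ext z
  simp only [PolyMaass.dz, pdx, pdy, Pi.smul_apply, Pi.add_apply, smul_eq_mul]
  ring

theorem WeakGrowth.dzb {f : ℍ → ℂ} (hf : IsSmooth f) (wf : WeakGrowth f) :
    WeakGrowth (dzb f) := by
  have h := ((wf.pd hf 1).add (hf.pd 1) ((hf.pd Complex.I).smul _)
    ((wf.pd hf Complex.I).smul Complex.I)).smul (1 / 2)
  convert! h using 1
  ext z
  simp only [PolyMaass.dzb, pdx, pdy, Pi.smul_apply, Pi.add_apply, smul_eq_mul]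
  ring

theorem WeakGrowth.lower {f : ℍ → ℂ} (hf : IsSmooth f) (wf : WeakGrowth f) :
    WeakGrowth (lower f) := by
  rw [lower_eq, mul_assoc]
  exact (wf.dzb hf).im_mul.im_mul

theorem WeakGrowth.lap {f : ℍ → ℂ} (hf : IsSmooth f) (wf : WeakGrowth f) :
    WeakGrowth (lap 2 f) := by
  have e : PolyMaass.lap 2 f = (4 : ℂ) • PolyMaass.dz (PolyMaass.lower f) := by
    ext z; exact lap_two_eq hf z
  rw [e]
  exact ((wf.lower hf).dz hf.lower).smul 4

theorem ModerateGrowth.weakGrowth {f : ℍ → ℂ} (gf : ModerateGrowth f) : WeakGrowth f := by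
  obtain ⟨α, hα⟩ := gf
  refine ⟨α, fun φ h => ?_⟩
  obtain ⟨K, hK⟩ := hα.bound
  obtain ⟨A, hA⟩ := (atImInfty_mem _).mp hK
  -- Compact support keeps Im w ≥ δ > 0 on the support of φ, so Y ≥ A/δ puts every sampled point x +
  -- Yw in the region where the pointwise bound holds.
  obtain ⟨δ, hδ, hφ⟩ := h.compact.isCompact.exists_forall_le' (f := Complex.im) (a := 0)
    Complex.continuous_im.continuousOn fun w hw => h.subset hw
  have hcont : ContinuousOn (fun w : ℂ => ((w.im ^ α : ℝ) : ℂ)) {w : ℂ | 0 < w.im} := by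
    refine Complex.continuous_ofReal.comp_continuousOn ?_
    exact Complex.continuous_im.continuousOn.rpow_const fun w hw => Or.inl (ne_of_gt hw)
  have hIntegrable := (h.integrable_mul hcont).norm
  refine ⟨K * ∫ w : ℂ, ‖((w.im ^ α : ℝ) : ℂ) * φ w‖, ?_⟩
  filter_upwards [eventually_gt_atTop 0, eventually_ge_atTop (A / δ)] with Y hY hYA x
  rw [testPairing, mul_assoc, mul_comm _ (Y ^ α), ← mul_assoc, ← integral_const_mul]
  refine norm_integral_le_of_norm_le (hIntegrable.const_mul _) (Eventually.of_forall fun w => ?_)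
  by_cases hw : w ∈ tsupport φ
  · have hw0 : 0 < w.im := h.subset hw
    have h2 : 0 < ((x : ℂ) + Y * w).im := by
      rw [im_rescale]; exact mul_pos hY hw0
    have h3 : (ofComplex ((x : ℂ) + Y * w)).im = Y * w.im := by
      rw [ofComplex_apply_of_im_pos h2, ← im_rescale x Y w]; rfl
    have h4 : A ≤ (ofComplex ((x : ℂ) + Y * w)).im := by
      rw [h3]
      calc A = A / δ * δ := by field_simp
        _ ≤ Y * w.im := mul_le_mul hYA (hφ w hw) hδ.le hY.le
    have h5 := hA _ h4
    simp only [Set.mem_ofPred_eq, h3] at h5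
    rw [Real.norm_of_nonneg (by positivity), Real.mul_rpow hY.le hw0.le] at h5
    rw [norm_mul, norm_mul, Complex.norm_real, Real.norm_of_nonneg (by positivity)]
    calc _ ≤ (K * (Y ^ α * w.im ^ α)) * ‖φ w‖ := mul_le_mul_of_nonneg_right h5 (norm_nonneg _)
      _ = _ := by ring
  · rw [image_eq_zero_of_notMem_tsupport hw]; simp

/-- A radial test function centred at `i`. -/
theorem isTestFun_radial : IsTestFun fun w : ℂ =>
    ((Real.smoothTransition (1 - 4 * ‖w - Complex.I‖ ^ 2) : ℝ) : ℂ) := by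
  have hs : tsupport (fun w : ℂ =>
      ((Real.smoothTransition (1 - 4 * ‖w - Complex.I‖ ^ 2) : ℝ) : ℂ)) ⊆
      Metric.closedBall Complex.I (1 / 2) := by
    refine closure_minimal (fun w hw => ?_) Metric.isClosed_closedBall
    by_contra hw'
    simp only [Metric.mem_closedBall, dist_eq_norm, not_le] at hw'
    refine hw ?_
    simp only [Complex.ofReal_eq_zero]
    exact Real.smoothTransition.zero_of_nonpos (by nlinarith)
  refine ⟨?_, HasCompactSupport.of_support_subset_isCompact (isCompact_closedBall Complex.I (1 / 2))
    ((subset_tsupport _).trans hs), hs.trans fun w hw => ?_⟩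
  · refine Complex.ofRealCLM.contDiff.comp (Real.smoothTransition.contDiff.comp ?_)
    exact contDiff_const.sub (contDiff_const.mul ((contDiff_id.sub contDiff_const).norm_sq ℝ))
  · rw [Metric.mem_closedBall, dist_eq_norm] at hw
    have h1 := (Complex.abs_im_le_norm (w - Complex.I)).trans hw
    rw [Complex.sub_im, Complex.I_im, abs_le] at h1
    simp only [Set.mem_ofPred_eq]
    linarith [h1.1]

/-- For holomorphic f, pairing with a radial bump centred at i returns f(z) times the mass of the
bump, so the weak bound is already a pointwise one. -/
theorem WeakGrowth.moderateGrowth {f : ℍ → ℂ} (hf : MDifferentiable 𝓘(ℂ) 𝓘(ℂ) f)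
    (wf : WeakGrowth f) : ModerateGrowth f := by
  obtain ⟨α, hα⟩ := wf
  obtain ⟨C, hC⟩ := hα _ isTestFun_radial
  set ρ : ℝ → ℂ := fun r => ((Real.smoothTransition (1 - 4 * r ^ 2) : ℝ) : ℂ) with hρ
  have hρc : Continuous ρ :=
    Complex.continuous_ofReal.comp (Real.smoothTransition.continuous.comp (by fun_prop))
  have hρ0 : ∀ r, 1 / 2 ≤ r → ρ r = 0 := fun r hr => by
    simp only [hρ, Complex.ofReal_eq_zero]
    exact Real.smoothTransition.zero_of_nonpos (by nlinarith)
  set N := ∫ u : ℂ, ρ ‖u‖ with hN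
  have hNpos : 0 < ‖N‖ := by
    have e : N = ((∫ u : ℂ, Real.smoothTransition (1 - 4 * ‖u‖ ^ 2) : ℝ) : ℂ) :=
      integral_ofReal
    have hc : Continuous fun u : ℂ => Real.smoothTransition (1 - 4 * ‖u‖ ^ 2) :=
      Real.smoothTransition.continuous.comp (by fun_prop)
    have hp : 0 < ∫ u : ℂ, Real.smoothTransition (1 - 4 * ‖u‖ ^ 2) := by
      refine hc.integral_pos_of_hasCompactSupport_nonneg_nonzero (x := 0) ?_
        (fun u => Real.smoothTransition.nonneg _) (by simp)
      refine HasCompactSupport.of_support_subset_isCompact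
        (isCompact_closedBall (0 : ℂ) (1 / 2)) fun w hw => ?_
      by_contra hw'
      simp only [Metric.mem_closedBall, dist_zero_right, not_le] at hw'
      exact hw (Real.smoothTransition.zero_of_nonpos (by nlinarith))
    rw [e, Complex.norm_real, Real.norm_of_nonneg hp.le]
    exact hp
  refine ⟨α, Asymptotics.IsBigO.of_bound (C / ‖N‖) ?_⟩
  have h1 : ∀ᶠ z : ℍ in atImInfty, ∀ x : ℝ, ‖testPairing f (fun w : ℂ =>
    ((Real.smoothTransition (1 - 4 * ‖w - Complex.I‖ ^ 2) : ℝ) : ℂ)) x z.im‖ ≤ C * z.im ^ α :=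
    (Filter.tendsto_comap (f := UpperHalfPlane.im)).eventually hC
  filter_upwards [h1] with z hz
  have hy : 0 < z.im := z.im_pos
  have hH : DifferentiableOn ℂ (fun u : ℂ => (f ∘ ofComplex) (z + z.im * u))
      (Metric.ball 0 1) := by
    refine (UpperHalfPlane.mdifferentiable_iff.mp hf).comp (by fun_prop) fun u hu => ?_
    rw [Metric.mem_ball, dist_zero_right] at hu
    have h2 := (Complex.abs_im_le_norm u).trans_lt hu
    rw [abs_lt] at h2
    have : ((z : ℂ) + z.im * u).im = z.im * (1 + u.im) := by simp; ring
    simp only [Set.mem_ofPred_eq, this]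
    exact mul_pos hy (by linarith [h2.1])
  have h3 := integral_mul_radial hH hρc hρ0
  -- With x = Re z, Y = Im z and w = i + u, the sampled point x + Yw is z + Yu.
  have h4 : testPairing f (fun w : ℂ =>
      ((Real.smoothTransition (1 - 4 * ‖w - Complex.I‖ ^ 2) : ℝ) : ℂ)) z.re z.im = f z * N := by
    rw [testPairing, ← integral_add_right_eq_self _ Complex.I]
    simp only [mul_zero, add_zero, Function.comp_apply, ofComplex_apply] at h3
    rw [hN, ← h3]
    congr 1
    ext u
    simp only [Function.comp_apply, hρ, add_sub_cancel_right]
    congr 3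
    have : (z : ℂ) = z.re + z.im * Complex.I := (Complex.re_add_im (z : ℂ)).symm
    rw [this]
    ring
  have h5 := hz z.re
  rw [h4, norm_mul] at h5
  rw [Real.norm_of_nonneg (by positivity), div_mul_eq_mul_div, le_div_iff₀ hNpos]
  exact h5

end

end PolyMaass

namespace PolyMaass

noncomputable section

open UpperHalfPlane Filter Topology MeasureTheory
open scoped MatrixGroups ContDiff Manifold ModularForm ComplexConjugate

/-! ### Classification of weight two harmonic forms -/

/-- Smooth weight two modular forms of moderate growth in the weak sense. -/
structure IsWeakForm (f : ℍ → ℂ) : Prop where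
  smooth : IsSmooth f
  modular : IsModular 2 f
  growth : WeakGrowth f

theorem IsModerateForm.isWeakForm {f : ℍ → ℂ} (hf : IsModerateForm 2 f) : IsWeakForm f :=
  ⟨hf.smooth, hf.modular, hf.growth.weakGrowth⟩

theorem IsWeakForm.add {f g : ℍ → ℂ} (hf : IsWeakForm f) (hg : IsWeakForm g) :
    IsWeakForm (f + g) :=
  ⟨hf.smooth.add hg.smooth, hf.modular.add hg.modular, hf.growth.add hf.smooth hg.smooth hg.growth⟩

theorem IsWeakForm.smul (c : ℂ) {f : ℍ → ℂ} (hf : IsWeakForm f) : IsWeakForm (c • f) :=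
  ⟨hf.smooth.smul c, hf.modular.smul c, hf.growth.smul c⟩

theorem IsWeakForm.lap_iterate {f : ℍ → ℂ} (hf : IsWeakForm f) (m : ℕ) :
    IsWeakForm ((lap 2)^[m] f) := by
  induction m with
  | zero => exact hf
  | succ m ih =>
    rw [Function.iterate_succ_apply']
    exact ⟨ih.smooth.lap 2, ih.modular.lap ih.smooth, ih.growth.lap ih.smooth⟩

theorem IsWeakForm.eq_zero_of_dzb_eq_zero {f : ℍ → ℂ} (hf : IsWeakForm f)
    (h : ∀ z, dzb f z = 0) : f = 0 := by
  have hol := mdifferentiable_of_dzb_eq_zero hf.smooth h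
  exact IsHolModForm.eq_zero_of_weight_two ⟨hol, hf.modular, hf.growth.moderateGrowth hol⟩

theorem IsModular.conj_of_weight_zero {f : ℍ → ℂ} (hf : IsModular 0 f) :
    IsModular 0 fun z => conj (f z) := by
  refine isModular_of_apply_smul fun γ z => ?_
  rw [hf.apply_smul]
  simp

/-- Harmonicity says that `lower f` is antiholomorphic, so its conjugate is a holomorphic form of
weight 0; weak growth makes it moderate at the cusp, hence constant. -/
theorem IsWeakForm.lower_eq_const {f : ℍ → ℂ} (hf : IsWeakForm f) (h : lap 2 f = 0) :
    ∃ c, ∀ z, lower f z = c := by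
  have hs : IsSmooth fun z => conj (lower f z) := hf.smooth.lower.conj
  have hdz : ∀ z, dz (lower f) z = 0 := fun z => by
    have h1 := lap_two_eq hf.smooth z
    rw [h] at h1
    simpa using h1.symm
  have hdzb : ∀ z, dzb (fun z => conj (lower f z)) z = 0 := fun z => by
    rw [(hf.smooth.lower.hasWirtinger z).conj.dzb, hdz, map_zero]
  have hol := mdifferentiable_of_dzb_eq_zero hs hdzb
  obtain ⟨c, hc⟩ := IsHolModForm.eq_const_of_weight_zero ⟨hol,
    (hf.modular.lower hf.smooth).conj_of_weight_zero,
    (hf.growth.lower hf.smooth).conj.moderateGrowth hol⟩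
  exact ⟨conj c, fun z => by rw [← hc z, Complex.conj_conj]⟩

/-- Harmonic weight two forms form a space of dimension at most one. -/
theorem IsWeakForm.exists_eq_smul {f g : ℍ → ℂ} (hf : IsWeakForm f) (hg : IsWeakForm g)
    (lf : lap 2 f = 0) (lg : lap 2 g = 0) (hg0 : g ≠ 0) : ∃ c : ℂ, f = c • g := by
  obtain ⟨a, ha⟩ := hf.lower_eq_const lf
  obtain ⟨b, hb⟩ := hg.lower_eq_const lg
  have him : ∀ z : ℍ, (z.im : ℂ) ≠ 0 := fun z => by exact_mod_cast z.im_pos.ne'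
  -- If b = 0 then g is holomorphic of weight 2, hence zero.
  have hb0 : b ≠ 0 := by
    rintro rfl
    refine hg0 (hg.eq_zero_of_dzb_eq_zero fun z => ?_)
    simpa [lower, him z] using hb z
  refine ⟨a / b, ?_⟩
  -- Subtracting (a/b) g cancels the constant, leaving a holomorphic form of weight 2.
  have h := (hf.add (hg.smul (-(a / b)))).eq_zero_of_dzb_eq_zero fun z => by
    rw [dzb_add hf.smooth (hg.smooth.smul _), dzb_smul _ hg.smooth]
    have h1 := ha z
    have h2 := hb z
    simp only [lower] at h1 h2
    simp only [Pi.add_apply, Pi.smul_apply, smul_eq_mul]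
    apply mul_left_cancel₀ (pow_ne_zero 2 (him z))
    rw [mul_zero, mul_add, h1, mul_left_comm, h2]
    field_simp
    ring
  ext z
  have hz := congrFun h z
  simp only [Pi.add_apply, Pi.smul_apply, smul_eq_mul, Pi.zero_apply] at hz ⊢
  linear_combination hz

end

end PolyMaass

/-! ### Construction: integrals of theta kernels against weights in t, and their Laplacians -/

namespace PolyMaass

noncomputable section

open UpperHalfPlane Filter Topology MeasureTheory
open scoped MatrixGroups ContDiff Manifold ModularForm ComplexConjugate

/-! ### Theta integrals over binary quadratic forms -/

/-- The measure on `ℤ² × ℝ` for summation over `ℤ²` and integration over `(1, ∞)`. -/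
def latticeMeasure : Measure ((Fin 2 → ℤ) × ℝ) :=
  (Measure.count : Measure (Fin 2 → ℤ)).prod (volume.restrict (Set.Ioi (1 : ℝ)))

/-- Polynomially bounded coefficient functions on `ℤ² × (1, ∞)` vanishing at the origin
of `ℤ²`. -/
structure IsWeight (a : (Fin 2 → ℤ) × ℝ → ℂ) : Prop where
  measurable : Measurable a
  zero : ∀ t, a (0, t) = 0
  bound : ∃ (C : ℝ) (n : ℕ), 0 ≤ C ∧ ∀ v t, 1 < t → ‖a (v, t)‖ ≤ C * (‖v‖ * t) ^ n

theorem one_le_norm_of_ne_zero {v : Fin 2 → ℤ} (hv : v ≠ 0) : 1 ≤ ‖v‖ := by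
  obtain ⟨i, hi⟩ := Function.ne_iff.mp hv
  refine le_trans ?_ (norm_le_pi_norm v i)
  rw [Int.norm_eq_abs]
  exact_mod_cast Int.one_le_abs hi

theorem IsWeight.bound_mul {a b : (Fin 2 → ℤ) × ℝ → ℂ} (ha : IsWeight a) (hb : Measurable b)
    (h : ∃ (C : ℝ) (n : ℕ), 0 ≤ C ∧ ∀ v t, v ≠ 0 → 1 < t → ‖b (v, t)‖ ≤ C * (‖v‖ * t) ^ n) :
    IsWeight (b * a) := by
  obtain ⟨C, n, hC, hn⟩ := ha.bound
  obtain ⟨D, k, hD, hk⟩ := h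
  refine ⟨hb.mul ha.measurable, fun t => by simp [ha.zero], C * D, n + k, by positivity,
    fun v t ht => ?_⟩
  by_cases hv : v = 0
  · subst hv
    simp only [Pi.mul_apply, ha.zero, mul_zero, norm_zero]
    positivity
  · rw [Pi.mul_apply, norm_mul]
    calc _ ≤ (D * (‖v‖ * t) ^ k) * (C * (‖v‖ * t) ^ n) :=
          mul_le_mul (hk v t hv ht) (hn v t ht) (norm_nonneg _) (by positivity)
      _ = _ := by ring

theorem IsWeight.coord_mul {a : (Fin 2 → ℤ) × ℝ → ℂ} (ha : IsWeight a) (i : Fin 2) :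
    IsWeight ((fun p => ((p.1 i : ℤ) : ℂ)) * a) := by
  refine ha.bound_mul (by fun_prop) ⟨1, 1, zero_le_one, fun v t hv ht => ?_⟩
  have h1 := norm_le_pi_norm v i
  rw [one_mul, pow_one]
  simp only [Complex.norm_intCast]
  rw [Int.norm_eq_abs] at h1
  nlinarith [norm_nonneg v]

theorem IsWeight.snd_mul {a : (Fin 2 → ℤ) × ℝ → ℂ} (ha : IsWeight a) :
    IsWeight ((fun p => (p.2 : ℂ)) * a) := by
  refine ha.bound_mul (by fun_prop) ⟨1, 1, zero_le_one, fun v t hv ht => ?_⟩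
  have h1 := one_le_norm_of_ne_zero hv
  rw [one_mul, pow_one]
  simp only [Complex.norm_real, Real.norm_eq_abs]
  rw [abs_of_pos (by linarith)]
  nlinarith

theorem IsWeight.const_mul {a : (Fin 2 → ℤ) × ℝ → ℂ} (ha : IsWeight a) (c : ℂ) :
    IsWeight ((fun _ => c) * a) :=
  ha.bound_mul measurable_const ⟨‖c‖, 0, norm_nonneg _, fun v t _ _ => by simp⟩

theorem pow_mul_exp_neg_le {c u : ℝ} (hc : 0 < c) (hu : 0 ≤ u) (n : ℕ) :
    u ^ n * Real.exp (-(c * u)) ≤ n.factorial / c ^ n := by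
  have h := Real.pow_div_factorial_le_exp (x := c * u) (by positivity) n
  rw [Real.exp_neg, le_div_iff₀ (by positivity), ← div_eq_mul_inv, div_mul_eq_mul_div,
    div_le_iff₀ (Real.exp_pos _)]
  rw [div_le_iff₀ (by positivity), mul_pow] at h
  linarith

/-- The common majorant for all dominated convergence arguments: exponent -4 is summable on ℤ² and
integrable on (1, ∞). -/
theorem integrable_lattice_rpow :
    Integrable (fun p : (Fin 2 → ℤ) × ℝ => ‖p.1‖ ^ (-4 : ℝ) * p.2 ^ (-4 : ℝ)) latticeMeasure := by
  refine Integrable.mul_prod (f := fun v : Fin 2 → ℤ => ‖v‖ ^ (-4 : ℝ))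
    (g := fun t : ℝ => t ^ (-4 : ℝ)) ?_ ?_
  · exact integrable_count_iff.mpr
      (EisensteinSeries.summable_one_div_norm_rpow (k := 4) (by norm_num)).norm
  · exact integrableOn_Ioi_rpow_of_lt (by norm_num) one_pos

theorem ae_lattice_one_lt : ∀ᵐ p ∂latticeMeasure, 1 < p.2 := by
  have h : ∀ᵐ t ∂(volume.restrict (Set.Ioi (1 : ℝ))), 1 < t :=
    ae_restrict_mem measurableSet_Ioi
  exact Measure.quasiMeasurePreserving_snd.ae h

/-- Exponentially damped weights are dominated by a fixed integrable function. -/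
theorem IsWeight.exists_uniform_bound {a : (Fin 2 → ℤ) × ℝ → ℂ} (ha : IsWeight a) :
    ∃ (B : ℝ) (N : ℕ), ∀ κ > 0, ∀ v t, 1 < t →
      ‖a (v, t)‖ * Real.exp (-(Real.pi * t * (κ * ‖v‖ ^ 2)))
        ≤ B / κ ^ N * (‖v‖ ^ (-4 : ℝ) * t ^ (-4 : ℝ)) := by
  obtain ⟨C, n, hC, hn⟩ := ha.bound
  -- The Gaussian absorbs n powers of ‖v‖t from the weight and 4 more for the majorant. The
  -- dependence on κ is kept explicit because κ shrinks like 1/y at the cusp. At v = 0 both sides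
  -- are zero, since `0 ^ (-4)` is 0.
  refine ⟨C * ((n + 4).factorial / Real.pi ^ (n + 4)), n + 4, fun κ hκ v t ht => ?_⟩
  have hc : 0 < Real.pi * κ := mul_pos Real.pi_pos hκ
  by_cases hv : v = 0
  · subst hv
    simp [ha.zero]
  · have hv1 := one_le_norm_of_ne_zero hv
    have hv0 : 0 < ‖v‖ := by linarith
    have ht0 : 0 < t := by linarith
    have h1 : Real.exp (-(Real.pi * t * (κ * ‖v‖ ^ 2)))
        ≤ Real.exp (-(Real.pi * κ * (‖v‖ * t))) := by
      rw [Real.exp_le_exp, neg_le_neg_iff]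
      have : ‖v‖ ≤ ‖v‖ ^ 2 := by nlinarith
      calc Real.pi * κ * (‖v‖ * t) ≤ Real.pi * κ * (‖v‖ ^ 2 * t) := by gcongr
        _ = _ := by ring
    have h2 := pow_mul_exp_neg_le hc (u := ‖v‖ * t) (by positivity) (n + 4)
    rw [← Real.mul_rpow hv0.le ht0.le, Real.rpow_neg (by positivity),
      show (4 : ℝ) = ((4 : ℕ) : ℝ) by norm_num, Real.rpow_natCast,
      ← div_eq_mul_inv]
    calc _ ≤ C * (‖v‖ * t) ^ n * Real.exp (-(Real.pi * κ * (‖v‖ * t))) :=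
          mul_le_mul (hn v t ht) h1 (Real.exp_pos _).le (by positivity)
      _ = C * (((‖v‖ * t) ^ (n + 4) * Real.exp (-(Real.pi * κ * (‖v‖ * t))))
            / (‖v‖ * t) ^ 4) := by
          rw [pow_add]
          field_simp
      _ ≤ C * (((n + 4).factorial / (Real.pi * κ) ^ (n + 4)) / (‖v‖ * t) ^ 4) := by gcongr
      _ = _ := by rw [mul_pow]; field_simp

theorem IsWeight.exists_bound {a : (Fin 2 → ℤ) × ℝ → ℂ} (ha : IsWeight a) {κ : ℝ} (hκ : 0 < κ) :
    ∃ B : ℝ, ∀ v t, 1 < t → ‖a (v, t)‖ * Real.exp (-(Real.pi * t * (κ * ‖v‖ ^ 2)))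
      ≤ B * (‖v‖ ^ (-4 : ℝ) * t ^ (-4 : ℝ)) := by
  obtain ⟨B, N, h⟩ := ha.exists_uniform_bound
  exact ⟨B / κ ^ N, h κ hκ⟩

/-- The binary quadratic form with coefficient vector `q`. -/
def quadForm (q : ℝ × ℝ × ℝ) (v : Fin 2 → ℤ) : ℝ :=
  q.1 * (v 0 : ℝ) ^ 2 + 2 * q.2.1 * ((v 0 : ℝ) * (v 1 : ℝ)) + q.2.2 * (v 1 : ℝ) ^ 2

/-- Coefficient vectors of positive definite binary quadratic forms. -/
def posForms : Set (ℝ × ℝ × ℝ) :=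
  {q | ∃ κ > 0, ∀ v : Fin 2 → ℤ, κ * ‖v‖ ^ 2 ≤ quadForm q v}

theorem abs_coord_le (v : Fin 2 → ℤ) (i : Fin 2) : |(v i : ℝ)| ≤ ‖v‖ := by
  have := norm_le_pi_norm v i
  rwa [Int.norm_eq_abs] at this

theorem abs_quadForm_le (q : ℝ × ℝ × ℝ) (v : Fin 2 → ℤ) :
    |quadForm q v| ≤ 4 * ‖q‖ * ‖v‖ ^ 2 := by
  have h1 : |q.1| ≤ ‖q‖ := norm_fst_le q
  have h2 : |q.2.1| ≤ ‖q‖ := (norm_fst_le q.2).trans (norm_snd_le q)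
  have h3 : |q.2.2| ≤ ‖q‖ := (norm_snd_le q.2).trans (norm_snd_le q)
  have a0 := abs_coord_le v 0
  have a1 := abs_coord_le v 1
  unfold quadForm
  refine (abs_add_three _ _ _).trans ?_
  rw [abs_mul, abs_mul, abs_mul, abs_mul, abs_mul, abs_pow, abs_pow, abs_two]
  have e1 : |q.1| * |(v 0 : ℝ)| ^ 2 ≤ ‖q‖ * ‖v‖ ^ 2 := by gcongr
  have e2 : 2 * |q.2.1| * (|(v 0 : ℝ)| * |(v 1 : ℝ)|) ≤ 2 * ‖q‖ * (‖v‖ * ‖v‖) := by gcongr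
  have e3 : |q.2.2| * |(v 1 : ℝ)| ^ 2 ≤ ‖q‖ * ‖v‖ ^ 2 := by gcongr
  nlinarith

/-- Moving the coefficients by less than κ/8 changes the form by at most 4(κ/8)‖v‖², leaving the
lower bound κ/2 uniformly over the ball. -/
theorem exists_nhds_posForms {q : ℝ × ℝ × ℝ} (hq : q ∈ posForms) :
    ∃ κ > 0, ∃ ε > 0, ∀ q' ∈ Metric.ball q ε, ∀ v : Fin 2 → ℤ, κ * ‖v‖ ^ 2 ≤ quadForm q' v := by
  obtain ⟨κ, hκ, h⟩ := hq
  refine ⟨κ / 2, by positivity, κ / 8, by positivity, fun q' hq' v => ?_⟩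
  rw [Metric.mem_ball, dist_eq_norm] at hq'
  have h1 := abs_quadForm_le (q' - q) v
  have h2 : quadForm (q' - q) v = quadForm q' v - quadForm q v := by
    simp only [quadForm, Prod.fst_sub, Prod.snd_sub]; ring
  rw [h2] at h1
  have h3 := (abs_le.mp h1).1
  have h4 : ‖q' - q‖ * ‖v‖ ^ 2 ≤ κ / 8 * ‖v‖ ^ 2 := by gcongr
  linarith [h v]

theorem isOpen_posForms : IsOpen posForms := by
  rw [Metric.isOpen_iff]
  intro q hq
  obtain ⟨κ, hκ, ε, hε, h⟩ := exists_nhds_posForms hq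
  exact ⟨ε, hε, fun p hp => ⟨κ, hκ, h p hp⟩⟩

/-- The Gaussian `e^{-π t q(v)}`. -/
def gauss (q : ℝ × ℝ × ℝ) (p : (Fin 2 → ℤ) × ℝ) : ℂ :=
  ((Real.exp (-(Real.pi * p.2 * quadForm q p.1)) : ℝ) : ℂ)

theorem measurable_gauss (q : ℝ × ℝ × ℝ) : Measurable (gauss q) := by
  unfold gauss quadForm
  fun_prop

theorem norm_gauss (q : ℝ × ℝ × ℝ) (p : (Fin 2 → ℤ) × ℝ) :
    ‖gauss q p‖ = Real.exp (-(Real.pi * p.2 * quadForm q p.1)) := by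
  rw [gauss, Complex.norm_real, Real.norm_of_nonneg (Real.exp_pos _).le]

theorem norm_gauss_le {q : ℝ × ℝ × ℝ} {κ : ℝ} (h : ∀ v : Fin 2 → ℤ, κ * ‖v‖ ^ 2 ≤ quadForm q v)
    {v : Fin 2 → ℤ} {t : ℝ} (ht : 1 < t) :
    ‖gauss q (v, t)‖ ≤ Real.exp (-(Real.pi * t * (κ * ‖v‖ ^ 2))) := by
  rw [norm_gauss, Real.exp_le_exp, neg_le_neg_iff]
  have := h v
  have := Real.pi_pos
  gcongr

theorem IsWeight.integrable {a : (Fin 2 → ℤ) × ℝ → ℂ} (ha : IsWeight a) {q : ℝ × ℝ × ℝ}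
    (hq : q ∈ posForms) : Integrable (fun p => a p * gauss q p) latticeMeasure := by
  obtain ⟨κ, hκ, h⟩ := hq
  obtain ⟨B, hB⟩ := ha.exists_bound hκ
  refine (integrable_lattice_rpow.const_mul B).mono'
    (ha.measurable.mul (measurable_gauss q)).aestronglyMeasurable ?_
  filter_upwards [ae_lattice_one_lt] with p hp
  rw [norm_mul]
  exact (mul_le_mul_of_nonneg_left (norm_gauss_le h hp) (norm_nonneg _)).trans (hB p.1 p.2 hp)

/-- The theta integral attached to a weight. -/
def thetaInt (a : (Fin 2 → ℤ) × ℝ → ℂ) (q : ℝ × ℝ × ℝ) : ℂ :=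
  ∫ p, a p * gauss q p ∂latticeMeasure

/-- The weights occurring in the partial derivatives of a theta integral. -/
def dWeight (i j : Fin 2) (a : (Fin 2 → ℤ) × ℝ → ℂ) : (Fin 2 → ℤ) × ℝ → ℂ :=
  (fun _ => (-Real.pi : ℂ)) * ((fun p => (p.2 : ℂ)) * ((fun p => ((p.1 i : ℤ) : ℂ)) *
    ((fun p => ((p.1 j : ℤ) : ℂ)) * a)))

theorem IsWeight.dWeight {a : (Fin 2 → ℤ) × ℝ → ℂ} (ha : IsWeight a) (i j : Fin 2) :
    IsWeight (dWeight i j a) :=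
  (((ha.coord_mul j).coord_mul i).snd_mul).const_mul _

/-- `(x, y, z) ↦ x a + 2 y b + z c`. -/
def tripleCLM (a b c : ℂ) : ℝ × ℝ × ℝ →L[ℝ] ℂ :=
  (ContinuousLinearMap.fst ℝ ℝ (ℝ × ℝ)).smulRight a +
    (((ContinuousLinearMap.fst ℝ ℝ ℝ).comp (ContinuousLinearMap.snd ℝ ℝ (ℝ × ℝ))).smulRight
      (2 * b) +
    ((ContinuousLinearMap.snd ℝ ℝ ℝ).comp (ContinuousLinearMap.snd ℝ ℝ (ℝ × ℝ))).smulRight c)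

theorem tripleCLM_apply (a b c : ℂ) (q : ℝ × ℝ × ℝ) :
    tripleCLM a b c q = q.1 * a + (q.2.1 * (2 * b) + q.2.2 * c) := by
  simp [tripleCLM]

/-- `tripleCLM` is real linear in its three coefficients, so measurability, integrability and
smoothness pass from the coefficients to the functional. -/
theorem exists_clm_eq_tripleCLM :
    ∃ T : ℂ × ℂ × ℂ →L[ℝ] ℝ × ℝ × ℝ →L[ℝ] ℂ, ∀ a b c, T (a, b, c) = tripleCLM a b c := by
  let L := ContinuousLinearMap.smulRightL ℝ (ℝ × ℝ × ℝ) ℂ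
  refine ⟨(L (ContinuousLinearMap.fst ℝ ℝ (ℝ × ℝ))).comp (ContinuousLinearMap.fst ℝ ℂ (ℂ × ℂ)) +
    ((L ((ContinuousLinearMap.fst ℝ ℝ ℝ).comp (ContinuousLinearMap.snd ℝ ℝ (ℝ × ℝ)))).comp
      ((2 : ℝ) • (ContinuousLinearMap.fst ℝ ℂ ℂ).comp (ContinuousLinearMap.snd ℝ ℂ (ℂ × ℂ))) +
    (L ((ContinuousLinearMap.snd ℝ ℝ ℝ).comp (ContinuousLinearMap.snd ℝ ℝ (ℝ × ℝ)))).comp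
      ((ContinuousLinearMap.snd ℝ ℂ ℂ).comp (ContinuousLinearMap.snd ℝ ℂ (ℂ × ℂ)))),
    fun a b c => ContinuousLinearMap.ext fun q => ?_⟩
  rw [tripleCLM_apply]
  simp [L]
  ring

theorem hasFDerivAt_gauss (q : ℝ × ℝ × ℝ) (a : (Fin 2 → ℤ) × ℝ → ℂ) (p : (Fin 2 → ℤ) × ℝ) :
    HasFDerivAt (fun q => a p * gauss q p)
      (tripleCLM (dWeight 0 0 a p * gauss q p) (dWeight 0 1 a p * gauss q p)
        (dWeight 1 1 a p * gauss q p)) q := by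
  have h1 : HasFDerivAt (fun q => ((-(Real.pi * p.2 * quadForm q p.1) : ℝ) : ℂ))
      (tripleCLM (-Real.pi * p.2 * p.1 0 ^ 2) (-Real.pi * p.2 * (p.1 0 * p.1 1))
        (-Real.pi * p.2 * p.1 1 ^ 2)) q := by
    have e : (fun q => ((-(Real.pi * p.2 * quadForm q p.1) : ℝ) : ℂ)) =
        tripleCLM (-Real.pi * p.2 * p.1 0 ^ 2) (-Real.pi * p.2 * (p.1 0 * p.1 1))
        (-Real.pi * p.2 * p.1 1 ^ 2) := by
      ext q
      rw [tripleCLM_apply, quadForm]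
      push_cast
      ring
    rw [e]
    exact ContinuousLinearMap.hasFDerivAt _
  have h2 := (h1.cexp).const_mul (a p)
  have e2 : (fun q => a p * gauss q p) =
      fun q => a p * Complex.exp ((-(Real.pi * p.2 * quadForm q p.1) : ℝ) : ℂ) := by
    ext q; rw [gauss, Complex.ofReal_exp]
  rw [e2]
  refine h2.congr_fderiv ?_
  refine ContinuousLinearMap.ext fun r => ?_
  simp only [_root_.smul_apply, tripleCLM_apply, smul_eq_mul, dWeight, Pi.mul_apply]
  rw [gauss, Complex.ofReal_exp]
  ring

/-- Differentiation under the integral. The partial derivatives are again theta integrals, since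
multiplying a weight by -π t v_i v_j gives a weight. -/
theorem hasFDerivAt_thetaInt {a : (Fin 2 → ℤ) × ℝ → ℂ} (ha : IsWeight a) {q : ℝ × ℝ × ℝ}
    (hq : q ∈ posForms) :
    HasFDerivAt (thetaInt a) (tripleCLM (thetaInt (dWeight 0 0 a) q)
      (thetaInt (dWeight 0 1 a) q) (thetaInt (dWeight 1 1 a) q)) q := by
  obtain ⟨κ, hκ, ε, hε, h⟩ := exists_nhds_posForms hq
  obtain ⟨B0, hB0⟩ := (ha.dWeight 0 0).exists_bound hκ
  obtain ⟨B1, hB1⟩ := (ha.dWeight 0 1).exists_bound hκ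
  obtain ⟨B2, hB2⟩ := (ha.dWeight 1 1).exists_bound hκ
  have i0 := (ha.dWeight 0 0).integrable hq
  have i1 := (ha.dWeight 0 1).integrable hq
  have i2 := (ha.dWeight 1 1).integrable hq
  have hmain := hasFDerivAt_integral_of_dominated_of_fderiv_le (𝕜 := ℝ) (μ := latticeMeasure)
    (F := fun q p => a p * gauss q p)
    (F' := fun q p => tripleCLM (dWeight 0 0 a p * gauss q p) (dWeight 0 1 a p * gauss q p)
        (dWeight 1 1 a p * gauss q p))
    (bound := fun p => B0 * (‖p.1‖ ^ (-4 : ℝ) * p.2 ^ (-4 : ℝ)) +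
      (2 * (B1 * (‖p.1‖ ^ (-4 : ℝ) * p.2 ^ (-4 : ℝ))) +
        B2 * (‖p.1‖ ^ (-4 : ℝ) * p.2 ^ (-4 : ℝ))))
    (Metric.ball_mem_nhds q hε)
    (Eventually.of_forall fun q =>
      (ha.measurable.mul (measurable_gauss q)).aestronglyMeasurable)
    (ha.integrable hq) ?_ ?_ ?_ ?_
  · refine hmain.congr_fderiv ?_
    refine ContinuousLinearMap.ext fun r => ?_
    rw [ContinuousLinearMap.integral_apply]
    · simp only [tripleCLM_apply]
      have j1 := ((i1.const_mul 2).const_mul (r.2.1 : ℂ))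
      have j2 := i2.const_mul (r.2.2 : ℂ)
      have e1 := integral_add (i0.const_mul (r.1 : ℂ)) (j1.add j2)
      have e2 := integral_add j1 j2
      simp only [Pi.add_apply, integral_const_mul] at e1 e2
      rw [e2] at e1
      exact e1
    · obtain ⟨T, hT⟩ := exists_clm_eq_tripleCLM
      simp_rw [← hT]
      exact T.integrable_comp (i0.prodMk (i1.prodMk i2))
  · obtain ⟨T, hT⟩ := exists_clm_eq_tripleCLM
    simp_rw [← hT]
    exact T.continuous.comp_aestronglyMeasurable (i0.1.prodMk (i1.1.prodMk i2.1))
  · filter_upwards [ae_lattice_one_lt] with p hp q' hq'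
    have key : ∀ {b : (Fin 2 → ℤ) × ℝ → ℂ} {B : ℝ}, (∀ v t, 1 < t → ‖b (v, t)‖ *
        Real.exp (-(Real.pi * t * (κ * ‖v‖ ^ 2))) ≤ B * (‖v‖ ^ (-4 : ℝ) * t ^ (-4 : ℝ))) →
        ‖b p * gauss q' p‖ ≤ B * (‖p.1‖ ^ (-4 : ℝ) * p.2 ^ (-4 : ℝ)) := by
      intro b B hB
      rw [norm_mul]
      exact (mul_le_mul_of_nonneg_left (norm_gauss_le (h q' hq') hp) (norm_nonneg _)).trans
        (hB p.1 p.2 hp)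
    have k0 := key hB0
    have k1 := key hB1
    have k2 := key hB2
    refine ContinuousLinearMap.opNorm_le_bound _
      (by linarith [norm_nonneg (dWeight 0 0 a p * gauss q' p),
        norm_nonneg (dWeight 0 1 a p * gauss q' p), norm_nonneg (dWeight 1 1 a p * gauss q' p)])
      fun r => ?_
    rw [tripleCLM_apply]
    have n1 : ‖(r.1 : ℂ)‖ ≤ ‖r‖ := by rw [Complex.norm_real]; exact norm_fst_le r
    have n2 : ‖(r.2.1 : ℂ)‖ ≤ ‖r‖ := by
      rw [Complex.norm_real]; exact (norm_fst_le r.2).trans (norm_snd_le r)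
    have n3 : ‖(r.2.2 : ℂ)‖ ≤ ‖r‖ := by
      rw [Complex.norm_real]; exact (norm_snd_le r.2).trans (norm_snd_le r)
    refine (norm_add_le _ _).trans ((add_le_add le_rfl (norm_add_le _ _)).trans ?_)
    rw [norm_mul (r.1 : ℂ), norm_mul (r.2.1 : ℂ), norm_mul (r.2.2 : ℂ), norm_mul (2 : ℂ),
      Complex.norm_two]
    have m1 := mul_le_mul n1 k0 (norm_nonneg _) (norm_nonneg r)
    have m2 := mul_le_mul n2 k1 (norm_nonneg _) (norm_nonneg r)
    have m3 := mul_le_mul n3 k2 (norm_nonneg _) (norm_nonneg r)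
    linarith
  · exact ((integrable_lattice_rpow.const_mul B0).add
      (((integrable_lattice_rpow.const_mul B1).const_mul 2).add
        (integrable_lattice_rpow.const_mul B2)))
  · exact Eventually.of_forall fun p q' _ => hasFDerivAt_gauss q' a p

/-- Weights are closed under `dWeight`, so the derivative formula can be iterated; the induction
must therefore be over all weights at once. -/
theorem contDiffOn_thetaInt {a : (Fin 2 → ℤ) × ℝ → ℂ} (ha : IsWeight a) :
    ContDiffOn ℝ ∞ (thetaInt a) posForms := by
  rw [contDiffOn_infty]
  intro n
  induction n generalizing a with
  | zero =>
    exact contDiffOn_zero.mpr fun q hq =>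
      (hasFDerivAt_thetaInt ha hq).continuousAt.continuousWithinAt
  | succ n ih =>
    rw [Nat.cast_succ, contDiffOn_succ_iff_hasFDerivWithinAt_of_uniqueDiffOn
      isOpen_posForms.uniqueDiffOn]
    refine ⟨fun h => by simp at h, _, ?_,
      fun q hq => (hasFDerivAt_thetaInt ha hq).hasFDerivWithinAt⟩
    obtain ⟨T, hT⟩ := exists_clm_eq_tripleCLM
    simp_rw [← hT]
    exact T.contDiff.comp_contDiffOn ((ih (ha.dWeight 0 0)).prodMk
      ((ih (ha.dWeight 0 1)).prodMk (ih (ha.dWeight 1 1))))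

end

end PolyMaass

namespace PolyMaass

noncomputable section

open UpperHalfPlane Filter Topology MeasureTheory
open scoped MatrixGroups ContDiff Manifold ModularForm ComplexConjugate

/-! ### Kernel integrals on the upper half-plane -/

/-- The coefficients of the quadratic form `|c w + d|² / Im w`. -/
def formMap (w : ℂ) : ℝ × ℝ × ℝ := (Complex.normSq w / w.im, w.re / w.im, 1 / w.im)

theorem quadForm_formMap (z : ℍ) (v : Fin 2 → ℤ) :
    quadForm (formMap z) v = Complex.normSq (v 0 * z + v 1) / z.im := by
  have h : z.im ≠ 0 := z.im_pos.ne'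
  simp only [quadForm, formMap, Complex.normSq_apply, coe_im, coe_re, Complex.add_re,
    Complex.mul_re, Complex.add_im, Complex.mul_im, Complex.intCast_re, Complex.intCast_im]
  field_simp
  ring

theorem r_sq_mul_le_quadForm (z : ℍ) (v : Fin 2 → ℤ) :
    EisensteinSeries.r z ^ 2 / z.im * ‖v‖ ^ 2 ≤ quadForm (formMap z) v := by
  rw [quadForm_formMap, Complex.normSq_eq_norm_sq]
  by_cases hv : v = 0
  · simp [hv]
  · have h := EisensteinSeries.r_mul_max_le z hv
    have h0 := EisensteinSeries.r_pos z
    have hy := z.im_pos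
    rw [div_mul_eq_mul_div, ← mul_pow]
    gcongr

theorem formMap_mem (z : ℍ) : formMap z ∈ posForms :=
  ⟨EisensteinSeries.r z ^ 2 / z.im,
    div_pos (pow_pos (EisensteinSeries.r_pos z) 2) z.im_pos, r_sq_mul_le_quadForm z⟩

theorem contDiffOn_formMap : ContDiffOn ℝ ∞ formMap {w : ℂ | 0 < w.im} := by
  have hi : ContDiff ℝ ∞ Complex.im := Complex.imCLM.contDiff
  have hr : ContDiff ℝ ∞ Complex.re := Complex.reCLM.contDiff
  have hn : ContDiff ℝ ∞ fun w : ℂ => Complex.normSq w := by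
    simp only [Complex.normSq_apply]
    exact (hr.mul hr).add (hi.mul hi)
  have h0 : ∀ w ∈ {w : ℂ | 0 < w.im}, w.im ≠ 0 := fun w hw => ne_of_gt hw
  exact (hn.contDiffOn.div hi.contDiffOn h0).prodMk
    ((hr.contDiffOn.div hi.contDiffOn h0).prodMk (contDiffOn_const.div hi.contDiffOn h0))

/-- The derivative of `formMap` in the direction `v`. -/
def dForm (v : ℂ) (z : ℍ) : ℝ × ℝ × ℝ := fderiv ℝ formMap z v

theorem contDiffOn_dForm (v : ℂ) :
    ContDiffOn ℝ ∞ (dForm v ∘ ofComplex) {w : ℂ | 0 < w.im} := by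
  have h : ContDiffOn ℝ ∞ (fun w => fderiv ℝ formMap w v) {w : ℂ | 0 < w.im} :=
    (contDiffOn_formMap.fderiv_of_isOpen isOpen_im_pos (by simp)).clm_apply contDiffOn_const
  refine h.congr fun w hw => ?_
  simp only [Function.comp_apply, dForm]
  rw [ofComplex_apply_of_im_pos hw]

theorem isSmooth_clm_dForm (T : ℝ × ℝ × ℝ →L[ℝ] ℂ) (v : ℂ) : IsSmooth fun z => T (dForm v z) :=
  T.contDiff.comp_contDiffOn (contDiffOn_dForm v)

theorem hasFDerivAt_comp_formMap {Θ : ℝ × ℝ × ℝ → ℂ} {Θ' : ℝ × ℝ × ℝ →L[ℝ] ℂ} {z : ℍ}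
    (h : HasFDerivAt Θ Θ' (formMap z)) :
    HasFDerivAt ((fun z : ℍ => Θ (formMap z)) ∘ ofComplex) (Θ' ∘L fderiv ℝ formMap z) (z : ℂ) := by
  have h1 : HasFDerivAt formMap (fderiv ℝ formMap z) (z : ℂ) :=
    ((contDiffOn_formMap.differentiableOn (by simp)).differentiableAt
      (isOpen_im_pos.mem_nhds z.im_pos)).hasFDerivAt
  refine (h.comp (z : ℂ) h1).congr_of_eventuallyEq ?_
  filter_upwards [isOpen_im_pos.mem_nhds z.im_pos] with w hw
  simp only [Function.comp_apply]
  rw [ofComplex_apply_of_im_pos hw]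

theorem pd_mul_comp_formMap {c : ℍ → ℂ} (hc : IsSmooth c) {Θ : ℝ × ℝ × ℝ → ℂ}
    {Θ' : ℝ × ℝ × ℝ →L[ℝ] ℂ} {z : ℍ} (h : HasFDerivAt Θ Θ' (formMap z)) (v : ℂ) :
    pd v (fun z => c z * Θ (formMap z)) z
      = pd v c z * Θ (formMap z) + c z * Θ' (dForm v z) := by
  have h1 := (hc.differentiableAt z).hasFDerivAt.mul (hasFDerivAt_comp_formMap h)
  have e : (fun z => c z * Θ (formMap z)) ∘ ofComplex
      = (c ∘ ofComplex) * ((fun z : ℍ => Θ (formMap z)) ∘ ofComplex) := rfl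
  rw [pd, e, h1.fderiv]
  simp [pd, dForm]
  ring

theorem IsSmooth.comp_formMap {Θ : ℝ × ℝ × ℝ → ℂ} (h : ContDiffOn ℝ ∞ Θ posForms) :
    IsSmooth fun z => Θ (formMap z) := by
  have h1 : ContDiffOn ℝ ∞ (fun w => Θ (formMap w)) {w : ℂ | 0 < w.im} :=
    h.comp contDiffOn_formMap fun w hw => formMap_mem ⟨w, hw⟩
  refine h1.congr fun w hw => ?_
  simp only [Function.comp_apply]
  rw [ofComplex_apply_of_im_pos hw]

theorem contDiff_gauss (p : (Fin 2 → ℤ) × ℝ) : ContDiff ℝ ∞ fun q => gauss q p := by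
  refine Complex.ofRealCLM.contDiff.comp (Real.contDiff_exp.comp ?_)
  unfold quadForm
  fun_prop

/-- Finite sums of products of a smooth function of `z`, a weight and the Gaussian
`e^{-π t |c z + d|² / y}`. -/
inductive IsKernel : (ℍ → (Fin 2 → ℤ) × ℝ → ℂ) → Prop
  | base {c : ℍ → ℂ} {a : (Fin 2 → ℤ) × ℝ → ℂ} (hc : IsSmooth c) (ha : IsWeight a) :
      IsKernel fun z p => c z * (a p * gauss (formMap z) p)
  | add {k l : ℍ → (Fin 2 → ℤ) × ℝ → ℂ} (hk : IsKernel k) (hl : IsKernel l) :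
      IsKernel fun z p => k z p + l z p

theorem IsKernel.integrable {k : ℍ → (Fin 2 → ℤ) × ℝ → ℂ} (hk : IsKernel k) (z : ℍ) :
    Integrable (k z) latticeMeasure := by
  induction hk with
  | base hc ha => exact (ha.integrable (formMap_mem z)).const_mul _
  | add _ _ h1 h2 => exact h1.add h2

theorem IsKernel.isSmooth {k : ℍ → (Fin 2 → ℤ) × ℝ → ℂ} (hk : IsKernel k)
    (p : (Fin 2 → ℤ) × ℝ) : IsSmooth fun z => k z p := by
  induction hk with
  | base hc ha =>
    exact hc.mul ((IsSmooth.const _).mul (IsSmooth.comp_formMap (contDiff_gauss p).contDiffOn))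
  | add _ _ h1 h2 => exact h1.add h2

theorem IsKernel.isSmooth_integral {k : ℍ → (Fin 2 → ℤ) × ℝ → ℂ} (hk : IsKernel k) :
    IsSmooth fun z => ∫ p, k z p ∂latticeMeasure := by
  induction hk with
  | base hc ha =>
    simp_rw [integral_const_mul]
    exact hc.mul (IsSmooth.comp_formMap (contDiffOn_thetaInt ha))
  | add h1 h2 i1 i2 =>
    simp_rw [integral_add (h1.integrable _) (h2.integrable _)]
    exact i1.add i2

theorem IsKernel.smul {k : ℍ → (Fin 2 → ℤ) × ℝ → ℂ} (hk : IsKernel k) {c : ℍ → ℂ}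
    (hc : IsSmooth c) : IsKernel fun z p => c z * k z p := by
  induction hk with
  | base hd ha =>
    simp_rw [← mul_assoc (c _)]
    exact .base (hc.mul hd) ha
  | add _ _ h1 h2 =>
    simp_rw [mul_add]
    exact .add h1 h2

/-- Closure of the class under differentiation is what lets the second-order Laplacian pass under
the integral. In the base case the chain rule through `formMap` gives one term from the coefficient
and three from the entries of the quadratic form. -/
theorem IsKernel.pd {k : ℍ → (Fin 2 → ℤ) × ℝ → ℂ} (hk : IsKernel k) (v : ℂ) :
    IsKernel (fun z p => pd v (fun z => k z p) z) ∧
      ∀ z, PolyMaass.pd v (fun z => ∫ p, k z p ∂latticeMeasure) z =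
        ∫ p, PolyMaass.pd v (fun z => k z p) z ∂latticeMeasure := by
  induction hk with
  | @base c a hc ha =>
    have e : ∀ z p, PolyMaass.pd v (fun z => c z * (a p * gauss (formMap z) p)) z =
        PolyMaass.pd v c z * (a p * gauss (formMap z) p) +
        ((c z * (dForm v z).1) * (dWeight 0 0 a p * gauss (formMap z) p) +
        ((c z * (2 * (dForm v z).2.1)) * (dWeight 0 1 a p * gauss (formMap z) p) +
        (c z * (dForm v z).2.2) * (dWeight 1 1 a p * gauss (formMap z) p))) := by
      intro z p
      rw [pd_mul_comp_formMap hc (hasFDerivAt_gauss (formMap z) a p), tripleCLM_apply]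
      ring
    have s1 : IsSmooth fun z => c z * ((dForm v z).1 : ℂ) := by
      have := hc.mul (isSmooth_clm_dForm (tripleCLM 1 0 0) v)
      simpa only [tripleCLM_apply, mul_one, mul_zero, add_zero] using! this
    have s2 : IsSmooth fun z => c z * (2 * ((dForm v z).2.1 : ℂ)) := by
      have := hc.mul (isSmooth_clm_dForm (tripleCLM 0 1 0) v)
      convert! this using 1
      ext z
      simp only [Pi.mul_apply, tripleCLM_apply]
      ring
    have s3 : IsSmooth fun z => c z * ((dForm v z).2.2 : ℂ) := by
      have := hc.mul (isSmooth_clm_dForm (tripleCLM 0 0 1) v)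
      simpa only [tripleCLM_apply, mul_one, mul_zero, add_zero, zero_add] using! this
    have k0 := IsKernel.base (hc.pd v) ha
    have k1 := IsKernel.base s1 (ha.dWeight 0 0)
    have k2 := IsKernel.base s2 (ha.dWeight 0 1)
    have k3 := IsKernel.base s3 (ha.dWeight 1 1)
    constructor
    · simp_rw [e]
      exact k0.add (k1.add (k2.add k3))
    · intro z
      simp_rw [e]
      rw [integral_add (k0.integrable z) ((k1.add (k2.add k3)).integrable z),
        integral_add (k1.integrable z) ((k2.add k3).integrable z),
        integral_add (k2.integrable z) (k3.integrable z)]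
      simp_rw [integral_const_mul]
      have h := pd_mul_comp_formMap hc (hasFDerivAt_thetaInt ha (formMap_mem z)) v
      rw [tripleCLM_apply] at h
      simp only [thetaInt] at h
      rw [h]
      ring
  | @add k l h1 h2 i1 i2 =>
    have e : ∀ z p, PolyMaass.pd v (fun z => k z p + l z p) z =
        PolyMaass.pd v (fun z => k z p) z + PolyMaass.pd v (fun z => l z p) z := fun z p =>
      congrFun (pd_add v (h1.isSmooth p) (h2.isSmooth p)) z
    constructor
    · simp_rw [e]
      exact i1.1.add i2.1
    · intro z
      simp_rw [e]
      rw [integral_add (i1.1.integrable z) (i2.1.integrable z), ← i1.2, ← i2.2]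
      have h := congrFun (pd_add v h1.isSmooth_integral h2.isSmooth_integral) z
      rw [Pi.add_apply] at h
      rw [← h]
      congr 1
      ext z
      exact integral_add (h1.integrable z) (h2.integrable z)

theorem IsKernel.dz {k : ℍ → (Fin 2 → ℤ) × ℝ → ℂ} (hk : IsKernel k) :
    IsKernel (fun z p => dz (fun z => k z p) z) ∧
      ∀ z, PolyMaass.dz (fun z => ∫ p, k z p ∂latticeMeasure) z =
        ∫ p, PolyMaass.dz (fun z => k z p) z ∂latticeMeasure := by
  have e : ∀ z p, PolyMaass.dz (fun z => k z p) z =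
      (1 / 2) * PolyMaass.pd 1 (fun z => k z p) z +
        (-Complex.I / 2) * PolyMaass.pd Complex.I (fun z => k z p) z := fun z p => by
    simp only [PolyMaass.dz, pdx, pdy]; ring
  have h1 := (hk.pd 1).1.smul (IsSmooth.const (1 / 2))
  have h2 := (hk.pd Complex.I).1.smul (IsSmooth.const (-Complex.I / 2))
  simp_rw [e]
  refine ⟨h1.add h2, fun z => ?_⟩
  rw [integral_add (h1.integrable z) (h2.integrable z), integral_const_mul, integral_const_mul,
    ← (hk.pd 1).2, ← (hk.pd Complex.I).2]
  simp only [PolyMaass.dz, pdx, pdy]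
  ring

theorem IsKernel.dzb {k : ℍ → (Fin 2 → ℤ) × ℝ → ℂ} (hk : IsKernel k) :
    IsKernel (fun z p => dzb (fun z => k z p) z) ∧
      ∀ z, PolyMaass.dzb (fun z => ∫ p, k z p ∂latticeMeasure) z =
        ∫ p, PolyMaass.dzb (fun z => k z p) z ∂latticeMeasure := by
  have e : ∀ z p, PolyMaass.dzb (fun z => k z p) z =
      (1 / 2) * PolyMaass.pd 1 (fun z => k z p) z +
        (Complex.I / 2) * PolyMaass.pd Complex.I (fun z => k z p) z := fun z p => by
    simp only [PolyMaass.dzb, pdx, pdy]; ring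
  have h1 := (hk.pd 1).1.smul (IsSmooth.const (1 / 2))
  have h2 := (hk.pd Complex.I).1.smul (IsSmooth.const (Complex.I / 2))
  simp_rw [e]
  refine ⟨h1.add h2, fun z => ?_⟩
  rw [integral_add (h1.integrable z) (h2.integrable z), integral_const_mul, integral_const_mul,
    ← (hk.pd 1).2, ← (hk.pd Complex.I).2]
  simp only [PolyMaass.dzb, pdx, pdy]
  ring

theorem IsKernel.lap {k : ℍ → (Fin 2 → ℤ) × ℝ → ℂ} (hk : IsKernel k) :
    IsKernel (fun z p => lap 2 (fun z => k z p) z) ∧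
      ∀ z, PolyMaass.lap 2 (fun z => ∫ p, k z p ∂latticeMeasure) z =
        ∫ p, PolyMaass.lap 2 (fun z => k z p) z ∂latticeMeasure := by
  have hy : IsSmooth fun z : ℍ => (z.im : ℂ) ^ 2 := by
    simp_rw [sq]; exact IsSmooth.im.mul IsSmooth.im
  have hl := hk.dzb.1.smul hy
  have e : ∀ z p, PolyMaass.lap 2 (fun z => k z p) z = 4 * PolyMaass.dz
      (fun z : ℍ => (z.im : ℂ) ^ 2 * PolyMaass.dzb (fun z => k z p) z) z := fun z p =>
    lap_two_eq (hk.isSmooth p) z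
  simp_rw [e]
  refine ⟨hl.dz.1.smul (IsSmooth.const 4), fun z => ?_⟩
  rw [integral_const_mul, ← hl.dz.2, lap_two_eq hk.isSmooth_integral]
  congr 2
  ext z
  rw [integral_const_mul, ← hk.dzb.2]
  rfl

end

end PolyMaass

namespace PolyMaass

noncomputable section

open UpperHalfPlane Filter Topology MeasureTheory
open scoped MatrixGroups ContDiff Manifold ModularForm ComplexConjugate

/-! ### Iterated integration: summing over the lattice term by term -/

theorem integrableOn_of_lattice {f : (Fin 2 → ℤ) × ℝ → ℂ} (hf : Integrable f latticeMeasure)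
    (v : Fin 2 → ℤ) : IntegrableOn (fun t => f (v, t)) (Set.Ioi 1) := by
  have h := hf.prod_right_ae
  have h1 := Measure.ae_count_iff.mp h v
  exact h1

theorem hasSum_integral_lattice {f : (Fin 2 → ℤ) × ℝ → ℂ} (hf : Integrable f latticeMeasure) :
    HasSum (fun v => ∫ t in Set.Ioi (1 : ℝ), f (v, t)) (∫ p, f p ∂latticeMeasure) := by
  have h1 := hf.integral_prod_left
  have h2 : Summable fun v => ∫ t in Set.Ioi (1 : ℝ), f (v, t) :=
    (integrable_count_iff.mp h1).of_norm
  have h3 : ∫ p, f p ∂latticeMeasure = ∑' v, ∫ t in Set.Ioi (1 : ℝ), f (v, t) := by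
    rw [latticeMeasure, integral_prod _ hf, integral_countable h1]
    simp
  rw [h3]
  exact h2.hasSum

/-! ### Weight functions of polynomial growth -/

/-- Measurable functions of at most polynomial growth on `(1, ∞)`. -/
structure IsPolyBdd (w : ℝ → ℂ) : Prop where
  measurable : Measurable w
  bound : ∃ (C : ℝ) (n : ℕ), 0 ≤ C ∧ ∀ t, 1 < t → ‖w t‖ ≤ C * t ^ n

theorem IsPolyBdd.mul {w u : ℝ → ℂ} (hw : IsPolyBdd w) (hu : IsPolyBdd u) :
    IsPolyBdd fun t => w t * u t := by
  obtain ⟨C, n, hC, h1⟩ := hw.bound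
  obtain ⟨D, m, hD, h2⟩ := hu.bound
  refine ⟨hw.measurable.mul hu.measurable, C * D, n + m, by positivity, fun t ht => ?_⟩
  have ht0 : 0 < t := by linarith
  rw [norm_mul]
  calc _ ≤ (C * t ^ n) * (D * t ^ m) :=
        mul_le_mul (h1 t ht) (h2 t ht) (norm_nonneg _) (by positivity)
    _ = _ := by ring

theorem IsPolyBdd.add {w u : ℝ → ℂ} (hw : IsPolyBdd w) (hu : IsPolyBdd u) :
    IsPolyBdd fun t => w t + u t := by
  obtain ⟨C, n, hC, h1⟩ := hw.bound
  obtain ⟨D, m, hD, h2⟩ := hu.bound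
  refine ⟨hw.measurable.add hu.measurable, C + D, n + m, by positivity, fun t ht => ?_⟩
  have e1 : t ^ n ≤ t ^ (n + m) := pow_le_pow_right₀ ht.le (by omega)
  have e2 : t ^ m ≤ t ^ (n + m) := pow_le_pow_right₀ ht.le (by omega)
  calc _ ≤ C * t ^ n + D * t ^ m := (norm_add_le _ _).trans (add_le_add (h1 t ht) (h2 t ht))
    _ ≤ C * t ^ (n + m) + D * t ^ (n + m) := by gcongr
    _ = _ := by ring

theorem IsPolyBdd.const (c : ℂ) : IsPolyBdd fun _ => c :=
  ⟨measurable_const, ‖c‖, 0, norm_nonneg _, fun t _ => by simp⟩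

theorem IsPolyBdd.id : IsPolyBdd fun t => (t : ℂ) :=
  ⟨Complex.measurable_ofReal, 1, 1, zero_le_one, fun t ht => by
    rw [Complex.norm_real, Real.norm_of_nonneg (by linarith)]; simp⟩

theorem IsPolyBdd.inv : IsPolyBdd fun t => (t : ℂ)⁻¹ :=
  ⟨Complex.measurable_ofReal.inv, 1, 0, zero_le_one, fun t ht => by
    rw [norm_inv, Complex.norm_real, Real.norm_of_nonneg (by linarith)]
    simpa using inv_le_one_of_one_le₀ ht.le⟩

theorem IsPolyBdd.log : IsPolyBdd fun t => (Real.log t : ℂ) :=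
  ⟨Complex.measurable_ofReal.comp Real.measurable_log, 1, 1, zero_le_one, fun t ht => by
    rw [Complex.norm_real, Real.norm_of_nonneg (Real.log_nonneg ht.le)]
    linarith [Real.log_le_sub_one_of_pos (by linarith : 0 < t)]⟩

theorem IsPolyBdd.pow {w : ℝ → ℂ} (hw : IsPolyBdd w) (n : ℕ) : IsPolyBdd fun t => w t ^ n := by
  induction n with
  | zero => simpa using IsPolyBdd.const 1
  | succ n ih => simp_rw [pow_succ]; exact ih.mul hw

theorem IsPolyBdd.tendsto_mul_exp {w : ℝ → ℂ} (hw : IsPolyBdd w) {x : ℝ} (hx : 0 < x) :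
    Tendsto (fun t => w t * ((Real.exp (-(x * t)) : ℝ) : ℂ)) atTop (𝓝 0) := by
  obtain ⟨C, n, hC, h⟩ := hw.bound
  have h1 := (Real.tendsto_pow_mul_exp_neg_atTop_nhds_zero n).comp
    (tendsto_id.const_mul_atTop hx)
  have h2 := h1.const_mul (C / x ^ n)
  rw [mul_zero] at h2
  refine squeeze_zero_norm' ?_ h2
  filter_upwards [eventually_gt_atTop 1] with t ht
  rw [norm_mul, Complex.norm_real, Real.norm_of_nonneg (Real.exp_pos _).le]
  calc _ ≤ C * t ^ n * Real.exp (-(x * t)) :=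
        mul_le_mul_of_nonneg_right (h t ht) (Real.exp_pos _).le
    _ = _ := by
        simp only [Function.comp_apply, _root_.id, mul_pow]
        field_simp

/-- Integrating by parts twice to move the second derivative of `t² e^{-xt}` onto `w`. -/
theorem integral_exp_mul_by_parts {w w' w'' : ℝ → ℂ} (hw : IsPolyBdd w) (hw' : IsPolyBdd w')
    (h1 : ∀ t, 0 < t → HasDerivAt w (w' t) t) (h2 : ∀ t, 0 < t → HasDerivAt w' (w'' t) t)
    {x : ℝ} (hx : 0 < x)
    (i1 : IntegrableOn (fun t => (x ^ 2 * t ^ 2 - 4 * x * t + 2) * w t *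
      ((Real.exp (-(x * t)) : ℝ) : ℂ)) (Set.Ioi 1))
    (i2 : IntegrableOn (fun t => t ^ 2 * w'' t * ((Real.exp (-(x * t)) : ℝ) : ℂ)) (Set.Ioi 1)) :
    ∫ t in Set.Ioi (1 : ℝ), (x ^ 2 * t ^ 2 - 4 * x * t + 2) * w t *
      ((Real.exp (-(x * t)) : ℝ) : ℂ) =
    (∫ t in Set.Ioi (1 : ℝ), t ^ 2 * w'' t * ((Real.exp (-(x * t)) : ℝ) : ℂ)) +
      (w' 1 - (2 - x) * w 1) * ((Real.exp (-x) : ℝ) : ℂ) := by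
  -- With E = e^{-xt}, the antiderivative is (t²E)' w - t²E w'. Its derivative is (t²E)'' w - t²E
  -- w'', and (t²E)'' = (x²t² - 4xt + 2)E.
  set A : ℝ → ℂ := fun t => ((2 * t - x * t ^ 2) * w t - t ^ 2 * w' t) *
    ((Real.exp (-(x * t)) : ℝ) : ℂ) with hA
  have hd : ∀ t, 0 < t → HasDerivAt A ((x ^ 2 * t ^ 2 - 4 * x * t + 2) * w t *
      ((Real.exp (-(x * t)) : ℝ) : ℂ) - t ^ 2 * w'' t * ((Real.exp (-(x * t)) : ℝ) : ℂ)) t := by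
    intro t ht
    have ht1 : HasDerivAt (fun t : ℝ => (t : ℂ)) 1 t := Complex.ofRealCLM.hasDerivAt
    have he : HasDerivAt (fun t : ℝ => ((Real.exp (-(x * t)) : ℝ) : ℂ))
        ((Real.exp (-(x * t)) * (-(x * 1)) : ℝ) : ℂ) t :=
      (((hasDerivAt_id t).const_mul x).neg.exp).ofReal_comp
    have := ((((ht1.const_mul 2).sub ((ht1.pow 2).const_mul (x : ℂ))).mul (h1 t ht)).sub
      ((ht1.pow 2).mul (h2 t ht))).mul he
    refine this.congr_deriv ?_
    simp only [Pi.mul_apply, Pi.sub_apply, Pi.pow_apply]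
    push_cast
    ring
  have hlim : Tendsto A atTop (𝓝 0) := by
    have hpoly : IsPolyBdd fun t => (2 * t - x * t ^ 2) * w t - t ^ 2 * w' t := by
      have p1 := ((((IsPolyBdd.const 2).mul .id).add ((IsPolyBdd.const (-x)).mul
        (IsPolyBdd.id.pow 2))).mul hw).add (((IsPolyBdd.const (-1)).mul (IsPolyBdd.id.pow 2)).mul hw')
      convert! p1 using 2
      ring
    exact hpoly.tendsto_mul_exp hx
  have hI := integral_Ioi_of_hasDerivAt_of_tendsto (a := 1) (m := 0)
    ((hd 1 one_pos).continuousAt.continuousWithinAt)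
    (fun t ht => hd t (by linarith [Set.mem_Ioi.mp ht])) (i1.sub i2) hlim
  rw [integral_sub i1 i2] at hI
  rw [sub_eq_iff_eq_add.mp hI]
  simp only [hA]
  push_cast
  simp only [mul_one]
  ring

/-! ### The weight two theta kernel -/

/-- The kernel `((c z̄ + d)/y)² w(t) e^{-π t |c z + d|² / y}`. -/
def eisKernel (w : ℝ → ℂ) (z : ℍ) (p : (Fin 2 → ℤ) × ℝ) : ℂ :=
  ((p.1 0 * conj (z : ℂ) + p.1 1) / z.im) ^ 2 * (w p.2 * gauss (formMap z) p)

theorem IsPolyBdd.isWeight {w : ℝ → ℂ} (hw : IsPolyBdd w) (i j : Fin 2) :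
    IsWeight fun p => (p.1 i : ℂ) * ((p.1 j : ℂ) * w p.2) := by
  obtain ⟨C, n, hC, h⟩ := hw.bound
  have hm := hw.measurable
  refine ⟨by fun_prop, fun t => by simp, C, n + 2, hC, fun v t ht => ?_⟩
  by_cases hv : v = 0
  · subst hv
    simp
  have hv1 := one_le_norm_of_ne_zero hv
  have ht0 : 0 < t := by linarith
  rw [norm_mul, norm_mul, Complex.norm_intCast, Complex.norm_intCast]
  calc _ ≤ ‖v‖ * (‖v‖ * (C * t ^ n)) := by
        have := abs_coord_le v i
        have := abs_coord_le v j
        have := h t ht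
        gcongr
    _ = C * (‖v‖ ^ 2 * 1) * (t ^ n * 1) := by ring
    _ ≤ C * (‖v‖ ^ 2 * ‖v‖ ^ n) * (t ^ n * t ^ 2) := by
        have := one_le_pow₀ hv1 (n := n)
        have := one_le_pow₀ ht.le (n := 2)
        gcongr
    _ = _ := by rw [mul_pow]; ring

theorem isKernel_eisKernel {w : ℝ → ℂ} (hw : IsPolyBdd w) : IsKernel (eisKernel w) := by
  have hy : IsSmooth (fun z : ℍ => (z.im : ℂ))⁻¹ :=
    IsSmooth.im.inv fun z => by exact_mod_cast z.im_pos.ne'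
  have hc := IsSmooth.conj_coe
  have k1 := IsKernel.base ((hc.mul hc).mul (hy.mul hy)) (hw.isWeight 0 0)
  have k2 := IsKernel.base ((IsSmooth.const 2).mul (hc.mul (hy.mul hy))) (hw.isWeight 0 1)
  have k3 := IsKernel.base (hy.mul hy) (hw.isWeight 1 1)
  convert! k1.add (k2.add k3) using 3 with z p
  simp only [eisKernel, Pi.mul_apply, Pi.inv_apply]
  field_simp
  ring

theorem gauss_eq (z : ℍ) (p : (Fin 2 → ℤ) × ℝ) :
    gauss (formMap z) p = Complex.exp (-(Real.pi * p.2) *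
      ((p.1 0 * z + p.1 1) * ((p.1 0 * conj (z : ℂ) + p.1 1) * (z.im : ℂ)⁻¹))) := by
  rw [gauss, quadForm_formMap, Complex.ofReal_exp]
  congr 1
  push_cast
  rw [← Complex.mul_conj]
  simp only [map_add, map_mul, map_intCast]
  ring

theorem ofReal_quadForm (z : ℍ) (v : Fin 2 → ℤ) : (quadForm (formMap z) v : ℂ) =
    (v 0 * z + v 1) * ((v 0 * conj (z : ℂ) + v 1) * (z.im : ℂ)⁻¹) := by
  rw [quadForm_formMap]
  push_cast
  rw [← Complex.mul_conj]
  simp only [map_add, map_mul, map_intCast]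
  ring

/-- With R and Q = ℓR as below, applying y² ∂_z̄ to R² F(Q) gives -i(Q F + Q² F'/2), a function of Q
alone, and ∂_z restores R² because ∂Q/∂z = (i/2)R². For F = e^{-πtQ} the resulting factor is the one
in (d²/dt²)(t² e^{-xt}) with x = πQ. -/
theorem lap_eisKernel {w : ℝ → ℂ} (hw : IsPolyBdd w) (z : ℍ) (p : (Fin 2 → ℤ) × ℝ) :
    lap 2 (fun z => eisKernel w z p) z =
      ((Real.pi * quadForm (formMap z) p.1) ^ 2 * p.2 ^ 2
        - 4 * (Real.pi * quadForm (formMap z) p.1) * p.2 + 2) * eisKernel w z p := by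
  obtain ⟨v, t⟩ := p
  set c : ℂ := ((v 0 : ℤ) : ℂ) with hc
  set d : ℂ := ((v 1 : ℤ) : ℂ) with hd
  have hy0 : ∀ z : ℍ, (z.im : ℂ) ≠ 0 := fun z => by exact_mod_cast z.im_pos.ne'
  have hzy : ∀ z : ℍ, (z : ℂ) - conj (z : ℂ) = 2 * Complex.I * z.im := fun z => by
    apply Complex.ext <;> simp
    ring
  set ell : ℍ → ℂ := (fun _ : ℍ => c) * (fun z : ℍ => (z : ℂ)) + fun _ : ℍ => d with hell
  set R : ℍ → ℂ := ((fun _ : ℍ => c) * (fun z : ℍ => conj (z : ℂ)) + fun _ : ℍ => d) *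
    ((fun x => x⁻¹) ∘ fun z : ℍ => (z.im : ℂ)) with hR
  set Q : ℍ → ℂ := ell * R with hQ
  have wR : ∀ z, HasWirtinger R z (Complex.I / 2 * (R z / z.im))
      (-(Complex.I / 2) * (ell z / z.im ^ 2)) := by
    intro z
    have h1 := ((HasWirtinger.const c z).mul (hasWirtinger_conj z)).add (HasWirtinger.const d z)
    have h2 := (hasWirtinger_im z).comp (hasDerivAt_inv (hy0 z))
    have h := h1.mul h2
    convert! h using 1
    · simp only [hR, Pi.mul_apply, Pi.add_apply, Function.comp_apply]
      field_simp [hy0 z]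
      ring
    · simp only [hell, Pi.mul_apply, Pi.add_apply, Function.comp_apply]
      have := hy0 z
      field_simp
      linear_combination (-Complex.I * c) * hzy z - 2 * c * z.im * Complex.I_sq
  have well : ∀ z, HasWirtinger ell z c 0 := by
    intro z
    have h1 := ((HasWirtinger.const c z).mul (hasWirtinger_coe z)).add (HasWirtinger.const d z)
    convert! h1 using 1 <;> simp
  have hlR : ∀ z : ℍ, ell z - z.im * R z = 2 * Complex.I * c * z.im := by
    intro z
    have := hy0 z
    simp only [hell, hR, Pi.mul_apply, Pi.add_apply, Function.comp_apply]
    field_simp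
    linear_combination c * hzy z
  have wQ : ∀ z, HasWirtinger Q z (Complex.I / 2 * R z ^ 2)
      (-(Complex.I / 2) * (ell z / z.im) ^ 2) := by
    intro z
    have h := (well z).mul (wR z)
    have := hy0 z
    convert! h using 1
    · field_simp
      linear_combination (-Complex.I * R z) * hlR z - (2 * R z * c * z.im) * Complex.I_sq
    · field_simp
      ring
  have hRdef : ∀ z : ℍ, R z = (c * conj (z : ℂ) + d) / z.im := fun z => by
    simp only [hR, Pi.mul_apply, Pi.add_apply, Function.comp_apply]; ring
  have hQdef : ∀ z : ℍ, (quadForm (formMap z) v : ℂ) = Q z := fun z => by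
    rw [ofReal_quadForm]
    simp only [hQ, hell, hR, Pi.mul_apply, Pi.add_apply, Function.comp_apply, hc, hd]
  have hE : ∀ z : ℍ, gauss (formMap z) (v, t) = Complex.exp (-(Real.pi * t) * Q z) := fun z => by
    rw [gauss_eq, ← ofReal_quadForm, hQdef]
  have hker : (fun z => eisKernel w z (v, t)) =
      (R * R) * ((fun q => w t * Complex.exp (-(Real.pi * t) * q)) ∘ Q) := by
    ext z
    simp only [eisKernel, Pi.mul_apply, Function.comp_apply, hE, hRdef, ← hc, ← hd]
    ring
  have hexp : ∀ q : ℂ, HasDerivAt (fun q => w t * Complex.exp (-(Real.pi * t) * q))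
      (w t * (Complex.exp (-(Real.pi * t) * q) * -(Real.pi * t))) q := fun q => by
    have := (((hasDerivAt_id q).const_mul (-(Real.pi * t : ℂ))).cexp).const_mul (w t)
    simpa using! this
  have hlow : lower (fun z => eisKernel w z (v, t)) =
      (fun q => (-Complex.I * (q - Real.pi * t / 2 * q ^ 2)) *
        (w t * Complex.exp (-(Real.pi * t) * q))) ∘ Q := by
    ext z
    rw [hker, lower, (((wR z).mul (wR z)).mul ((wQ z).comp (hexp (Q z)))).dzb]
    have := hy0 z
    have hQz : Q z = ell z * R z := rfl
    simp only [Function.comp_apply, Pi.mul_apply]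
    rw [hQz]
    field_simp
    ring
  have hfin : ∀ q : ℂ, HasDerivAt (fun q => (-Complex.I * (q - Real.pi * t / 2 * q ^ 2)) *
        (w t * Complex.exp (-(Real.pi * t) * q)))
      (-Complex.I * (1 - 2 * (Real.pi * t * q) + (Real.pi * t * q) ^ 2 / 2) *
        (w t * Complex.exp (-(Real.pi * t) * q))) q := fun q => by
    have h0 := (((hasDerivAt_id q).sub (((hasDerivAt_id q).pow 2).const_mul
      (Real.pi * t / 2 : ℂ))).const_mul (-Complex.I)).mul (hexp q)
    refine h0.congr_deriv ?_
    simp only [Pi.sub_apply, Pi.pow_apply, id]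
    push_cast
    ring
  rw [lap_two_eq ((isKernel_eisKernel hw).isSmooth (v, t)), hlow, ((wQ z).comp (hfin (Q z))).dz,
    hQdef]
  have hk := congrFun hker z
  rw [hk]
  simp only [Pi.mul_apply, Function.comp_apply]
  linear_combination (-2 * (1 - 2 * (Real.pi * t * Q z) + (Real.pi * t * Q z) ^ 2 / 2) *
        (w t * Complex.exp (-(Real.pi * t) * Q z)) * R z ^ 2) * Complex.I_sq

end

end PolyMaass

namespace PolyMaass

noncomputable section

open UpperHalfPlane Filter Topology MeasureTheory
open scoped MatrixGroups ContDiff Manifold ModularForm ComplexConjugate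

/-! ### Eisenstein integrals -/

/-- The Eisenstein integral
`∑_{(c,d)} ∫₁^∞ ((c z̄ + d)/y)² w(t) e^{-π t |c z + d|² / y} dt`. -/
def eisInt (w : ℝ → ℂ) (z : ℍ) : ℂ := ∫ p, eisKernel w z p ∂latticeMeasure

theorem hasSum_eisInt {w : ℝ → ℂ} (hw : IsPolyBdd w) (z : ℍ) :
    HasSum (fun v => ∫ t in Set.Ioi (1 : ℝ), eisKernel w z (v, t)) (eisInt w z) :=
  hasSum_integral_lattice ((isKernel_eisKernel hw).integrable z)

theorem isSmooth_eisInt {w : ℝ → ℂ} (hw : IsPolyBdd w) : IsSmooth (eisInt w) :=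
  (isKernel_eisKernel hw).isSmooth_integral

theorem eisInt_add {w u : ℝ → ℂ} (hw : IsPolyBdd w) (hu : IsPolyBdd u) (z : ℍ) :
    eisInt (fun t => w t + u t) z = eisInt w z + eisInt u z := by
  rw [eisInt, eisInt, eisInt, ← integral_add ((isKernel_eisKernel hw).integrable z)
    ((isKernel_eisKernel hu).integrable z)]
  congr 1
  ext p
  simp only [eisKernel]
  ring

theorem eisInt_const_mul (c : ℂ) (w : ℝ → ℂ) (z : ℍ) :
    eisInt (fun t => c * w t) z = c * eisInt w z := by
  rw [eisInt, eisInt, ← integral_const_mul]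
  congr 1
  ext p
  simp only [eisKernel]
  ring

theorem eisInt_congr {w u : ℝ → ℂ} (h : ∀ t, 1 < t → w t = u t) (z : ℍ) :
    eisInt w z = eisInt u z := by
  refine integral_congr_ae ?_
  filter_upwards [ae_lattice_one_lt] with p hp
  simp only [eisKernel, h p.2 hp]

theorem quadForm_formMap_pos (z : ℍ) {v : Fin 2 → ℤ} (hv : v ≠ 0) :
    0 < quadForm (formMap z) v := by
  refine lt_of_lt_of_le ?_ (r_sq_mul_le_quadForm z v)
  have h1 := one_le_norm_of_ne_zero hv
  have h2 := EisensteinSeries.r_pos z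
  have h3 := z.im_pos
  positivity

/-- The Laplacian of an Eisenstein integral, up to the boundary terms at `t = 1`. -/
theorem hasSum_lap_eisInt_sub {w w' w'' : ℝ → ℂ} (hw : IsPolyBdd w) (hw' : IsPolyBdd w')
    (hw'' : IsPolyBdd fun t => (t : ℂ) ^ 2 * w'' t)
    (h1 : ∀ t, 0 < t → HasDerivAt w (w' t) t) (h2 : ∀ t, 0 < t → HasDerivAt w' (w'' t) t)
    (z : ℍ) :
    HasSum (fun v : Fin 2 → ℤ => ((v 0 * conj (z : ℂ) + v 1) / z.im) ^ 2 *
      ((w' 1 - (2 - Real.pi * quadForm (formMap z) v) * w 1) * gauss (formMap z) (v, 1)))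
      (lap 2 (eisInt w) z - eisInt (fun t => (t : ℂ) ^ 2 * w'' t) z) := by
  have hk := isKernel_eisKernel hw
  have s1 := hasSum_integral_lattice (hk.lap.1.integrable z)
  rw [← hk.lap.2] at s1
  have s2 := hasSum_eisInt hw'' z
  refine (s1.sub s2).congr_fun fun v => ?_
  by_cases hv : v = 0
  · subst hv
    have e := integral_congr_ae (μ := volume.restrict (Set.Ioi (1 : ℝ)))
      (Eventually.of_forall fun t => lap_eisKernel hw z (0, t))
    rw [e]
    simp [eisKernel]
  have hx : 0 < Real.pi * quadForm (formMap z) v :=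
    mul_pos Real.pi_pos (quadForm_formMap_pos z hv)
  set x := Real.pi * quadForm (formMap z) v with hxdef
  set R : ℂ := ((v 0 * conj (z : ℂ) + v 1) / z.im) ^ 2 with hR
  -- Dividing by this factor turns integrability of the kernels into the integrability hypotheses
  -- for integration by parts.
  have hR0 : R ≠ 0 := by
    have hy : (z.im : ℂ) ≠ 0 := by exact_mod_cast z.im_pos.ne'
    have h := (quadForm_formMap_pos z hv).ne'
    have h' : (quadForm (formMap z) v : ℂ) ≠ 0 := by exact_mod_cast h
    rw [ofReal_quadForm] at h'
    exact pow_ne_zero 2 (div_ne_zero (left_ne_zero_of_mul (right_ne_zero_of_mul h')) hy)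
  have hg : ∀ t : ℝ, gauss (formMap z) (v, t) = ((Real.exp (-(x * t)) : ℝ) : ℂ) := fun t => by
    rw [gauss, hxdef]; congr 3; ring
  have i1 := integrableOn_of_lattice (hk.lap.1.integrable z) v
  have i2 := integrableOn_of_lattice ((isKernel_eisKernel hw'').integrable z) v
  have e1 : (fun t => lap 2 (fun z => eisKernel w z (v, t)) z) = fun t : ℝ =>
      R * ((x ^ 2 * t ^ 2 - 4 * x * t + 2) * w t * ((Real.exp (-(x * t)) : ℝ) : ℂ)) := by
    ext t
    rw [lap_eisKernel hw, eisKernel, hg, hxdef]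
    push_cast
    ring
  have e2 : (fun t => eisKernel (fun t => (t : ℂ) ^ 2 * w'' t) z (v, t)) = fun t : ℝ =>
      R * (t ^ 2 * w'' t * ((Real.exp (-(x * t)) : ℝ) : ℂ)) := by
    ext t
    rw [eisKernel, hg]
  rw [e1] at i1 ⊢
  rw [e2] at i2 ⊢
  have j1 := i1.const_mul R⁻¹
  have j2 := i2.const_mul R⁻¹
  simp only [inv_mul_cancel_left₀ hR0] at j1 j2
  rw [integral_const_mul, integral_const_mul, integral_exp_mul_by_parts hw hw' h1 h2 hx j1 j2, hg]
  rw [hxdef]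
  push_cast
  simp only [mul_one]
  ring

/-- The row vector v is replaced by vγ: the quadratic form Q is invariant and R acquires one factor
of the denominator. Since vγ permutes ℤ², modularity of the integral follows. -/
theorem eisKernel_smul (w : ℝ → ℂ) (γ : SL(2, ℤ)) (z : ℍ) (v : Fin 2 → ℤ) (t : ℝ) :
    eisKernel w (γ • z) (v, t) = denom γ z ^ 2 * eisKernel w z (Matrix.vecMul v γ.1, t) := by
  have hd : denom γ z ≠ 0 := denom_ne_zero _ _
  have hd' : conj (denom γ z) ≠ 0 := by simp [hd]
  have hy : (z.im : ℂ) ≠ 0 := by exact_mod_cast z.im_pos.ne'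
  have h4 : ((γ • z).im : ℂ) = z.im / (denom γ z * conj (denom γ z)) := by
    rw [Complex.mul_conj, ModularGroup.im_smul_eq_div_normSq]
    push_cast
    rfl
  have h5 : ((γ • z : ℍ) : ℂ) = (γ.1 0 0 * z + γ.1 0 1) / denom γ z := by
    rw [ModularGroup.denom_apply, UpperHalfPlane.specialLinearGroup_apply]
    simp
  have hden : denom γ z = γ.1 1 0 * z + γ.1 1 1 := by
    rw [ModularGroup.denom_apply]
  have v0 : ((Matrix.vecMul v γ.1 0 : ℤ) : ℂ) = v 0 * γ.1 0 0 + v 1 * γ.1 1 0 := by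
    simp [Matrix.vecMul, dotProduct, Fin.sum_univ_two]
  have v1 : ((Matrix.vecMul v γ.1 1 : ℤ) : ℂ) = v 0 * γ.1 0 1 + v 1 * γ.1 1 1 := by
    simp [Matrix.vecMul, dotProduct, Fin.sum_univ_two]
  have hden' : conj (denom γ z) = γ.1 1 0 * conj (z : ℂ) + γ.1 1 1 := by
    rw [hden]; simp
  have l1 : (v 0 : ℂ) * ((γ • z : ℍ) : ℂ) + v 1 =
      ((Matrix.vecMul v γ.1 0 : ℤ) * z + (Matrix.vecMul v γ.1 1 : ℤ)) / denom γ z := by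
    rw [h5, v0, v1, eq_div_iff hd, add_mul, mul_assoc, div_mul_cancel₀ _ hd, hden]
    ring
  have l2 : (v 0 : ℂ) * conj ((γ • z : ℍ) : ℂ) + v 1 =
      ((Matrix.vecMul v γ.1 0 : ℤ) * conj (z : ℂ) + (Matrix.vecMul v γ.1 1 : ℤ)) /
        conj (denom γ z) := by
    have := congrArg (starRingEnd ℂ) l1
    simpa using this
  simp only [eisKernel, gauss_eq]
  rw [l1, l2, h4]
  have e : (((Matrix.vecMul v γ.1 0 : ℤ) : ℂ) * z + (Matrix.vecMul v γ.1 1 : ℤ)) / denom γ z *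
      ((((Matrix.vecMul v γ.1 0 : ℤ) : ℂ) * conj (z : ℂ) + (Matrix.vecMul v γ.1 1 : ℤ)) /
        conj (denom γ z) * ((z.im : ℂ) / (denom γ z * conj (denom γ z)))⁻¹) =
      (((Matrix.vecMul v γ.1 0 : ℤ) : ℂ) * z + (Matrix.vecMul v γ.1 1 : ℤ)) *
      ((((Matrix.vecMul v γ.1 0 : ℤ) : ℂ) * conj (z : ℂ) + (Matrix.vecMul v γ.1 1 : ℤ)) *
        (z.im : ℂ)⁻¹) := by
    field_simp
  rw [e]
  field_simp

/-- Right multiplication by `γ ∈ SL₂(ℤ)` on row vectors. -/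
def vecMulEquiv (γ : SL(2, ℤ)) : (Fin 2 → ℤ) ≃ (Fin 2 → ℤ) where
  toFun v := Matrix.vecMul v (γ : Matrix (Fin 2) (Fin 2) ℤ)
  invFun v := Matrix.vecMul v ((γ⁻¹ : SL(2, ℤ)) : Matrix (Fin 2) (Fin 2) ℤ)
  left_inv v := by
    simp_rw [Matrix.vecMul_vecMul, ← Matrix.SpecialLinearGroup.coe_mul, mul_inv_cancel,
      Matrix.SpecialLinearGroup.coe_one, Matrix.vecMul_one]
  right_inv v := by
    simp_rw [Matrix.vecMul_vecMul, ← Matrix.SpecialLinearGroup.coe_mul, inv_mul_cancel,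
      Matrix.SpecialLinearGroup.coe_one, Matrix.vecMul_one]

theorem isModular_eisInt {w : ℝ → ℂ} (hw : IsPolyBdd w) : IsModular 2 (eisInt w) := by
  refine isModular_of_apply_smul fun γ z => ?_
  have h1 := hasSum_eisInt hw (γ • z)
  simp_rw [eisKernel_smul, integral_const_mul] at h1
  have h2 := ((vecMulEquiv γ).hasSum_iff.mpr (hasSum_eisInt hw z)).mul_left (denom γ z ^ 2)
  rw [zpow_ofNat]
  exact h1.unique h2

/-- Powers of T move any point into 0 ≤ Re z < 1 without changing y or the value of f. -/
theorem moderateGrowth_of_strip {k : ℤ} {f : ℍ → ℂ} (hf : IsModular k f) {C : ℝ} {N : ℕ}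
    (h : ∀ z : ℍ, |z.re| ≤ 1 → 1 ≤ z.im → ‖f z‖ ≤ C * z.im ^ N) : ModerateGrowth f := by
  refine ⟨N, Asymptotics.IsBigO.of_bound C ?_⟩
  have h1 : ∀ᶠ z : ℍ in atImInfty, 1 ≤ z.im :=
    (Filter.tendsto_comap (f := UpperHalfPlane.im)).eventually (Filter.eventually_ge_atTop 1)
  filter_upwards [h1] with z hz
  have e := hf.apply_smul (ModularGroup.T ^ (-⌊z.re⌋)) z
  have hden : denom (ModularGroup.T ^ (-⌊z.re⌋) : SL(2, ℤ)) z = 1 := by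
    rw [ModularGroup.denom_apply, ModularGroup.coe_T_zpow]
    simp
  rw [hden, one_zpow, one_mul, modular_T_zpow_smul] at e
  rw [← e, Real.rpow_natCast, Real.norm_of_nonneg (pow_nonneg z.im_pos.le N)]
  have := h (((-⌊z.re⌋ : ℤ) : ℝ) +ᵥ z) ?_ (by simpa using hz)
  · simpa using this
  · rw [vadd_re, abs_le]
    push_cast
    constructor <;> linarith [Int.floor_le z.re, Int.lt_floor_add_one z.re]

theorem IsWeight.thetaInt_growth {a : (Fin 2 → ℤ) × ℝ → ℂ} (ha : IsWeight a) :
    ∃ (C : ℝ) (N : ℕ), 0 ≤ C ∧ ∀ z : ℍ, |z.re| ≤ 1 → 1 ≤ z.im →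
      ‖thetaInt a (formMap z)‖ ≤ C * z.im ^ N := by
  obtain ⟨B, N, h⟩ := ha.exists_uniform_bound
  -- The value at 1 + i bounds `r` from below on the strip |x| ≤ 1, y ≥ 1, so κ = r₀²/y is
  -- admissible there and the factor κ^{-N} becomes y^N.
  set r₀ := EisensteinSeries.r ⟨⟨1, 1⟩, one_pos⟩ with hr₀
  have hr₀p : 0 < r₀ := EisensteinSeries.r_pos _
  set J := ∫ p : (Fin 2 → ℤ) × ℝ, ‖p.1‖ ^ (-4 : ℝ) * p.2 ^ (-4 : ℝ) ∂latticeMeasure with hJ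
  refine ⟨|B| / (r₀ ^ 2) ^ N * |J|, N, by positivity, fun z hx hy => ?_⟩
  have hr : r₀ ≤ EisensteinSeries.r z :=
    EisensteinSeries.r_lower_bound_on_verticalStrip z one_pos ⟨hx, hy⟩
  have hy0 := z.im_pos
  have hκ : 0 < r₀ ^ 2 / z.im := by positivity
  have hq : ∀ v : Fin 2 → ℤ, r₀ ^ 2 / z.im * ‖v‖ ^ 2 ≤ quadForm (formMap z) v := fun v => by
    refine le_trans ?_ (r_sq_mul_le_quadForm z v)
    gcongr
  have hb := norm_integral_le_of_norm_le (f := fun p => a p * gauss (formMap z) p)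
    (integrable_lattice_rpow.const_mul (B / (r₀ ^ 2 / z.im) ^ N)) (by
      filter_upwards [ae_lattice_one_lt] with p hp
      rw [norm_mul]
      exact (mul_le_mul_of_nonneg_left (norm_gauss_le hq hp) (norm_nonneg _)).trans
        (h _ hκ p.1 p.2 hp))
  rw [integral_const_mul] at hb
  refine hb.trans ((le_abs_self _).trans (le_of_eq ?_))
  rw [abs_mul, abs_div, abs_of_pos (pow_pos hκ N), div_pow, ← hJ]
  field_simp

/-- Expanding (c z̄ + d)² gives three theta integrals whose coefficients are bounded on the strip,
where |z| ≤ 2y. -/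
theorem moderateGrowth_eisInt {w : ℝ → ℂ} (hw : IsPolyBdd w) : ModerateGrowth (eisInt w) := by
  obtain ⟨C1, N1, c1, h1⟩ := (hw.isWeight 0 0).thetaInt_growth
  obtain ⟨C2, N2, c2, h2⟩ := (hw.isWeight 0 1).thetaInt_growth
  obtain ⟨C3, N3, c3, h3⟩ := (hw.isWeight 1 1).thetaInt_growth
  refine moderateGrowth_of_strip (isModular_eisInt hw) (C := 4 * C1 + 4 * C2 + C3)
    (N := N1 + N2 + N3) fun z hx hy => ?_
  have hy0 := z.im_pos
  have hyc : (z.im : ℂ) ≠ 0 := by exact_mod_cast hy0.ne'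
  have e : eisInt w z = (conj (z : ℂ) / z.im) ^ 2 *
      thetaInt (fun p => (p.1 0 : ℂ) * ((p.1 0 : ℂ) * w p.2)) (formMap z) +
      (2 * (conj (z : ℂ) / z.im ^ 2) *
        thetaInt (fun p => (p.1 0 : ℂ) * ((p.1 1 : ℂ) * w p.2)) (formMap z) +
      (1 / (z.im : ℂ)) ^ 2 *
        thetaInt (fun p => (p.1 1 : ℂ) * ((p.1 1 : ℂ) * w p.2)) (formMap z)) := by
    simp only [thetaInt, eisInt]
    have i1 := ((hw.isWeight 0 0).integrable (formMap_mem z)).const_mul ((conj (z : ℂ) / z.im) ^ 2)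
    have i2 := ((hw.isWeight 0 1).integrable (formMap_mem z)).const_mul
      (2 * (conj (z : ℂ) / z.im ^ 2))
    have i3 := ((hw.isWeight 1 1).integrable (formMap_mem z)).const_mul ((1 / (z.im : ℂ)) ^ 2)
    have e1 := integral_add i1 (i2.add i3)
    have e2 := integral_add i2 i3
    simp only [Pi.add_apply] at e1
    rw [e2] at e1
    rw [← integral_const_mul, ← integral_const_mul, ← integral_const_mul, ← e1]
    congr 1
    ext p
    simp only [eisKernel]
    field_simp
    ring
  have hz : ‖(z : ℂ)‖ ≤ 2 * z.im := by
    have := Complex.norm_le_abs_re_add_abs_im (z : ℂ)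
    rw [coe_re, coe_im, abs_of_pos hy0] at this
    linarith
  have n1 : ‖(conj (z : ℂ) / z.im) ^ 2‖ ≤ 4 := by
    rw [norm_pow, norm_div, Complex.norm_real, Complex.norm_conj, Real.norm_of_nonneg hy0.le]
    calc _ ≤ (2 * z.im / z.im) ^ 2 := by gcongr
      _ = 4 := by field_simp; norm_num
  have n2 : ‖2 * (conj (z : ℂ) / z.im ^ 2)‖ ≤ 4 := by
    rw [norm_mul, norm_div, norm_pow, Complex.norm_real, Complex.norm_conj,
      Real.norm_of_nonneg hy0.le, Complex.norm_two]
    calc _ ≤ 2 * (2 * z.im / z.im ^ 2) := by gcongr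
      _ = 4 / z.im := by field_simp; norm_num
      _ ≤ 4 := div_le_self (by norm_num) hy
  have n3 : ‖(1 / (z.im : ℂ)) ^ 2‖ ≤ 1 := by
    rw [norm_pow, norm_div, Complex.norm_real, Real.norm_of_nonneg hy0.le, norm_one]
    exact pow_le_one₀ (by positivity) (by rw [div_le_one hy0]; exact hy)
  have p1 : z.im ^ N1 ≤ z.im ^ (N1 + N2 + N3) := pow_le_pow_right₀ hy (by omega)
  have p2 : z.im ^ N2 ≤ z.im ^ (N1 + N2 + N3) := pow_le_pow_right₀ hy (by omega)
  have p3 : z.im ^ N3 ≤ z.im ^ (N1 + N2 + N3) := pow_le_pow_right₀ hy (by omega)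
  rw [e]
  refine (norm_add_le _ _).trans ((add_le_add le_rfl (norm_add_le _ _)).trans ?_)
  rw [norm_mul (_ ^ 2), norm_mul (2 * _), norm_mul (_ ^ 2)]
  have q1 := mul_le_mul n1 ((h1 z hx hy).trans (mul_le_mul_of_nonneg_left p1 c1))
    (norm_nonneg _) (by norm_num)
  have q2 := mul_le_mul n2 ((h2 z hx hy).trans (mul_le_mul_of_nonneg_left p2 c2))
    (norm_nonneg _) (by norm_num)
  have q3 := mul_le_mul n3 ((h3 z hx hy).trans (mul_le_mul_of_nonneg_left p3 c3))
    (norm_nonneg _) (by norm_num)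
  refine (add_le_add q1 (add_le_add q2 q3)).trans (le_of_eq ?_)
  ring

theorem isModerateForm_eisInt {w : ℝ → ℂ} (hw : IsPolyBdd w) : IsModerateForm 2 (eisInt w) :=
  ⟨isSmooth_eisInt hw, isModular_eisInt hw, moderateGrowth_eisInt hw⟩

/-! ### Logarithmic weights -/

/-- The weight function `(t + (-1)ⁿ) (log t)ⁿ`. -/
def logWeight (n : ℕ) (t : ℝ) : ℂ := (t + (-1) ^ n) * (Real.log t : ℂ) ^ n

theorem isPolyBdd_logWeight (n : ℕ) : IsPolyBdd (logWeight n) :=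
  (IsPolyBdd.id.add (.const _)).mul (IsPolyBdd.log.pow n)

/-- The derivative of `logWeight n`. -/
def logWeightDeriv (n : ℕ) (t : ℝ) : ℂ :=
  (Real.log t : ℂ) ^ n + n * ((1 + (-1) ^ n * (t : ℂ)⁻¹) * (Real.log t : ℂ) ^ (n - 1))

theorem isPolyBdd_logWeightDeriv (n : ℕ) : IsPolyBdd (logWeightDeriv n) :=
  (IsPolyBdd.log.pow n).add ((IsPolyBdd.const n).mul
    (((IsPolyBdd.const 1).add ((IsPolyBdd.const _).mul .inv)).mul (IsPolyBdd.log.pow (n - 1))))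

theorem hasDerivAt_ofReal_log {t : ℝ} (ht : 0 < t) :
    HasDerivAt (fun t : ℝ => (Real.log t : ℂ)) (t : ℂ)⁻¹ t := by
  have := (Real.hasDerivAt_log ht.ne').ofReal_comp
  rwa [Complex.ofReal_inv] at this

theorem hasDerivAt_logWeight (n : ℕ) {t : ℝ} (ht : 0 < t) :
    HasDerivAt (logWeight n) (logWeightDeriv n t) t := by
  have ht1 : HasDerivAt (fun t : ℝ => (t : ℂ)) 1 t := Complex.ofRealCLM.hasDerivAt
  have h := (ht1.add_const ((-1 : ℂ) ^ n)).mul ((hasDerivAt_ofReal_log ht).pow n)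
  refine h.congr_deriv ?_
  have ht0 : (t : ℂ) ≠ 0 := by exact_mod_cast ht.ne'
  simp only [logWeightDeriv, Pi.pow_apply]
  field_simp

/-- `logWeight n` is the n-th s-derivative at s = 0 of t^{s+1} + t^{-s}, on which t² d²/dt² acts by
s² + s; Leibniz then leaves only the two terms shown. The truncated indices for n = 0, 1 carry
coefficient zero. -/
theorem hasDerivAt_logWeightDeriv (n : ℕ) {t : ℝ} (ht : 0 < t) :
    HasDerivAt (logWeightDeriv n) (((t : ℂ) ^ 2)⁻¹ *
      (n * logWeight (n - 1) t + n * (n - 1) * logWeight (n - 2) t)) t := by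
  have ht0 : (t : ℂ) ≠ 0 := by exact_mod_cast ht.ne'
  have ht1 : HasDerivAt (fun t : ℝ => (t : ℂ)) 1 t := Complex.ofRealCLM.hasDerivAt
  have hl := hasDerivAt_ofReal_log ht
  have h := (hl.pow n).add ((((ht1.inv ht0).const_mul ((-1 : ℂ) ^ n)).const_add 1
    |>.mul (hl.pow (n - 1))).const_mul (n : ℂ))
  refine h.congr_deriv ?_
  rcases n with _ | _ | n
  · simp
  · simp [logWeight]
    field_simp
  · simp only [logWeight, Pi.pow_apply, Pi.inv_apply, Nat.add_sub_cancel,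
      show n + 1 + 1 - 2 = n by omega, show n + 1 + 1 - 1 = n + 1 by omega]
    push_cast
    field_simp
    ring

end

end PolyMaass

/-! ### The theta functional equation and the vanishing of the boundary terms -/

namespace PolyMaass

noncomputable section

open UpperHalfPlane Filter Topology MeasureTheory
open scoped MatrixGroups ContDiff Manifold ModularForm ComplexConjugate FourierTransform

/-! ### Fourier transforms of quadratic polynomials times Gaussians -/

theorem fourier_add_apply {f g : ℝ → ℂ} (hf : Integrable f) (hg : Integrable g) (w : ℝ) :
    𝓕 (fun x => f x + g x) w = 𝓕 f w + 𝓕 g w := by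
  simp only [Real.fourier_eq, smul_add]
  exact integral_add ((Real.fourierIntegral_convergent_iff w).mpr hf)
    ((Real.fourierIntegral_convergent_iff w).mpr hg)

theorem fourier_const_mul_apply (c : ℂ) (f : ℝ → ℂ) (w : ℝ) :
    𝓕 (fun x => c * f x) w = c * 𝓕 f w := by
  simp only [Real.fourier_eq]
  rw [← integral_const_mul]
  congr 1
  ext x
  simp only [Circle.smul_def, smul_eq_mul]
  ring

theorem integrable_pow_mul_gaussian {a : ℝ} (ha : 0 < a) (n : ℕ) :
    Integrable fun x : ℝ => (x : ℂ) ^ n * Complex.exp (-Real.pi * a * x ^ 2) := by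
  have h := integrable_rpow_mul_exp_neg_mul_sq (mul_pos Real.pi_pos ha) (s := n)
    (by linarith [Nat.cast_nonneg (α := ℝ) n])
  refine (h.ofReal (𝕜 := ℂ)).congr (Eventually.of_forall fun x => ?_)
  simp

/-- Multiplication by -2πix corresponds to differentiating the Fourier transform, so the quadratic
factor is handled by differentiating the transformed Gaussian twice. -/
theorem fourier_quadratic_mul_gaussian {a : ℝ} (ha : 0 < a) (b w : ℝ) :
    𝓕 (fun x : ℝ => ((x : ℂ) - Complex.I * b) ^ 2 * Complex.exp (-Real.pi * a * x ^ 2)) w =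
      (1 / (2 * Real.pi * a) - (w / a + b) ^ 2) *
        ((((√a)⁻¹ : ℝ) : ℂ) * Complex.exp (-Real.pi / a * w ^ 2)) := by
  have hpi : (Real.pi : ℂ) ≠ 0 := by exact_mod_cast Real.pi_ne_zero
  have hac : (a : ℂ) ≠ 0 := by exact_mod_cast ha.ne'
  set g : ℝ → ℂ := fun x => Complex.exp (-Real.pi * a * x ^ 2) with hg
  set g1 : ℝ → ℂ := fun x => (-2 * Real.pi * Complex.I * x) • g x with hg1
  set g2 : ℝ → ℂ := fun x => (-2 * Real.pi * Complex.I * x) • g1 x with hg2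
  set K : ℂ := (((√a)⁻¹ : ℝ) : ℂ) with hK
  have i0 : Integrable g := by
    simpa only [pow_zero, one_mul] using integrable_pow_mul_gaussian ha 0
  have i1 : Integrable g1 := by
    refine ((integrable_pow_mul_gaussian ha 1).const_mul (-2 * Real.pi * Complex.I)).congr
      (Eventually.of_forall fun x => ?_)
    simp only [hg1, hg, smul_eq_mul]
    ring
  have i2 : Integrable g2 := by
    refine ((integrable_pow_mul_gaussian ha 2).const_mul ((-2 * Real.pi * Complex.I) ^ 2)).congr
      (Eventually.of_forall fun x => ?_)
    simp only [hg2, hg1, hg, smul_eq_mul]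
    ring
  have j0 : Integrable fun x : ℝ => x • g x := by
    refine (integrable_pow_mul_gaussian ha 1).congr (Eventually.of_forall fun x => ?_)
    simp [hg]
  have j1 : Integrable fun x : ℝ => x • g1 x := by
    refine ((integrable_pow_mul_gaussian ha 2).const_mul (-2 * Real.pi * Complex.I)).congr
      (Eventually.of_forall fun x => ?_)
    simp only [hg1, hg, smul_eq_mul, Complex.real_smul]
    ring
  have F0 : 𝓕 g = fun w : ℝ => K * Complex.exp (-Real.pi / a * w ^ 2) := by
    have h := fourier_gaussian_pi (b := (a : ℂ)) (by simpa using ha)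
    have hs : 1 / (a : ℂ) ^ (1 / 2 : ℂ) = K := by
      rw [hK, Real.sqrt_eq_rpow, Complex.ofReal_inv, Complex.ofReal_cpow ha.le, one_div]
      norm_num
    rw [hs] at h
    exact h
  have dE : ∀ w : ℝ, HasDerivAt (fun w : ℝ => K * Complex.exp (-Real.pi / a * w ^ 2))
      (K * (Complex.exp (-Real.pi / a * w ^ 2) * (-2 * Real.pi / a * w))) w := fun w => by
    have ht1 : HasDerivAt (fun t : ℝ => (t : ℂ)) 1 w := Complex.ofRealCLM.hasDerivAt
    have := (((ht1.pow 2).const_mul (-Real.pi / a : ℂ)).cexp).const_mul K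
    refine this.congr_deriv ?_
    simp only [Pi.pow_apply]
    push_cast
    ring
  have F1 : 𝓕 g1 = fun w : ℝ =>
      K * (Complex.exp (-Real.pi / a * w ^ 2) * (-2 * Real.pi / a * w)) := by
    ext w
    have h := Real.hasDerivAt_fourier i0 j0 w
    rw [F0] at h
    exact h.unique (dE w)
  have F2 : 𝓕 g2 w = K * (Complex.exp (-Real.pi / a * w ^ 2) *
      ((2 * Real.pi / a * w) ^ 2 - 2 * Real.pi / a)) := by
    have h := Real.hasDerivAt_fourier i1 j1 w
    rw [F1] at h
    have ht1 : HasDerivAt (fun t : ℝ => (t : ℂ)) 1 w := Complex.ofRealCLM.hasDerivAt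
    have h' := (dE w).mul (ht1.const_mul (-2 * Real.pi / a : ℂ))
    have h'' := h.unique (h'.congr_of_eventuallyEq (Eventually.of_forall fun w => ?_))
    · rw [h'']
      ring
    · simp only [Pi.mul_apply]
      ring
  -- Here (x - ib)² is written in powers of -2πix, the multiplier in the derivative formula.
  have e : (fun x : ℝ => ((x : ℂ) - Complex.I * b) ^ 2 * Complex.exp (-Real.pi * a * x ^ 2)) =
      fun x => (-(1 / (4 * Real.pi ^ 2)) * g2 x) + ((b / Real.pi) * g1 x + (-b ^ 2) * g x) := by
    ext x
    simp only [hg2, hg1, hg, smul_eq_mul]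
    field_simp
    ring_nf
    rw [Complex.I_sq]
    ring
  have i10 : Integrable fun x => (b / Real.pi : ℂ) * g1 x + (-b ^ 2 : ℂ) * g x :=
    (i1.const_mul _).add (i0.const_mul _)
  rw [e, fourier_add_apply (i2.const_mul _) i10, fourier_add_apply (i1.const_mul _) (i0.const_mul _), fourier_const_mul_apply,
    fourier_const_mul_apply, fourier_const_mul_apply, F2, F1, F0]
  field_simp
  ring

theorem quadratic_mul_gaussian_isBigO {a : ℝ} (ha : 0 < a) (b : ℝ) :
    (fun x : ℝ => ((x : ℂ) - Complex.I * b) ^ 2 * Complex.exp (-Real.pi * a * x ^ 2))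
      =O[cocompact ℝ] fun x : ℝ => |x| ^ (-2 : ℝ) := by
  have h1 := (cexp_neg_quadratic_isLittleO_abs_rpow_cocompact (a := (-Real.pi * a : ℂ))
    (by simpa using mul_pos Real.pi_pos ha) 0 (-4)).isBigO
  have h2 : (fun x : ℝ => ((x : ℂ) - Complex.I * b) ^ 2) =O[cocompact ℝ]
      fun x : ℝ => |x| ^ (2 : ℝ) := by
    refine Asymptotics.IsBigO.of_bound ((1 + |b|) ^ 2) ?_
    have h3 : ∀ᶠ x : ℝ in cocompact ℝ, 1 ≤ ‖x‖ :=
      (tendsto_norm_cocompact_atTop (E := ℝ)).eventually (eventually_ge_atTop 1)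
    filter_upwards [h3] with x hx
    rw [Real.norm_eq_abs] at hx
    rw [Real.rpow_two, norm_pow, norm_pow, norm_abs_eq_norm, Real.norm_eq_abs, ← mul_pow]
    gcongr
    refine (norm_sub_le _ _).trans ?_
    simp only [Complex.norm_real, norm_mul, Complex.norm_I, one_mul, Real.norm_eq_abs]
    nlinarith [abs_nonneg b]
  refine (h2.mul h1).congr' (Eventually.of_forall fun x => by simp) ?_
  have h3 : ∀ᶠ x : ℝ in cocompact ℝ, 1 ≤ ‖x‖ :=
    (tendsto_norm_cocompact_atTop (E := ℝ)).eventually (eventually_ge_atTop 1)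
  filter_upwards [h3] with x hx
  rw [Real.norm_eq_abs] at hx
  rw [← Real.rpow_add (by linarith)]
  norm_num

/-! ### The weight two theta series -/

theorem summable_lattice_gaussian {κ : ℝ} (hκ : 0 < κ) (N : ℕ) :
    Summable fun v : Fin 2 → ℤ => (1 + ‖v‖) ^ N * Real.exp (-(κ * ‖v‖ ^ 2)) := by
  have hs := (EisensteinSeries.summable_one_div_norm_rpow (k := 4) (by norm_num)).mul_left
    (2 ^ N * ((N + 4).factorial / κ ^ (N + 4)))
  refine Summable.of_norm_bounded_eventually hs ?_
  filter_upwards [(Set.finite_singleton (0 : Fin 2 → ℤ)).compl_mem_cofinite] with v hv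
  have hv1 := one_le_norm_of_ne_zero hv
  rw [Real.norm_of_nonneg (by positivity), Real.rpow_neg (norm_nonneg _),
    show (4 : ℝ) = ((4 : ℕ) : ℝ) by norm_num, Real.rpow_natCast, ← div_eq_mul_inv,
    le_div_iff₀ (by positivity)]
  have h2 := pow_mul_exp_neg_le hκ (norm_nonneg v) (N + 4)
  have h1 : Real.exp (-(κ * ‖v‖ ^ 2)) ≤ Real.exp (-(κ * ‖v‖)) := by
    rw [Real.exp_le_exp, neg_le_neg_iff]
    have : ‖v‖ ≤ ‖v‖ ^ 2 := by nlinarith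
    gcongr
  calc (1 + ‖v‖) ^ N * Real.exp (-(κ * ‖v‖ ^ 2)) * ‖v‖ ^ 4
      ≤ (2 * ‖v‖) ^ N * Real.exp (-(κ * ‖v‖)) * ‖v‖ ^ 4 := by gcongr; linarith
    _ = 2 ^ N * (‖v‖ ^ (N + 4) * Real.exp (-(κ * ‖v‖))) := by ring
    _ ≤ _ := by gcongr

/-- The terms `((c z̄ + d)/y)² e^{-π t |c z + d|² / y}` of the weight two theta series. -/
def thetaTerm (z : ℍ) (t : ℝ) (v : Fin 2 → ℤ) : ℂ :=
  ((v 0 * conj (z : ℂ) + v 1) / z.im) ^ 2 * gauss (formMap z) (v, t)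

theorem norm_linear_div_le (z : ℍ) (v : Fin 2 → ℤ) :
    ‖(v 0 * conj (z : ℂ) + v 1) / z.im‖ ≤ (‖(z : ℂ)‖ + 1) / z.im * ‖v‖ := by
  rw [norm_div, Complex.norm_real, Real.norm_of_nonneg z.im_pos.le, div_mul_eq_mul_div]
  have := z.im_pos
  gcongr
  refine (norm_add_le _ _).trans ?_
  rw [norm_mul, Complex.norm_conj, Complex.norm_intCast, Complex.norm_intCast]
  nlinarith [abs_coord_le v 0, abs_coord_le v 1, norm_nonneg (z : ℂ)]

/-- The exponential rate of decay of the theta terms. -/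
def thetaRate (z : ℍ) : ℝ := EisensteinSeries.r z ^ 2 / z.im

theorem thetaRate_pos (z : ℍ) : 0 < thetaRate z :=
  div_pos (pow_pos (EisensteinSeries.r_pos z) 2) z.im_pos

theorem norm_thetaTerm_le (z : ℍ) {t₀ t : ℝ} (h0 : 0 ≤ t₀) (ht : t₀ ≤ t) (v : Fin 2 → ℤ) :
    ‖thetaTerm z t v‖ ≤ ((‖(z : ℂ)‖ + 1) / z.im) ^ 2 * ((1 + ‖v‖) ^ 2 *
      Real.exp (-(Real.pi * t₀ * thetaRate z * ‖v‖ ^ 2))) := by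
  have hy := z.im_pos
  rw [thetaTerm, norm_mul, norm_pow, norm_gauss, ← mul_assoc]
  have h1 := norm_linear_div_le z v
  have h2 := r_sq_mul_le_quadForm z v
  have h3 : 0 ≤ thetaRate z * ‖v‖ ^ 2 := mul_nonneg (thetaRate_pos z).le (by positivity)
  have h4 : Real.pi * t₀ * thetaRate z * ‖v‖ ^ 2 ≤ Real.pi * t * quadForm (formMap z) v := by
    rw [mul_assoc]
    have := Real.pi_pos
    exact mul_le_mul (by gcongr) h2 h3 (by have := h0.trans ht; positivity)
  refine mul_le_mul ?_ (Real.exp_le_exp.mpr (neg_le_neg h4)) (Real.exp_pos _).le (by positivity)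
  rw [← mul_pow]
  refine pow_le_pow_left₀ (norm_nonneg _) (h1.trans ?_) 2
  have : 0 ≤ (‖(z : ℂ)‖ + 1) / z.im := by positivity
  nlinarith

theorem quadForm_formMap_le (z : ℍ) (v : Fin 2 → ℤ) :
    quadForm (formMap z) v ≤ (‖(z : ℂ)‖ + 1) ^ 2 / z.im * (1 + ‖v‖) ^ 2 := by
  rw [quadForm_formMap, Complex.normSq_eq_norm_sq, div_mul_eq_mul_div, ← mul_pow]
  have := z.im_pos
  gcongr
  refine (norm_add_le _ _).trans ?_
  rw [norm_mul, Complex.norm_intCast, Complex.norm_intCast]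
  nlinarith [abs_coord_le v 0, abs_coord_le v 1, norm_nonneg (z : ℂ)]

theorem summable_thetaTerm (z : ℍ) {t : ℝ} (ht : 0 < t) : Summable (thetaTerm z t) := by
  have hs := (summable_lattice_gaussian (mul_pos (mul_pos Real.pi_pos ht) (thetaRate_pos z)) 2)
    |>.mul_left (((‖(z : ℂ)‖ + 1) / z.im) ^ 2)
  exact Summable.of_norm_bounded hs (norm_thetaTerm_le z ht.le le_rfl)

/-- The weight two theta series `∑ ((c z̄ + d)/y)² e^{-π t |c z + d|² / y}`. -/
def theta (z : ℍ) (t : ℝ) : ℂ := ∑' v, thetaTerm z t v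

theorem hasDerivAt_theta (z : ℍ) {t : ℝ} (ht : 0 < t) :
    Summable (fun v => -(Real.pi * quadForm (formMap z) v) * thetaTerm z t v) ∧
    HasDerivAt (theta z) (∑' v, -(Real.pi * quadForm (formMap z) v) * thetaTerm z t v) t := by
  have hpos := mul_pos (mul_pos Real.pi_pos (half_pos ht)) (thetaRate_pos z)
  have hs := (summable_lattice_gaussian hpos 4).mul_left
    (Real.pi * ((‖(z : ℂ)‖ + 1) ^ 2 / z.im) * ((‖(z : ℂ)‖ + 1) / z.im) ^ 2)
  have hy := z.im_pos
  have hb : ∀ v, ∀ s ∈ Set.Ioi (t / 2),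
      ‖-(Real.pi * quadForm (formMap z) v) * thetaTerm z s v‖ ≤
      Real.pi * ((‖(z : ℂ)‖ + 1) ^ 2 / z.im) * ((‖(z : ℂ)‖ + 1) / z.im) ^ 2 * ((1 + ‖v‖) ^ 4 *
        Real.exp (-(Real.pi * (t / 2) * thetaRate z * ‖v‖ ^ 2))) := by
    intro v s hs
    have h1 := norm_thetaTerm_le z (half_pos ht).le (le_of_lt hs) v
    have h2 := quadForm_formMap_le z v
    have h3 : 0 ≤ quadForm (formMap z) v := by
      rw [quadForm_formMap]; exact div_nonneg (Complex.normSq_nonneg _) hy.le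
    rw [norm_mul, norm_neg, norm_mul, Complex.norm_real, Complex.norm_real,
      Real.norm_of_nonneg Real.pi_pos.le, Real.norm_of_nonneg h3]
    have := Real.pi_pos
    calc _ ≤ Real.pi * ((‖(z : ℂ)‖ + 1) ^ 2 / z.im * (1 + ‖v‖) ^ 2) *
          (((‖(z : ℂ)‖ + 1) / z.im) ^ 2 * ((1 + ‖v‖) ^ 2 *
      Real.exp (-(Real.pi * (t / 2) * thetaRate z * ‖v‖ ^ 2)))) := by gcongr
      _ = _ := by ring
  have hd : ∀ (v : Fin 2 → ℤ), ∀ s ∈ Set.Ioi (t / 2), HasDerivAt (fun s => thetaTerm z s v)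
      (-(Real.pi * quadForm (formMap z) v) * thetaTerm z s v) s := by
    intro v s _
    have he : HasDerivAt (fun s : ℝ => gauss (formMap z) (v, s))
        ((Real.exp (-(Real.pi * s * quadForm (formMap z) v)) *
          (-(Real.pi * 1 * quadForm (formMap z) v)) : ℝ) : ℂ) s :=
      (((hasDerivAt_id s).const_mul Real.pi).mul_const
        (quadForm (formMap z) v)).neg.exp.ofReal_comp
    refine (he.const_mul _).congr_deriv ?_
    simp only [thetaTerm, gauss]
    push_cast
    ring
  have hmem : t ∈ Set.Ioi (t / 2) := half_lt_self ht
  exact ⟨Summable.of_norm_bounded hs fun v => hb v t hmem,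
    hasDerivAt_tsum_of_isPreconnected hs isOpen_Ioi (convex_Ioi _).isPreconnected hd hb hmem
      (summable_thetaTerm z ht) hmem⟩

/-- The partial Fourier transform in the second variable of `y²` times the theta terms. -/
def thetaDual (z : ℍ) (t : ℝ) (v : Fin 2 → ℤ) : ℂ :=
  (((√(t / z.im))⁻¹ : ℝ) : ℂ) * Complex.exp (2 * Real.pi * Complex.I * (v 0 * v 1 * z.re)) *
    ((Real.exp (-(Real.pi * z.im * (t * v 0 ^ 2 + v 1 ^ 2 / t))) : ℝ) : ℂ) *
    ((z.im / (2 * Real.pi * t) - z.im ^ 2 * (v 1 / t + v 0) ^ 2 : ℝ) : ℂ)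

theorem norm_sq_le_add_sq (v : Fin 2 → ℤ) : ‖v‖ ^ 2 ≤ (v 0 : ℝ) ^ 2 + (v 1 : ℝ) ^ 2 := by
  have h : ‖v‖ ≤ √((v 0 : ℝ) ^ 2 + (v 1 : ℝ) ^ 2) := by
    refine (pi_norm_le_iff_of_nonneg (Real.sqrt_nonneg _)).mpr fun i => ?_
    rw [Int.norm_eq_abs]
    refine Real.abs_le_sqrt ?_
    fin_cases i
    · simpa using sq_nonneg _
    · simpa using sq_nonneg _
  calc ‖v‖ ^ 2 ≤ √((v 0 : ℝ) ^ 2 + (v 1 : ℝ) ^ 2) ^ 2 := by gcongr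
    _ = _ := Real.sq_sqrt (by positivity)

theorem summable_thetaDual (z : ℍ) {t : ℝ} (ht : 0 < t) : Summable (thetaDual z t) := by
  have hy := z.im_pos
  have hpi := Real.pi_pos
  have hm : 0 < min t (1 / t) := lt_min ht (by positivity)
  have hs := (summable_lattice_gaussian (mul_pos (mul_pos hpi hy) hm) 2).mul_left
    ((√(t / z.im))⁻¹ * (z.im / (2 * Real.pi * t) + z.im ^ 2 * (1 / t + 1) ^ 2))
  refine Summable.of_norm_bounded hs fun v => ?_
  have hph : ‖Complex.exp (2 * Real.pi * Complex.I * (v 0 * v 1 * z.re))‖ = 1 := by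
    have := Complex.norm_exp_ofReal_mul_I (2 * Real.pi * (v 0 * v 1 * z.re))
    rw [← this]
    congr 2
    push_cast
    ring
  rw [thetaDual, norm_mul, norm_mul, norm_mul, hph, mul_one, Complex.norm_real, Complex.norm_real,
    Complex.norm_real, Real.norm_of_nonneg (by positivity), Real.norm_of_nonneg (Real.exp_pos _).le]
  have e1 : Real.exp (-(Real.pi * z.im * (t * v 0 ^ 2 + v 1 ^ 2 / t))) ≤
      Real.exp (-(Real.pi * z.im * min t (1 / t) * ‖v‖ ^ 2)) := by
    rw [Real.exp_le_exp, neg_le_neg_iff, mul_assoc]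
    refine mul_le_mul_of_nonneg_left ?_ (by positivity)
    have a1 : min t (1 / t) * (v 0 : ℝ) ^ 2 ≤ t * v 0 ^ 2 := by gcongr; exact min_le_left _ _
    have a2 : min t (1 / t) * (v 1 : ℝ) ^ 2 ≤ 1 / t * v 1 ^ 2 := by gcongr; exact min_le_right _ _
    have a3 := mul_le_mul_of_nonneg_left (norm_sq_le_add_sq v) hm.le
    rw [one_div_mul_eq_div] at a2
    linarith
  have e2 : ‖z.im / (2 * Real.pi * t) - z.im ^ 2 * ((v 1 : ℝ) / t + v 0) ^ 2‖ ≤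
      (z.im / (2 * Real.pi * t) + z.im ^ 2 * (1 / t + 1) ^ 2) * (1 + ‖v‖) ^ 2 := by
    have b1 : |(v 1 : ℝ) / t + v 0| ≤ (1 / t + 1) * (1 + ‖v‖) := by
      refine (abs_add_le _ _).trans ?_
      rw [abs_div, abs_of_pos ht]
      have c1 : |(v 1 : ℝ)| / t ≤ 1 / t * (1 + ‖v‖) := by
        rw [one_div_mul_eq_div]
        gcongr
        linarith [abs_coord_le v 1]
      linarith [abs_coord_le v 0]
    have b2 : ((v 1 : ℝ) / t + v 0) ^ 2 ≤ ((1 / t + 1) * (1 + ‖v‖)) ^ 2 := by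
      rw [← sq_abs]
      gcongr
    have b3 : (1 : ℝ) ≤ (1 + ‖v‖) ^ 2 := one_le_pow₀ (by linarith [norm_nonneg v])
    have b4 : 0 ≤ z.im / (2 * Real.pi * t) := by positivity
    refine (norm_sub_le _ _).trans ?_
    rw [Real.norm_of_nonneg b4, Real.norm_of_nonneg (by positivity), add_mul]
    refine add_le_add (le_mul_of_one_le_right b4 b3) ?_
    rw [mul_assoc, ← mul_pow (1 / t + 1)]
    exact mul_le_mul_of_nonneg_left b2 (by positivity)
  calc _ ≤ (√(t / z.im))⁻¹ * Real.exp (-(Real.pi * z.im * min t (1 / t) * ‖v‖ ^ 2)) *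
      ((z.im / (2 * Real.pi * t) + z.im ^ 2 * (1 / t + 1) ^ 2) * (1 + ‖v‖) ^ 2) := by gcongr
    _ = _ := by ring

/-- Poisson summation in d for fixed c. Since c z̄ + d = (c Re z + d) - i c y, a row samples a
shifted quadratic times a Gaussian at Re(z)c + d, and the shift becomes the phase e^{2πi c m Re z}.
-/
theorem tsum_thetaTerm_row (z : ℍ) {t : ℝ} (ht : 0 < t) (c : ℤ) :
    (z.im : ℂ) ^ 2 * ∑' d : ℤ, thetaTerm z t ![c, d] = ∑' m : ℤ, thetaDual z t ![c, m] := by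
  have hy := z.im_pos
  have hyc : (z.im : ℂ) ≠ 0 := by exact_mod_cast hy.ne'
  have htc : (t : ℂ) ≠ 0 := by exact_mod_cast ht.ne'
  have hpi : (Real.pi : ℂ) ≠ 0 := by exact_mod_cast Real.pi_ne_zero
  have ha : 0 < t / z.im := by positivity
  set h : ℝ → ℂ := fun x => ((x : ℂ) - Complex.I * ((c * z.im : ℝ) : ℂ)) ^ 2 *
    Complex.exp (-Real.pi * ((t / z.im : ℝ) : ℂ) * x ^ 2) with hh
  set E : ℂ := ((Real.exp (-(Real.pi * z.im * (t * c ^ 2))) : ℝ) : ℂ) with hE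
  have hE0 : E ≠ 0 := by rw [hE]; exact_mod_cast (Real.exp_pos _).ne'
  have dual : ∀ m : ℤ, thetaDual z t ![c, m] = E * (𝓕 h m * fourier m
      ((c * z.re : ℝ) : UnitAddCircle)) := fun m => by
    rw [hh, fourier_quadratic_mul_gaussian ha, fourier_coe_apply, thetaDual, hE]
    simp only [Matrix.cons_val_zero, Matrix.cons_val_one, mul_add, neg_add, Real.exp_add]
    push_cast
    have e1 : (-(Real.pi * z.im * ((m : ℂ) ^ 2 / t))) = -Real.pi / (t / z.im) * (m : ℂ) ^ 2 := by
      field_simp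
    rw [e1]
    have e2 : (2 * Real.pi * Complex.I * (c * m * z.re) : ℂ) =
        2 * Real.pi * Complex.I * m * (c * z.re) / 1 := by ring
    rw [e2]
    field_simp
  have prim : ∀ d : ℤ, (z.im : ℂ) ^ 2 * thetaTerm z t ![c, d] = E * h (c * z.re + d) := fun d => by
    have hz : conj (z : ℂ) = z.re - Complex.I * z.im := by
      apply Complex.ext <;> simp
    have hz' : (z : ℂ) = z.re + Complex.I * z.im := by
      apply Complex.ext <;> simp
    rw [thetaTerm, gauss_eq, hE, hh, Complex.ofReal_exp]
    simp only [Matrix.cons_val_zero, Matrix.cons_val_one]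
    have e1 : -(Real.pi * t) * ((c * (z : ℂ) + d) * ((c * conj (z : ℂ) + d) * (z.im : ℂ)⁻¹)) =
        ((-(Real.pi * z.im * (t * c ^ 2)) : ℝ) : ℂ) +
        -Real.pi * ((t / z.im : ℝ) : ℂ) * ((c * z.re + d : ℝ) : ℂ) ^ 2 := by
      rw [hz, hz']
      push_cast
      field_simp
      ring_nf
      rw [Complex.I_sq]
      ring
    rw [e1, Complex.exp_add, hz]
    push_cast
    field_simp
    ring
  have hsum : Summable fun m : ℤ => 𝓕 h m := by
    have h1 : Summable fun m : ℤ => thetaDual z t ![c, m] :=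
      (summable_thetaDual z ht).comp_injective fun m m' hm => by simpa using congrFun hm 1
    have h2 := (h1.mul_left E⁻¹).norm
    refine Summable.of_norm (h2.congr fun m => ?_)
    rw [dual, inv_mul_cancel_left₀ hE0, norm_mul, fourier_apply, Circle.norm_coe, mul_one]
  rw [← tsum_mul_left]
  simp_rw [prim, dual]
  rw [tsum_mul_left, tsum_mul_left, Real.tsum_eq_tsum_fourier_of_rpow_decay_of_summable
    (by fun_prop) one_lt_two (quadratic_mul_gaussian_isBigO ha _) hsum]

theorem tsum_lattice {f : (Fin 2 → ℤ) → ℂ} (hf : Summable f) :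
    ∑' v, f v = ∑' c : ℤ, ∑' d : ℤ, f ![c, d] := by
  rw [← (finTwoArrowEquiv ℤ).symm.tsum_eq f]
  exact Summable.tsum_prod ((finTwoArrowEquiv ℤ).symm.summable_iff.mpr hf)

theorem sq_mul_theta (z : ℍ) {t : ℝ} (ht : 0 < t) :
    (z.im : ℂ) ^ 2 * theta z t = ∑' v, thetaDual z t v := by
  rw [theta, tsum_lattice (summable_thetaTerm z ht), tsum_lattice (summable_thetaDual z ht),
    ← tsum_mul_left]
  exact tsum_congr fun c => tsum_thetaTerm_row z ht c

/-- The functional equation of the weight two theta series. -/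
theorem theta_inv (z : ℍ) {t : ℝ} (ht : 0 < t) : theta z t⁻¹ = t ^ 3 * theta z t := by
  have hy := z.im_pos
  have hyc : (z.im : ℂ) ^ 2 ≠ 0 := pow_ne_zero 2 (by exact_mod_cast hy.ne')
  refine mul_left_cancel₀ hyc ?_
  -- Replacing t by 1/t and swapping the coordinates preserves the phase and the Gaussian in
  -- `thetaDual`. The square root contributes t and the quadratic factor t², which accounts for t³.
  rw [sq_mul_theta z (inv_pos.mpr ht), mul_left_comm, sq_mul_theta z ht, ← tsum_mul_left,
    ← (Equiv.arrowCongr (Equiv.swap (0 : Fin 2) 1) (Equiv.refl ℤ)).tsum_eq]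
  refine tsum_congr fun v => ?_
  have hsq : (√(t⁻¹ / z.im))⁻¹ = t * (√(t / z.im))⁻¹ := by
    rw [show t⁻¹ / z.im = t / z.im / t ^ 2 by field_simp, Real.sqrt_div' _ (by positivity),
      Real.sqrt_sq ht.le, inv_div, div_eq_mul_inv]
  simp only [thetaDual, Equiv.arrowCongr_apply, Equiv.coe_refl, Function.comp_apply, id,
    Equiv.symm_swap, Equiv.swap_apply_left, Equiv.swap_apply_right]
  rw [hsq, show t⁻¹ * (v 1 : ℝ) ^ 2 + v 0 ^ 2 / t⁻¹ = t * v 0 ^ 2 + v 1 ^ 2 / t by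
    rw [div_inv_eq_mul]; ring, mul_comm (v 1 : ℂ) (v 0 : ℂ)]
  have e : (z.im / (2 * Real.pi * t⁻¹) - z.im ^ 2 * ((v 0 : ℝ) / t⁻¹ + v 1) ^ 2) =
      t ^ 2 * (z.im / (2 * Real.pi * t) - z.im ^ 2 * ((v 1 : ℝ) / t + v 0) ^ 2) := by
    field_simp
    ring
  rw [e]
  push_cast
  ring

/-- Differentiating θ(1/t) = t³θ(t) at t = 1 gives 3θ(1) + 2θ'(1) = 0, written here as a sum over
the lattice. -/
theorem theta_derivative_one (z : ℍ) :
    HasSum (fun v => (3 - 2 * (Real.pi * quadForm (formMap z) v)) * thetaTerm z 1 v) 0 := by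
  obtain ⟨hs, hd⟩ := hasDerivAt_theta z one_pos
  set D := ∑' v, -(Real.pi * quadForm (formMap z) v) * thetaTerm z 1 v with hD
  have ht1 : HasDerivAt (fun t : ℝ => (t : ℂ)) 1 1 := Complex.ofRealCLM.hasDerivAt
  have h1 : HasDerivAt (fun t : ℝ => theta z t⁻¹) ((-(1 : ℝ) / 1 ^ 2) • D) 1 := by
    have hi := (hasDerivAt_id (1 : ℝ)).inv one_ne_zero
    have hd' : HasDerivAt (theta z) D ((id⁻¹ : ℝ → ℝ) 1) := by simpa using hd
    exact hd'.scomp 1 hi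
  have h2 := (ht1.pow 3).mul hd
  have h3 := h1.unique (h2.congr_of_eventuallyEq (by
    filter_upwards [Ioi_mem_nhds (zero_lt_one (α := ℝ))] with t ht
    simpa using theta_inv z ht))
  have h4 : 3 * theta z 1 + 2 * D = 0 := by
    simp at h3
    linear_combination -h3
  have h5 := ((summable_thetaTerm z one_pos).hasSum.mul_left 3).add (hs.hasSum.mul_left 2)
  rw [← hD, ← theta, h4] at h5
  refine h5.congr_fun fun v => ?_
  ring

/-- The weight t + 1 has zero second derivative, so only boundary terms remain. With w(1) = 2 and
w'(1) = 1 they are the negatives of those in `theta_derivative_one`. -/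
theorem lap_eisInt_logWeight_zero : lap 2 (eisInt (logWeight 0)) = 0 := by
  ext z
  have h := hasSum_lap_eisInt_sub (isPolyBdd_logWeight 0) (isPolyBdd_logWeightDeriv 0)
    (w'' := fun _ => 0) (by simpa using IsPolyBdd.const 0) (fun t ht => hasDerivAt_logWeight 0 ht)
    (fun t ht => by simpa using hasDerivAt_logWeightDeriv 0 ht) z
  have h0 : eisInt (fun t : ℝ => (t : ℂ) ^ 2 * 0) z = 0 := by simp [eisInt, eisKernel]
  rw [h0, sub_zero] at h
  have h1 := (theta_derivative_one z).neg
  rw [neg_zero] at h1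
  refine h.unique (h1.congr_fun fun v => ?_)
  simp [logWeight, logWeightDeriv, thetaTerm]
  ring

theorem lap_eisInt_logWeight {n : ℕ} (hn : n ≠ 0) :
    lap 2 (eisInt (logWeight n)) =
      (n : ℂ) • eisInt (logWeight (n - 1)) + (n * (n - 1) : ℂ) • eisInt (logWeight (n - 2)) := by
  ext z
  have hp : IsPolyBdd fun t =>
      (n : ℂ) * logWeight (n - 1) t + (n * (n - 1) : ℂ) * logWeight (n - 2) t :=
    ((IsPolyBdd.const _).mul (isPolyBdd_logWeight _)).add
      ((IsPolyBdd.const _).mul (isPolyBdd_logWeight _))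
  have hp2 : IsPolyBdd fun t : ℝ => (t : ℂ) ^ 2 * (((t : ℂ) ^ 2)⁻¹ *
      (n * logWeight (n - 1) t + n * (n - 1) * logWeight (n - 2) t)) := by
    simp_rw [← inv_pow]
    exact (IsPolyBdd.id.pow 2).mul ((IsPolyBdd.inv.pow 2).mul hp)
  have h := hasSum_lap_eisInt_sub (isPolyBdd_logWeight n) (isPolyBdd_logWeightDeriv n) hp2
    (fun t ht => hasDerivAt_logWeight n ht) (fun t ht => hasDerivAt_logWeightDeriv n ht) z
  -- At t = 1 every positive power of log t vanishes. The one term without a logarithm occurs for n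
  -- = 1, where its coefficient 1 + (-1) is zero.
  have hb : ∀ x : ℂ, logWeightDeriv n 1 - x * logWeight n 1 = 0 := fun x => by
    rcases n with _ | _ | n
    · exact absurd rfl hn
    · simp [logWeight, logWeightDeriv]
    · simp [logWeight, logWeightDeriv]
  simp only [hb, zero_mul, mul_zero] at h
  have h0 := sub_eq_zero.mp (h.unique hasSum_zero)
  rw [h0]
  have e : eisInt (fun t : ℝ => (t : ℂ) ^ 2 * (((t : ℂ) ^ 2)⁻¹ *
      (n * logWeight (n - 1) t + n * (n - 1) * logWeight (n - 2) t))) z =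
      eisInt (fun t => (n : ℂ) * logWeight (n - 1) t +
        (n * (n - 1) : ℂ) * logWeight (n - 2) t) z := by
    refine eisInt_congr (fun t ht => ?_) z
    have : (t : ℂ) ^ 2 ≠ 0 := pow_ne_zero 2 (by exact_mod_cast (by linarith : t ≠ 0))
    rw [mul_inv_cancel_left₀ this]
  rw [e, eisInt_add ((IsPolyBdd.const _).mul (isPolyBdd_logWeight _))
      ((IsPolyBdd.const _).mul (isPolyBdd_logWeight _)), eisInt_const_mul, eisInt_const_mul]
  rfl

end

end PolyMaass

/-! ### Analytic continuation and the Taylor coefficients at s = 0 -/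

namespace PolyMaass

noncomputable section

open UpperHalfPlane Filter Topology MeasureTheory
open scoped MatrixGroups ContDiff Manifold ModularForm ComplexConjugate

/-! ### Entire families of Eisenstein integrals -/

theorem IsPolyBdd.cpow (s : ℂ) : IsPolyBdd fun t => (t : ℂ) ^ s :=
  ⟨Complex.measurable_ofReal.pow_const s, 1, ⌈|s.re|⌉₊, zero_le_one, fun t ht => by
    rw [Complex.norm_cpow_eq_rpow_re_of_pos (by linarith), one_mul, ← Real.rpow_natCast]
    exact Real.rpow_le_rpow_of_exponent_le ht.le ((le_abs_self _).trans (Nat.le_ceil _))⟩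

/-- The weight function `(log t)ⁿ (t^{s+1} + (-1)ⁿ t^{-s})`. -/
def powWeight (n : ℕ) (s : ℂ) (t : ℝ) : ℂ :=
  (Real.log t : ℂ) ^ n * ((t : ℂ) ^ (s + 1) + (-1) ^ n * (t : ℂ) ^ (-s))

theorem isPolyBdd_powWeight (n : ℕ) (s : ℂ) : IsPolyBdd (powWeight n s) :=
  (IsPolyBdd.log.pow n).mul ((IsPolyBdd.cpow _).add ((IsPolyBdd.const _).mul (.cpow _)))

theorem hasDerivAt_powWeight (n : ℕ) (s : ℂ) {t : ℝ} (ht : 1 < t) :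
    HasDerivAt (fun s => powWeight n s t) (powWeight (n + 1) s t) s := by
  have ht0 : (t : ℂ) ≠ 0 := by exact_mod_cast (by linarith : t ≠ 0)
  have h1 := ((hasDerivAt_id s).add_const 1).const_cpow (c := (t : ℂ)) (Or.inl ht0)
  have h2 := (hasDerivAt_id s).neg.const_cpow (c := (t : ℂ)) (Or.inl ht0)
  have h := (h1.add (h2.const_mul ((-1 : ℂ) ^ n))).const_mul ((Real.log t : ℂ) ^ n)
  refine h.congr_deriv ?_
  simp only [powWeight, id, Pi.neg_apply, Complex.ofReal_log (by linarith : 0 ≤ t)]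
  ring

theorem norm_powWeight_le (n : ℕ) {s : ℂ} {M : ℕ} (h : |s.re| + 1 ≤ M) {t : ℝ} (ht : 1 < t) :
    ‖powWeight n s t‖ ≤ 2 * t ^ (n + M) := by
  have ht0 : 0 < t := by linarith
  have a1 : ‖(t : ℂ) ^ (s + 1)‖ ≤ t ^ M := by
    rw [Complex.norm_cpow_eq_rpow_re_of_pos ht0, ← Real.rpow_natCast]
    refine Real.rpow_le_rpow_of_exponent_le ht.le ?_
    simp only [Complex.add_re, Complex.one_re]
    linarith [le_abs_self s.re]
  have a2 : ‖(t : ℂ) ^ (-s)‖ ≤ t ^ M := by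
    rw [Complex.norm_cpow_eq_rpow_re_of_pos ht0, ← Real.rpow_natCast]
    refine Real.rpow_le_rpow_of_exponent_le ht.le ?_
    simp only [Complex.neg_re]
    linarith [neg_le_abs s.re]
  have a3 : ‖(Real.log t : ℂ) ^ n‖ ≤ t ^ n := by
    rw [norm_pow, Complex.norm_real, Real.norm_of_nonneg (Real.log_nonneg ht.le)]
    exact pow_le_pow_left₀ (Real.log_nonneg ht.le)
      (by linarith [Real.log_le_sub_one_of_pos ht0]) n
  have a4 : ‖(t : ℂ) ^ (s + 1) + (-1) ^ n * (t : ℂ) ^ (-s)‖ ≤ t ^ M + t ^ M := by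
    refine (norm_add_le _ _).trans (add_le_add a1 ?_)
    rw [norm_mul, norm_pow, norm_neg, norm_one, one_pow, one_mul]
    exact a2
  rw [powWeight, norm_mul]
  calc _ ≤ t ^ n * (t ^ M + t ^ M) := mul_le_mul a3 a4 (norm_nonneg _) (by positivity)
    _ = _ := by ring

theorem hasDerivAt_eisInt_powWeight (n : ℕ) (z : ℍ) (s₀ : ℂ) :
    HasDerivAt (fun s => eisInt (powWeight n s) z) (eisInt (powWeight (n + 1) s₀) z) s₀ := by
  -- On the unit ball about s₀ one has |Re s| + 1 ≤ |Re s₀| + 2, so one polynomial weight dominates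
  -- all the derivatives there.
  set M := ⌈|s₀.re| + 2⌉₊ with hM
  set W : ℝ → ℂ := fun t => 2 * (t : ℂ) ^ (n + 1 + M) with hW
  have hWp : IsPolyBdd W := (IsPolyBdd.const 2).mul (IsPolyBdd.id.pow _)
  refine (hasDerivAt_integral_of_dominated_loc_of_deriv_le (μ := latticeMeasure)
    (F := fun s p => eisKernel (powWeight n s) z p)
    (F' := fun s p => eisKernel (powWeight (n + 1) s) z p)
    (bound := fun p => ‖eisKernel W z p‖)
    (Metric.ball_mem_nhds s₀ one_pos)
    (Eventually.of_forall fun s => ((isKernel_eisKernel (isPolyBdd_powWeight n s)).integrable z).1)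
    ((isKernel_eisKernel (isPolyBdd_powWeight n s₀)).integrable z)
    ((isKernel_eisKernel (isPolyBdd_powWeight (n + 1) s₀)).integrable z).1 ?_
    ((isKernel_eisKernel hWp).integrable z).norm ?_).2
  · filter_upwards [ae_lattice_one_lt] with p hp s hs
    simp only [eisKernel, norm_mul]
    refine mul_le_mul_of_nonneg_left (mul_le_mul_of_nonneg_right ?_ (norm_nonneg _)) (norm_nonneg _)
    have hs1 : |s.re| ≤ |s₀.re| + 1 := by
      rw [Metric.mem_ball, dist_eq_norm] at hs
      have h1 := (Complex.abs_re_le_norm (s - s₀)).trans hs.le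
      rw [Complex.sub_re] at h1
      have h2 := abs_sub_abs_le_abs_sub s.re s₀.re
      linarith
    refine (norm_powWeight_le (n + 1) (M := M) ?_ hp).trans (le_of_eq ?_)
    · have := Nat.le_ceil (|s₀.re| + 2)
      rw [← hM] at this
      linarith
    · rw [hW, norm_mul, norm_pow, Complex.norm_real, Real.norm_of_nonneg (by linarith),
        Complex.norm_two]
  · filter_upwards [ae_lattice_one_lt] with p hp s _
    exact ((hasDerivAt_powWeight n s hp).mul_const _).const_mul _

theorem eisInt_powWeight_zero (n : ℕ) (z : ℍ) :
    eisInt (powWeight n 0) z = eisInt (logWeight n) z := by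
  refine eisInt_congr (fun t ht => ?_) z
  simp only [powWeight, logWeight, zero_add, Complex.cpow_one, neg_zero, Complex.cpow_zero, mul_one]
  ring

/-- The entire function of `s` continuing the doubly-completed Eisenstein series. -/
def eisCont (z : ℍ) (s : ℂ) : ℂ := s * (Real.pi / 2 * eisInt (powWeight 0 s) z)

theorem differentiable_eisCont (z : ℍ) : Differentiable ℂ (eisCont z) :=
  differentiable_id.mul (Differentiable.const_mul
    (fun s => (hasDerivAt_eisInt_powWeight 0 z s).differentiableAt) _)

theorem iteratedDeriv_succ_eisCont (n : ℕ) (z : ℍ) :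
    iteratedDeriv (n + 1) (eisCont z) = fun s => Real.pi / 2 *
      (s * eisInt (powWeight (n + 1) s) z + (n + 1) * eisInt (powWeight n s) z) := by
  induction n with
  | zero =>
    ext s
    rw [iteratedDeriv_one]
    have h := (hasDerivAt_id s).mul
      ((hasDerivAt_eisInt_powWeight 0 z s).const_mul (Real.pi / 2 : ℂ))
    have h' : HasDerivAt (eisCont z) _ s := h
    rw [h'.deriv]
    simp only [id, Nat.cast_zero]
    ring
  | succ n ih =>
    ext s
    rw [iteratedDeriv_succ, ih]
    have h := (((hasDerivAt_id s).mul (hasDerivAt_eisInt_powWeight (n + 1) z s)).add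
      ((hasDerivAt_eisInt_powWeight n z s).const_mul (n + 1 : ℂ))).const_mul (Real.pi / 2 : ℂ)
    have h' : HasDerivAt (fun s => Real.pi / 2 * (s * eisInt (powWeight (n + 1) s) z +
      (n + 1) * eisInt (powWeight n s) z)) _ s := h
    rw [h'.deriv]
    simp only [id]
    push_cast
    ring

/-! ### The Mellin transform of the theta series -/

theorem eisKernel_eq_mul_thetaTerm (w : ℝ → ℂ) (z : ℍ) (v : Fin 2 → ℤ) (t : ℝ) :
    eisKernel w z (v, t) = w t * thetaTerm z t v := by
  simp only [eisKernel, thetaTerm]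
  ring

theorem integral_count_eisKernel (w : ℝ → ℂ) (z : ℍ) {t : ℝ} (ht : 0 < t) :
    ∫ v, eisKernel w z (v, t) ∂Measure.count = w t * theta z t := by
  simp_rw [eisKernel_eq_mul_thetaTerm]
  rw [integral_const_mul, integral_countable
    (integrable_count_iff.mpr (summable_thetaTerm z ht).norm)]
  simp [theta]

theorem integrableOn_mul_theta {w : ℝ → ℂ} (hw : IsPolyBdd w) (z : ℍ) :
    IntegrableOn (fun t => w t * theta z t) (Set.Ioi 1) := by
  have h := ((isKernel_eisKernel hw).integrable z).integral_prod_right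
  refine h.congr ?_
  filter_upwards [ae_restrict_mem measurableSet_Ioi] with t ht
  exact integral_count_eisKernel w z (by linarith [Set.mem_Ioi.mp ht])

theorem integral_mul_theta {w : ℝ → ℂ} (hw : IsPolyBdd w) (z : ℍ) :
    ∫ t in Set.Ioi 1, w t * theta z t = eisInt w z := by
  rw [eisInt, latticeMeasure, integral_prod_symm _ ((isKernel_eisKernel hw).integrable z)]
  refine setIntegral_congr_fun measurableSet_Ioi fun t ht => ?_
  exact (integral_count_eisKernel w z (by linarith [Set.mem_Ioi.mp ht])).symm

theorem hasMellin_indicator_theta {w : ℝ → ℂ} (hw : IsPolyBdd w) (z : ℍ) (s : ℂ) :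
    HasMellin ((Set.Ioi 1).indicator fun t => w t * theta z t) s
      (eisInt (fun t => (t : ℂ) ^ (s - 1) * w t) z) := by
  have hp : IsPolyBdd fun t => (t : ℂ) ^ (s - 1) * w t := (IsPolyBdd.cpow _).mul hw
  have e : (fun t : ℝ => (t : ℂ) ^ (s - 1) • (Set.Ioi 1).indicator (fun t => w t * theta z t) t) =
      (Set.Ioi 1).indicator fun t : ℝ => ((t : ℂ) ^ (s - 1) * w t) * theta z t := by
    ext t
    by_cases ht : t ∈ Set.Ioi (1 : ℝ)
    · rw [Set.indicator_of_mem ht, Set.indicator_of_mem ht, smul_eq_mul, mul_assoc]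
    · rw [Set.indicator_of_notMem ht, Set.indicator_of_notMem ht, smul_zero]
  constructor
  · rw [MellinConvergent, e]
    exact ((integrableOn_mul_theta hp z).integrable_indicator measurableSet_Ioi).integrableOn
  · rw [mellin, e, setIntegral_indicator measurableSet_Ioi,
      Set.inter_eq_self_of_subset_right (Set.Ioi_subset_Ioi zero_le_one), integral_mul_theta hp]

/-- Split at t = 1 and fold (0, 1) onto (1, ∞) by the functional equation: the two halves give
t^{s+1} and t^{-s}. Absence of correction terms means that there are no poles. -/
theorem mellin_theta (z : ℍ) (s : ℂ) : mellin (theta z) (s + 2) = eisInt (powWeight 0 s) z := by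
  have m1 := hasMellin_indicator_theta (IsPolyBdd.const 1) z (s + 2)
  have m2 := hasMellin_indicator_theta (IsPolyBdd.id.pow 3) z (-(s + 2))
  set f : ℝ → ℂ := (Set.Ioi 1).indicator fun t => 1 * theta z t with hf
  set g : ℝ → ℂ := (Set.Ioi 1).indicator fun t => (t : ℂ) ^ 3 * theta z t with hg
  have m3 : MellinConvergent (fun t => g t⁻¹) (s + 2) := by
    have h := (MellinConvergent.comp_rpow (f := g) (s := s + 2) (a := -1) (by norm_num)).mpr
      (by simpa [div_neg] using m2.1)
    simpa only [Real.rpow_neg_one] using h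
  have h := (hasMellin_add m1.1 m3).2
  rw [mellin_comp_inv, m1.2, m2.2] at h
  have e : mellin (theta z) (s + 2) = mellin (fun t => f t + g t⁻¹) (s + 2) := by
    rw [mellin, mellin]
    refine setIntegral_congr_ae measurableSet_Ioi ?_
    -- Neither indicator covers t = 1, a null set.
    have h1 : ∀ᵐ t : ℝ, t ≠ 1 := by simp [ae_iff]
    filter_upwards [h1] with t ht1 ht0
    rw [Set.mem_Ioi] at ht0
    congr 1
    rcases lt_or_gt_of_ne ht1 with h | h
    · have hi : t⁻¹ ∈ Set.Ioi (1 : ℝ) := (one_lt_inv₀ ht0).mpr h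
      rw [hf, hg, Set.indicator_of_notMem (by simpa using h.le), Set.indicator_of_mem hi, zero_add,
        ← theta_inv z (inv_pos.mpr ht0), inv_inv]
    · have ht : t ∈ Set.Ioi (1 : ℝ) := h
      have hi : t⁻¹ ∉ Set.Ioi (1 : ℝ) := by
        simpa using inv_le_one_of_one_le₀ h.le
      rw [hf, hg, Set.indicator_of_mem ht, Set.indicator_of_notMem hi, add_zero, one_mul]
  rw [e, h, ← eisInt_add ((IsPolyBdd.cpow _).mul (.const 1))
    ((IsPolyBdd.cpow _).mul (IsPolyBdd.id.pow 3))]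
  refine eisInt_congr (fun t ht => ?_) z
  have ht0 : (t : ℂ) ≠ 0 := by exact_mod_cast (by linarith : t ≠ 0)
  simp only [powWeight, pow_zero, one_mul, mul_one]
  rw [← Complex.cpow_natCast, ← Complex.cpow_add _ _ ht0]
  congr 2 <;> push_cast <;> ring

/-! ### The Dirichlet series -/

/-- The terms `y^s / ((c z + d)² |c z + d|^{2s})`. -/
def eisTerm (z : ℍ) (s : ℂ) (v : Fin 2 → ℤ) : ℂ :=
  (z.im : ℂ) ^ s / (((v 0 : ℂ) * (z : ℂ) + (v 1 : ℂ)) ^ 2 *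
    ((‖(v 0 : ℂ) * (z : ℂ) + (v 1 : ℂ)‖ : ℝ) : ℂ) ^ (2 * s))

theorem norm_eisTerm (z : ℍ) {s : ℂ} (hs : 0 < s.re) (v : Fin 2 → ℤ) :
    ‖eisTerm z s v‖ = z.im ^ s.re * ‖(v 0 : ℂ) * (z : ℂ) + (v 1 : ℂ)‖ ^ (-(2 + 2 * s.re)) := by
  have h2 : 0 < 2 * s.re := by linarith
  rw [eisTerm, norm_div, norm_mul, norm_pow, Complex.norm_cpow_eq_rpow_re_of_pos z.im_pos,
    Complex.norm_cpow_eq_rpow_re_of_nonneg (norm_nonneg _) (by simpa using hs.ne'),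
    Real.rpow_neg (norm_nonneg _), Real.rpow_add_of_nonneg (norm_nonneg _) zero_le_two h2.le,
    Real.rpow_two, div_eq_mul_inv]
  simp

theorem summable_norm_eisTerm (z : ℍ) {s : ℂ} (hs : 0 < s.re) :
    Summable fun v => ‖eisTerm z s v‖ := by
  have h := (EisensteinSeries.summable_one_div_norm_rpow (k := 2 + 2 * s.re)
    (by linarith)).mul_left (z.im ^ s.re * EisensteinSeries.r z ^ (-(2 + 2 * s.re)))
  refine Summable.of_nonneg_of_le (fun v => norm_nonneg _) (fun v => ?_) h
  rw [norm_eisTerm z hs, mul_assoc]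
  have hy := z.im_pos
  exact mul_le_mul_of_nonneg_left (EisensteinSeries.summand_bound z (by linarith) v)
    (by positivity)

/-- With ℓ = cz + d one has R/Q = 1/ℓ, which accounts for two of the s + 2 powers; the remaining
Q^{-s} is y^s/|ℓ|^{2s}. -/
theorem ofReal_quadForm_cpow (z : ℍ) (s : ℂ) {v : Fin 2 → ℤ} (hv : v ≠ 0) :
    ((v 0 * conj (z : ℂ) + v 1) / z.im) ^ 2 / (quadForm (formMap z) v : ℂ) ^ (s + 2) =
      eisTerm z s v := by
  have hQ := quadForm_formMap_pos z hv
  have hQc : (quadForm (formMap z) v : ℂ) ≠ 0 := by exact_mod_cast hQ.ne'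
  have hy := z.im_pos
  have hyc : (z.im : ℂ) ≠ 0 := by exact_mod_cast hy.ne'
  have hlin : (v 0 : ℂ) * (z : ℂ) + (v 1 : ℂ) ≠ 0 := by
    intro h
    rw [ofReal_quadForm, h, zero_mul] at hQc
    exact hQc rfl
  set l := (v 0 : ℂ) * (z : ℂ) + (v 1 : ℂ) with hl
  have hl' : (v 0 : ℂ) * conj (z : ℂ) + v 1 = conj l := by simp [hl]
  have hlc : conj l ≠ 0 := by simpa using hlin
  have hn : (‖l‖ : ℂ) ≠ 0 := by exact_mod_cast (norm_pos_iff.mpr hlin).ne'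
  have e1 : (quadForm (formMap z) v : ℂ) ^ s = ((‖l‖ : ℝ) : ℂ) ^ (2 * s) / (z.im : ℂ) ^ s := by
    rw [quadForm_formMap, ← hl, Complex.normSq_eq_norm_sq, div_eq_mul_inv, Complex.ofReal_mul,
      Complex.mul_cpow_ofReal_nonneg (by positivity) (by positivity), Complex.ofReal_inv,
      Complex.inv_cpow _ _ (by
        rw [Complex.arg_ofReal_of_nonneg hy.le]; exact Real.pi_pos.ne), div_eq_mul_inv]
    congr 1
    rw [sq, Complex.ofReal_mul, Complex.mul_cpow_ofReal_nonneg (norm_nonneg _) (norm_nonneg _),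
      ← Complex.cpow_add _ _ hn, two_mul]
  rw [Complex.cpow_add _ _ hQc, e1, Complex.cpow_ofNat, ofReal_quadForm, ← hl, hl', eisTerm, ← hl]
  have hys : (z.im : ℂ) ^ s ≠ 0 := by simp [Complex.cpow_eq_zero_iff, hyc]
  have hns : ((‖l‖ : ℝ) : ℂ) ^ (2 * s) ≠ 0 := by simp [Complex.cpow_eq_zero_iff, hn]
  field_simp

theorem hasSum_mellin_theta (z : ℍ) {s : ℂ} (hs : 0 < s.re) :
    HasSum (fun v => (Real.pi : ℂ) ^ (-(s + 2)) * Complex.Gamma (s + 2) * eisTerm z s v)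
      (mellin (theta z) (s + 2)) := by
  have h := hasSum_mellin_pi_mul (ι := Fin 2 → ℤ)
    (a := fun v => ((v 0 * conj (z : ℂ) + v 1) / z.im) ^ 2)
    (q := fun v => quadForm (formMap z) v) (F := theta z) (s := s + 2) (fun v => ?_)
    (by simp; linarith) (fun t ht => ?_) ?_
  · refine h.congr_fun fun v => ?_
    by_cases hv : v = 0
    · simp [hv, eisTerm]
    · rw [mul_div_assoc, ofReal_quadForm_cpow z s hv]
  · by_cases hv : v = 0
    · left; simp [hv]
    · exact Or.inr (quadForm_formMap_pos z hv)
  · refine (summable_thetaTerm z ht).hasSum.congr_fun fun v => ?_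
    rw [thetaTerm, gauss]
    congr 4
    ring
  · refine (summable_norm_eisTerm z hs).congr fun v => ?_
    by_cases hv : v = 0
    · simp [hv, eisTerm]
    · rw [← ofReal_quadForm_cpow z s hv, norm_div,
        Complex.norm_cpow_eq_rpow_re_of_pos (quadForm_formMap_pos z hv)]

theorem eisTerm_nsmul (z : ℍ) (s : ℂ) {n : ℕ} (hn : n ≠ 0) (v : Fin 2 → ℤ) :
    eisTerm z s (n • v) = 1 / (n : ℂ) ^ (2 * s + 2) * eisTerm z s v := by
  have hnc : (n : ℂ) ≠ 0 := by exact_mod_cast hn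
  have e : ((n • v) 0 : ℂ) * (z : ℂ) + ((n • v) 1 : ℂ) =
      ((n : ℝ) : ℂ) * ((v 0 : ℂ) * (z : ℂ) + (v 1 : ℂ)) := by
    simp
    ring
  rw [eisTerm, eisTerm, e, norm_mul, Complex.norm_real, Real.norm_of_nonneg (Nat.cast_nonneg n),
    Complex.ofReal_mul, Complex.mul_cpow_ofReal_nonneg (Nat.cast_nonneg n) (norm_nonneg _),
    Complex.cpow_add _ _ hnc, Complex.cpow_ofNat, Complex.ofReal_natCast, mul_pow]
  rw [one_div, div_eq_mul_inv, div_eq_mul_inv]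
  simp only [mul_inv]
  ring

theorem tsum_coprime (f : (Fin 2 → ℤ) → ℂ) :
    ∑' p : {p : ℤ × ℤ // IsCoprime p.1 p.2}, f ![p.1.1, p.1.2] =
      ∑' v : EisensteinSeries.gammaSet 1 1 0, f v := by
  let φ : {p : ℤ × ℤ // IsCoprime p.1 p.2} ≃ EisensteinSeries.gammaSet 1 1 0 :=
    (finTwoArrowEquiv ℤ).symm.subtypeEquiv fun p => by
      rw [EisensteinSeries.mem_gammaSet_one]; rfl
  exact φ.tsum_eq fun v => f v

theorem tsum_gammaSet_eisTerm (z : ℍ) {s : ℂ} (hs : 2 * s + 2 ≠ 0) (n : ℕ) :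
    ∑' v : EisensteinSeries.gammaSet 1 n 0, eisTerm z s v = 1 / (n : ℂ) ^ (2 * s + 2) *
      ∑' v : EisensteinSeries.gammaSet 1 1 0, eisTerm z s v := by
  -- For n = 0 the only vector is 0, whose term is zero by division by zero; this matches the zero
  -- value of the n = 0 term in the series for ζ.
  rcases eq_or_ne n 0 with rfl | hn
  · have h0 : ∀ v : EisensteinSeries.gammaSet 1 0 0, eisTerm z s v = 0 := fun v => by
      have := EisensteinSeries.gammaSet_eq_gcd_mul_divIntMap v.2
      rw [zero_smul] at this
      rw [this]
      simp [eisTerm]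
    rw [tsum_congr h0, tsum_zero, Nat.cast_zero, Complex.zero_cpow hs, div_zero, zero_mul]
  · have : NeZero n := ⟨hn⟩
    rw [← tsum_mul_left, ← (EisensteinSeries.gammaSetDivGcdEquiv n).tsum_eq]
    refine tsum_congr fun v => ?_
    rw [EisensteinSeries.gammaSetDivGcdEquiv_eq, ← eisTerm_nsmul z s hn,
      ← EisensteinSeries.gammaSet_eq_gcd_mul_divIntMap v.2]

/-- Factoring out the greatest common divisor. -/
theorem tsum_eisTerm (z : ℍ) {s : ℂ} (hs : 0 < s.re) :
    ∑' v, eisTerm z s v = riemannZeta (2 * s + 2) *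
      ∑' p : {p : ℤ × ℤ // IsCoprime p.1 p.2}, eisTerm z s ![p.1.1, p.1.2] := by
  have hre : 1 < (2 * s + 2).re := by simp; linarith
  have h0 : 2 * s + 2 ≠ 0 := fun h => by rw [h] at hre; norm_num at hre
  have e1 : ∑' v, eisTerm z s v =
      ∑' (n : ℕ) (v : EisensteinSeries.gammaSet 1 n 0), eisTerm z s v := by
    have hsig := EisensteinSeries.gammaSetDivGcdSigmaEquiv.symm.summable_iff.mpr
      (summable_norm_eisTerm z hs).of_norm
    exact (EisensteinSeries.gammaSetDivGcdSigmaEquiv.symm.tsum_eq (eisTerm z s)).symm.trans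
      hsig.tsum_sigma
  rw [e1, tsum_coprime (eisTerm z s), zeta_eq_tsum_one_div_nat_cpow hre, ← tsum_mul_right]
  exact tsum_congr fun n => tsum_gammaSet_eisTerm z h0 n

/-- The completing factors agree through Γ(s+2) = (s+1)Γ(s+1) and π^{-(s+1)} = π · π^{-(s+2)}; with
the 1/2 in the coprime sum this explains the constant π/2. -/
theorem eisCont_eq_eisSeries2 (z : ℍ) {s : ℂ} (hs : 0 < s.re) : eisCont z s = eisSeries2 z s := by
  have h := (hasSum_mellin_theta z hs).tsum_eq
  have hpi : (Real.pi : ℂ) ≠ 0 := by exact_mod_cast Real.pi_ne_zero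
  rw [tsum_mul_left, tsum_eisTerm z hs, mellin_theta] at h
  have hs1 : s + 1 ≠ 0 := fun h => by
    have := congrArg Complex.re h
    simp at this
    linarith
  have hG : Complex.Gamma (s + 2) = (s + 1) * Complex.Gamma (s + 1) := by
    rw [← Complex.Gamma_add_one _ hs1]
    congr 1
    ring
  have hP : (Real.pi : ℂ) ^ (-(s + 1)) = Real.pi * (Real.pi : ℂ) ^ (-(s + 2)) := by
    rw [show -(s + 1) = 1 + -(s + 2) by ring, Complex.cpow_add _ _ hpi, Complex.cpow_one]
  rw [eisCont, eisSeries2, ← h, hG, hP]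
  simp only [eisTerm, Matrix.cons_val_zero, Matrix.cons_val_one]
  ring

theorem isContinuation_eisCont (z : ℍ) : IsContinuation z (eisCont z) :=
  ⟨differentiable_eisCont z, fun _ hs => eisCont_eq_eisSeries2 z (by linarith)⟩

theorem isContinuation_E2 (z : ℍ) : IsContinuation z (E2 z) :=
  Classical.epsilon_spec ⟨_, isContinuation_eisCont z⟩

/-- `E2` is an arbitrary choice among continuations; the identity theorem from the half-plane Re s >
1 forces it to be the explicit one. -/
theorem E2_eq_eisCont (z : ℍ) : E2 z = eisCont z := by
  have h1 := isContinuation_E2 z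
  have h2 := isContinuation_eisCont z
  have a1 : AnalyticOnNhd ℂ (E2 z) Set.univ := fun s _ => h1.entire.analyticAt s
  have a2 : AnalyticOnNhd ℂ (eisCont z) Set.univ := fun s _ => h2.entire.analyticAt s
  refine a1.eq_of_eventuallyEq a2 (z₀ := 2) ?_
  filter_upwards [(isOpen_lt continuous_const Complex.continuous_re).mem_nhds
    (show (1 : ℝ) < (2 : ℂ).re by norm_num)] with s hs
  rw [h1.eq_series s hs, h2.eq_series s hs]

theorem G_zero (z : ℍ) : G 0 z = 0 := by
  simp [G, E2_eq_eisCont, eisCont]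

theorem G_succ (n : ℕ) :
    G (n + 1) = (Real.pi / (2 * n.factorial) : ℂ) • eisInt (logWeight n) := by
  ext z
  rw [G, E2_eq_eisCont, iteratedDeriv_succ_eisCont, Pi.smul_apply, ← eisInt_powWeight_zero,
    Nat.factorial_succ, smul_eq_mul]
  have h1 : (n.factorial : ℂ) ≠ 0 := by exact_mod_cast n.factorial_ne_zero
  have h2 : ((n : ℂ) + 1) ≠ 0 := by exact_mod_cast n.succ_ne_zero
  push_cast
  field_simp
  ring

end

end PolyMaass

/-! ### Nonvanishing of the first coefficient and triangular linear algebra -/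

namespace PolyMaass

noncomputable section

open UpperHalfPlane Filter Topology MeasureTheory
open scoped MatrixGroups ContDiff Manifold ModularForm ComplexConjugate

/-! ### Nonvanishing of the first Taylor coefficient -/

/-- The point `2i`. -/
def twoI : ℍ := ⟨2 * Complex.I, by simp⟩

theorem quadForm_twoI (v : Fin 2 → ℤ) :
    quadForm (formMap twoI) v = (4 * (v 0 : ℝ) ^ 2 + (v 1 : ℝ) ^ 2) / 2 := by
  rw [quadForm_formMap]
  simp [twoI, Complex.normSq_apply, UpperHalfPlane.im]
  ring

/-- The point i would not do, since every form of weight 2 vanishes there. At 2i the shortest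
vectors (0, ±1) contribute positively and dominate. -/
theorem thetaTerm_twoI_re (t : ℝ) (v : Fin 2 → ℤ) :
    (thetaTerm twoI t v).re = ((v 1 : ℝ) ^ 2 / 4 - (v 0 : ℝ) ^ 2) *
      Real.exp (-(Real.pi * t / 2)) ^ (4 * (v 0).natAbs ^ 2 + (v 1).natAbs ^ 2) := by
  have e : gauss (formMap twoI) (v, t) = ((Real.exp (-(Real.pi * t / 2)) ^
      (4 * (v 0).natAbs ^ 2 + (v 1).natAbs ^ 2) : ℝ) : ℂ) := by
    rw [gauss, ← Real.exp_nat_mul, quadForm_twoI]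
    congr 2
    push_cast [Nat.cast_natAbs]
    rw [sq_abs, sq_abs]
    ring
  rw [thetaTerm, e, Complex.re_mul_ofReal]
  congr 1
  have hz : conj (twoI : ℂ) = -(2 * Complex.I) := by
    simp [twoI, Complex.conj_ofNat]
  have hi : twoI.im = 2 := by simp [twoI, UpperHalfPlane.im]
  rw [hz, hi, sq]
  simp
  ring

theorem exp_neg_pi_half_le {t : ℝ} (ht : 1 ≤ t) : Real.exp (-(Real.pi * t / 2)) ≤ 1 / 4 := by
  have h1 : (4 : ℝ) ≤ Real.exp (3 / 2) := by
    have := Real.exp_one_gt_d9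
    have h2 := Real.add_one_le_exp (1 / 2 : ℝ)
    rw [show (3 / 2 : ℝ) = 1 + 1 / 2 by norm_num, Real.exp_add]
    nlinarith
  have h3 : Real.exp (3 / 2) ≤ Real.exp (Real.pi * t / 2) := by
    rw [Real.exp_le_exp]
    nlinarith [Real.pi_gt_three]
  rw [Real.exp_neg, ← one_div]
  exact one_div_le_one_div_of_le (by norm_num) (h1.trans h3)

/-- Bounds the negative part of the theta terms by a geometric series with a small multiple of the
leading size x = e^{-πt/2}. -/
theorem sq_mul_pow_le {x : ℝ} (hx0 : 0 ≤ x) (hx : x ≤ 1 / 4) (C D : ℕ) :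
    (C : ℝ) ^ 2 * x ^ (4 * C ^ 2 + D ^ 2) ≤ x / 16 * ((1 / 4) ^ C * (1 / 4) ^ D) := by
  have hD : x ^ (D ^ 2) ≤ (1 / 4) ^ D := by
    refine (pow_le_pow_left₀ hx0 hx _).trans ?_
    exact pow_le_pow_of_le_one (by norm_num) (by norm_num) (Nat.le_self_pow two_ne_zero D)
  rcases C with _ | E
  · simp only [Nat.cast_zero]
    norm_num
    positivity
  have h1 : ((E + 1 : ℕ) : ℝ) ^ 2 ≤ 4 ^ (4 * E ^ 2 + 7 * E) := by
    have h2 : ((E + 1 : ℕ) : ℝ) ≤ 2 ^ E := by exact_mod_cast Nat.lt_two_pow_self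
    calc ((E + 1 : ℕ) : ℝ) ^ 2 ≤ (2 ^ E) ^ 2 := by gcongr
      _ = 4 ^ E := by rw [← pow_mul, mul_comm, pow_mul]; norm_num
      _ ≤ _ := pow_le_pow_right₀ (by norm_num) (by nlinarith)
  -- The exponent is split so that one x is kept, the power E + 3 supplies (1/4)^{E+1}/16, and the
  -- power 4E² + 7E absorbs (E + 1)².
  have e : 4 * (E + 1) ^ 2 + D ^ 2 = 1 + (E + 3) + (4 * E ^ 2 + 7 * E) + D ^ 2 := by ring
  rw [e, pow_add, pow_add, pow_add, pow_one]
  have h3 : x ^ (E + 3) ≤ (1 / 4) ^ (E + 3) := pow_le_pow_left₀ hx0 hx _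
  have h4 : x ^ (4 * E ^ 2 + 7 * E) ≤ (1 / 4) ^ (4 * E ^ 2 + 7 * E) := pow_le_pow_left₀ hx0 hx _
  calc _ ≤ 4 ^ (4 * E ^ 2 + 7 * E) *
        (x * (1 / 4) ^ (E + 3) * (1 / 4) ^ (4 * E ^ 2 + 7 * E) * (1 / 4) ^ D) := by gcongr
    _ = (4 * (1 / 4)) ^ (4 * E ^ 2 + 7 * E) * (x * (1 / 4) ^ (E + 3) * (1 / 4) ^ D) := by
        rw [mul_pow]; ring
    _ = _ := by
        rw [show (4 * (1 / 4) : ℝ) = 1 by norm_num, one_pow]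
        ring

theorem hasSum_geometric_int : HasSum (fun n : ℤ => (1 / 4 : ℝ) ^ n.natAbs) (5 / 3) := by
  have h1 := hasSum_geometric_of_lt_one (r := (1 / 4 : ℝ)) (by norm_num) (by norm_num)
  have h2 := h1.mul_left (1 / 4)
  have h3 : HasSum (fun n : ℕ => (1 / 4 : ℝ) ^ (n : ℤ).natAbs) (1 - 1 / 4)⁻¹ := by simpa using h1
  have h4 : HasSum (fun n : ℕ => (1 / 4 : ℝ) ^ (-((n : ℤ) + 1)).natAbs)
      (1 / 4 * (1 - 1 / 4)⁻¹) := by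
    refine h2.congr_fun fun n => ?_
    rw [Int.natAbs_neg, show ((n : ℤ) + 1).natAbs = n + 1 by omega, pow_succ, mul_comm]
  have h5 := HasSum.of_nat_of_neg_add_one (f := fun n : ℤ => (1 / 4 : ℝ) ^ n.natAbs) h3 h4
  have e : (1 - 1 / 4 : ℝ)⁻¹ + 1 / 4 * (1 - 1 / 4 : ℝ)⁻¹ = 5 / 3 := by norm_num
  rwa [e] at h5

theorem hasSum_geometric_lattice :
    HasSum (fun v : Fin 2 → ℤ => (1 / 4 : ℝ) ^ (v 0).natAbs * (1 / 4) ^ (v 1).natAbs)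
      (5 / 3 * (5 / 3)) := by
  have h := hasSum_geometric_int
  have hs := h.summable.mul_of_nonneg h.summable (fun n => by positivity) (fun n => by positivity)
  exact (finTwoArrowEquiv ℤ).hasSum_iff.mpr (h.mul h hs)

/-- The vectors (0, ±1) contribute x/2, while the negative parts total at most (x/16)(5/3)² =
25x/144. -/
theorem theta_twoI_re_pos {t : ℝ} (ht : 1 ≤ t) : 0 < (theta twoI t).re := by
  have hx := exp_neg_pi_half_le ht
  have hx0 := Real.exp_pos (-(Real.pi * t / 2))
  set x := Real.exp (-(Real.pi * t / 2)) with hxdef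
  have hθ := Complex.hasSum_re (summable_thetaTerm twoI (t := t) (by linarith)).hasSum
  have hb := hasSum_geometric_lattice.mul_left (x / 16)
  have hne : (![0, 1] : Fin 2 → ℤ) ≠ ![0, -1] := fun h => by
    have := congrFun h 1
    norm_num at this
  set S : Finset (Fin 2 → ℤ) := {![0, 1], ![0, -1]} with hS
  have ha : HasSum (fun v : Fin 2 → ℤ => if v ∈ S then x / 4 else 0) (x / 2) := by
    have h : HasSum (fun v : Fin 2 → ℤ => if v ∈ S then x / 4 else 0)
        (∑ v ∈ S, if v ∈ S then x / 4 else 0) :=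
      hasSum_sum_of_ne_finset_zero fun v hv => if_neg hv
    have e : (∑ v ∈ S, if v ∈ S then x / 4 else 0) = x / 2 := by
      rw [Finset.sum_congr rfl fun v hv => if_pos hv, Finset.sum_const, hS,
        Finset.card_pair hne]
      simp
      ring
    rwa [e] at h
  suffices hle : x / 2 - x / 16 * (5 / 3 * (5 / 3)) ≤ (theta twoI t).re by linarith
  refine hasSum_le (fun v => ?_) (ha.sub hb) hθ
  · rw [thetaTerm_twoI_re, ← hxdef, sub_mul]
    have h1 := sq_mul_pow_le hx0.le hx (v 0).natAbs (v 1).natAbs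
    rw [Nat.cast_natAbs, Int.cast_abs, sq_abs] at h1
    refine sub_le_sub ?_ h1
    split_ifs with hv
    · rw [hS, Finset.mem_insert, Finset.mem_singleton] at hv
      rcases hv with rfl | rfl <;> simp <;> linarith
    · positivity

/-- At 2i the integrand (t + 1) θ(t) has positive real part for every t > 1, so its integral cannot
vanish. -/
theorem eisInt_logWeight_zero_ne_zero : eisInt (logWeight 0) ≠ 0 := by
  intro h0
  have hi := integrableOn_mul_theta (isPolyBdd_logWeight 0) twoI
  have h1 := integral_mul_theta (isPolyBdd_logWeight 0) twoI
  rw [h0, Pi.zero_apply] at h1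
  have h2 := Complex.reCLM.integral_comp_comm hi
  rw [h1, map_zero] at h2
  have hpos : ∀ t ∈ Set.Ioi (1 : ℝ), 0 < Complex.reCLM (logWeight 0 t * theta twoI t) := by
    intro t ht
    rw [Set.mem_Ioi] at ht
    have e : logWeight 0 t = ((t + 1 : ℝ) : ℂ) := by simp [logWeight]
    rw [e, Complex.reCLM_apply, Complex.re_ofReal_mul]
    exact mul_pos (by linarith) (theta_twoI_re_pos ht.le)
  have h3 := (setIntegral_pos_iff_support_of_nonneg_ae (μ := volume) (s := Set.Ioi (1 : ℝ))
    (f := fun t => Complex.reCLM (logWeight 0 t * theta twoI t)) (by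
      filter_upwards [ae_restrict_mem measurableSet_Ioi] with t ht
      exact (hpos t ht).le) (Complex.reCLM.integrable_comp hi)).mpr (by
      have hsub : Set.Ioi (1 : ℝ) ⊆
          Function.support fun t => Complex.reCLM (logWeight 0 t * theta twoI t) :=
        fun t ht => (hpos t ht).ne'
      rw [Set.inter_eq_self_of_subset_right hsub]
      simp)
  exact h3.ne' h2

/-! ### The basis theorem -/

theorem G_one_ne_zero : G 1 ≠ 0 := by
  rw [G_succ]
  refine smul_ne_zero ?_ eisInt_logWeight_zero_ne_zero
  simp [Real.pi_ne_zero]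

theorem lap_G_one : lap 2 (G 1) = 0 := by
  rw [G_succ, lap_smul _ _ (isSmooth_eisInt (isPolyBdd_logWeight 0)), lap_eisInt_logWeight_zero,
    smul_zero]

/-- This is the coefficientwise form of the eigenvalue equation with eigenvalue s(s+1) = s + s². For
n = 0 the last term is G₀ = 0. -/
theorem lap_G_succ (n : ℕ) : lap 2 (G (n + 2)) = G (n + 1) + G n := by
  have h1 : (n.factorial : ℂ) ≠ 0 := by exact_mod_cast n.factorial_ne_zero
  have h2 : ((n : ℂ) + 1) ≠ 0 := by exact_mod_cast n.succ_ne_zero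
  rw [G_succ, G_succ, lap_smul _ _ (isSmooth_eisInt (isPolyBdd_logWeight _)),
    lap_eisInt_logWeight n.succ_ne_zero, smul_add, smul_smul, smul_smul, Nat.succ_eq_add_one, Nat.add_sub_cancel]
  congr 1
  · congr 1
    rw [Nat.factorial_succ]
    push_cast
    field_simp
  · rcases n with _ | n
    · ext z
      simp [G_zero]
    · rw [G_succ, show n + 1 + 1 - 2 = n by omega]
      congr 1
      rw [Nat.factorial_succ, Nat.factorial_succ]
      have h3 : (n.factorial : ℂ) ≠ 0 := by exact_mod_cast n.factorial_ne_zero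
      have h4 : ((n : ℂ) + 1) ≠ 0 := by exact_mod_cast n.succ_ne_zero
      push_cast at h2 ⊢
      field_simp
      ring

theorem isModerateForm_G (n : ℕ) : IsModerateForm 2 (G n) := by
  rcases n with _ | n
  · rw [show G 0 = 0 from funext G_zero]
    exact IsModerateForm.zero 2
  · rw [G_succ]
    exact (isModerateForm_eisInt (isPolyBdd_logWeight n)).smul _

/-- The two claims are proved together: one more Laplacian sends G_{m+2} to G_{m+1} + G_m, of which
Δ₂^m keeps only the first. -/
theorem lap_iterate_G (m : ℕ) :
    (∀ n ≤ m, (lap 2)^[m] (G n) = 0) ∧ (lap 2)^[m] (G (m + 1)) = G 1 := by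
  induction m with
  | zero =>
    refine ⟨fun n hn => ?_, rfl⟩
    rw [Nat.le_zero.mp hn]
    exact funext G_zero
  | succ m ih =>
    have hstep : ∀ n, (lap 2)^[m + 1] (G (n + 2)) =
        (lap 2)^[m] (G (n + 1)) + (lap 2)^[m] (G n) := fun n => by
      rw [Function.iterate_succ_apply, lap_G_succ,
        lap_iterate_add 2 (isModerateForm_G _).smooth (isModerateForm_G _).smooth]
    refine ⟨fun n hn => ?_, ?_⟩
    · rcases n with _ | _ | n
      · rw [show G 0 = 0 from funext G_zero, lap_iterate_zero]
      · rw [Function.iterate_succ_apply, zero_add, lap_G_one, lap_iterate_zero]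
      · rw [hstep, ih.1 _ (by omega), ih.1 _ (by omega), add_zero]
    · rw [hstep, ih.2, ih.1 _ le_rfl, add_zero]

theorem G_mem_V {n m : ℕ} (h : n ≤ m) : G n ∈ V 2 m :=
  ⟨isModerateForm_G n, (lap_iterate_G m).1 n h⟩

theorem G_succ_notMem_V (m : ℕ) : G (m + 1) ∉ V 2 m := fun h =>
  G_one_ne_zero ((lap_iterate_G m).2.symm.trans h.2)

theorem V_le_span (m : ℕ) : V 2 m ≤ Submodule.span ℂ (Set.range fun i : Fin m => G (i + 1)) := by
  induction m with
  | zero =>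
    intro f hf
    rw [show f = 0 from hf.2]
    exact Submodule.zero_mem _
  | succ m ih =>
    intro f hf
    have hl : lap 2 ((lap 2)^[m] f) = 0 :=
      (Function.iterate_succ_apply' (lap 2) m f).symm.trans hf.2
    -- The form Δ₂^m f is only known to have weak growth, which suffices to make it a multiple of
    -- G₁.
    obtain ⟨c, hc⟩ := (hf.1.isWeakForm.lap_iterate m).exists_eq_smul
      (isModerateForm_G 1).isWeakForm hl lap_G_one G_one_ne_zero
    have hG := isModerateForm_G (m + 1)
    -- Since Δ₂^m G_{m+1} = G₁, subtracting c G_{m+1} lowers the depth by one.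
    have hmem : f + (-c) • G (m + 1) ∈ V 2 m := by
      refine ⟨hf.1.add (hG.smul _), ?_⟩
      rw [lap_iterate_add 2 hf.1.smooth (hG.smooth.smul _), lap_iterate_smul 2 _ hG.smooth,
        (lap_iterate_G m).2, hc, _root_.neg_smul, add_neg_cancel]
    have h1 : Submodule.span ℂ (Set.range fun i : Fin m => G (i + 1)) ≤
        Submodule.span ℂ (Set.range fun i : Fin (m + 1) => G (i + 1)) := by
      refine Submodule.span_mono ?_
      rintro _ ⟨i, rfl⟩
      exact ⟨i.castSucc, rfl⟩
    have h2 : G (m + 1) ∈ Submodule.span ℂ (Set.range fun i : Fin (m + 1) => G (i + 1)) :=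
      Submodule.subset_span ⟨Fin.last m, rfl⟩
    have h3 := Submodule.add_mem _ (h1 (ih hmem)) (Submodule.smul_mem _ c h2)
    rwa [_root_.neg_smul, neg_add_cancel_right] at h3

/-- The space `V 2 m` contains G₁, …, G_m but not G_{m+1}, so each new coefficient is independent of
the earlier ones. -/
theorem linearIndependent_G (m : ℕ) : LinearIndependent ℂ fun i : Fin m => G (i + 1) := by
  induction m with
  | zero => exact linearIndependent_empty_type
  | succ m ih =>
    rw [linearIndependent_finSucc']
    refine ⟨ih, fun h => G_succ_notMem_V m (Submodule.span_le.mpr ?_ h)⟩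
    rintro _ ⟨i, rfl⟩
    exact G_mem_V i.isLt

/-- The Taylor coefficients `G 1, …, G m` as a basis of `V 2 m`. -/
def basisG (m : ℕ) : Module.Basis (Fin m) ℂ (V 2 m) :=
  Module.Basis.mk (v := fun i : Fin m => ⟨G (i + 1), G_mem_V i.isLt⟩)
    (LinearIndependent.of_comp (V 2 m).subtype (linearIndependent_G m)) (by
      intro f _
      have h := V_le_span m f.2
      rw [← Submodule.apply_mem_span_image_iff_mem_span (V 2 m).injective_subtype, ← Set.range_comp]
      exact h)

theorem V_eq_VHalf (m : ℕ) : V 2 m = VHalf 2 m := by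
  refine le_antisymm (fun f hf => ⟨hf.1, ?_⟩) fun f hf => ⟨hf.1, hf.2.eq_zero_of_weight_two⟩
  rw [hf.2]
  exact IsHolModForm.zero 2

end

end PolyMaass

theorem theorem1p2 :
    -- the doubly-completed series continues to an entire function of `s`
    (∀ z : UpperHalfPlane, PolyMaass.IsContinuation z (PolyMaass.E2 z)) ∧
    (∀ z : UpperHalfPlane, PolyMaass.G 0 z = 0) ∧
    ∀ m : ℕ,
      PolyMaass.V 2 m = PolyMaass.VHalf 2 m ∧
      Module.rank ℂ (PolyMaass.V 2 m) = (m : Cardinal) ∧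
      ∃ b : Module.Basis (Fin m) ℂ (PolyMaass.V 2 m),
        ∀ i : Fin m, (b i : UpperHalfPlane → ℂ) = PolyMaass.G ((i : ℕ) + 1) := by
  refine ⟨PolyMaass.isContinuation_E2, PolyMaass.G_zero, fun m =>
    ⟨PolyMaass.V_eq_VHalf m, ?_, PolyMaass.basisG m, fun i => ?_⟩⟩
  · rw [rank_eq_card_basis (PolyMaass.basisG m), Fintype.card_fin]
  · rw [PolyMaass.basisG, Module.Basis.mk_apply]
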